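/- Let $I\subseteq\mathbb R$ be a nonempty open interval, let $U\subseteq\mathbb R^2$ be a nonempty connected open set, and let $f,g$ be smooth nonconstant real functions on $I$ with $f$ nowhere zero. Consider the generalized 1+1 Zoomeron equation $$\Big(\frac{u_{xt}}{f(u)}\Big)_{tt}-\Big(\frac{u_{xt}}{f(u)}\Big)_{xx}+2\,(g(u))_{xt}=0 ,\qquad (t,x)\in U,\ u\in I. \qquad (*)$$ A Lie point symmetry of $(*)$ is a smooth vector field $X=\xi^t\partial_t+\xi^x\partial_x+\eta\,\partial_u$ on $U\times I$ (with $\xi^t,\xi^x,\eta$ functions of $t,x,u$) whose fourth prolongation $X^{[4]}$ annihilates the left-hand side of $(*)$ at every jet that satisfies $(*)$. Below, $f_0,g_0,g_1,K,c,\alpha$ are real constants, and $c\notin I$ whenever $|u-c|$ occurs. (0) $X_1=\partial_t$ and $X_2=\partial_x$ are always Lie point symmetries, and $[X_1,X_2]=0$. In each of the following four families the Lie point symmetries form a three-dimensional Lie algebra with basis $X_1,X_2,Y$ and commutators $[X_1,X_2]=0$, $[X_1,Y]=X_1$, $[X_2,Y]=X_2$, i.e. the Lie algebra $A_{3,3}$: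 (A) $f=f_0|u-c|^K$, $g=g_0+g_1|u-c|^{-\frac2\alpha-(K-1)}$ with $\alpha\ne0$; here $Y=t\partial_t+x\partial_x+\alpha(u-c)\partial_u$. (B) $f=f_0|u-c|^K$, $g=g_0+g_1\ln|u-c|$ with $K\neq1$; here $Y=t\partial_t+x\partial_x+\frac{2}{1-K}(u-c)\partial_u$. (C) $f=f_0e^{Ku}$, $g=g_0+g_1e^{-(K+\frac2\alpha)u}$ with $\alpha\ne0$; here $Y=t\partial_t+x\partial_x+\alpha\partial_u$. (D) $f=f_0e^{Ku}$, $g=g_0+g_1u$; here $Y=t\partial_t+x\partial_x-\frac2K\partial_u$. Conversely, if the Lie point symmetries of $(*)$ form the Lie algebra $A_{3,3}$, then $(f,g)$ belongs to one of the families (A)–(D). In the degenerate (limiting) cases of these families the third symmetry does not involve $t\partial_t+x\partial_x$, and the algebra is abelian ($3A_1$): if $f=f_0|u-c|^K$ and $g=g_0+g_1|u-c|^{1-K}$, or $f=f_0|u-c|$ and $g=g_0+g_1\ln|u-c|$, the Lie point symmetries have the basis $X_1,X_2,(u-c)\partial_u$; if $f=f_0e^{Ku}$ and $g=g_0+g_1e^{-Ku}$,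 they have the basis $X_1,X_2,\partial_u$. For all other $f,g$ the only Lie point symmetries are the linear combinations of $X_1$ and $X_2$, which form the abelian Lie algebra $2A_1$. -/

import Mathlib

open Set
open scoped ContDiff

noncomputable section

namespace Zoomeron

/-! ### Jets of functions `u(t, x)` and total derivatives -/

/-- A point of the jet space of functions `u(t, x)`: the two independent variables and the
derivative coordinates, `u (i, j)` standing for `∂ₜⁱ ∂ₓʲ u` (so `u (0, 0)` is the dependent
variable itself). -/
@[ext]
structure Jet where
  /-- the independent variable `t` -/
  t : ℝ
  /-- the independent variable `x` -/
  x : ℝ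
  /-- the derivative coordinates -/
  u : ℕ × ℕ → ℝ

/-- The partial derivative `∂F/∂t` on jet space. -/
def partialT (F : Jet → ℝ) (z : Jet) : ℝ :=
  deriv (fun s => F { z with t := s }) z.t

/-- The partial derivative `∂F/∂x` on jet space. -/
def partialX (F : Jet → ℝ) (z : Jet) : ℝ :=
  deriv (fun s => F { z with x := s }) z.x

/-- The partial derivative `∂F/∂u_k` on jet space, for the derivative coordinate `k = (i, j)`. -/
def partialU (k : ℕ × ℕ) (F : Jet → ℝ) (z : Jet) : ℝ :=
  deriv (fun s => F { z with u := Function.update z.u k s }) (z.u k)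

/-- The multi-indices `(i, j)` of order `i + j ≤ 4`. -/
def indices : Finset (ℕ × ℕ) :=
  (Finset.range 5 ×ˢ Finset.range 5).filter (fun k => k.1 + k.2 ≤ 4)

/-- The total derivative `D_t F = F_t + ∑ u_{i+1,j} ∂F/∂u_{i,j}` of a function of the jets of
order at most four. -/
def totalT (F : Jet → ℝ) (z : Jet) : ℝ :=
  partialT F z + ∑ k ∈ indices, z.u (k.1 + 1, k.2) * partialU k F z

/-- The total derivative `D_x F = F_x + ∑ u_{i,j+1} ∂F/∂u_{i,j}` of a function of the jets of
order at most four. -/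
def totalX (F : Jet → ℝ) (z : Jet) : ℝ :=
  partialX F z + ∑ k ∈ indices, z.u (k.1, k.2 + 1) * partialU k F z

/-! ### The equation -/

/-- The left-hand side
`(u_{xt} / f(u))_{tt} - (u_{xt} / f(u))_{xx} + 2 (g(u))_{xt}`
of the generalized 1+1 Zoomeron equation, as a function on jet space. -/
def zoomeron (f g : ℝ → ℝ) (z : Jet) : ℝ :=
  totalT (totalT fun w => w.u (1, 1) / f (w.u (0, 0))) z
    - totalX (totalX fun w => w.u (1, 1) / f (w.u (0, 0))) z
    + 2 * totalT (totalX fun w => g (w.u (0, 0))) z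

/-! ### Vector fields on `(t, x, u)`-space and their prolongations -/

/-- A vector field `ξᵗ ∂ₜ + ξˣ ∂ₓ + η ∂ᵤ` on the space of points `((t, x), u)`, with value
`((ξᵗ, ξˣ), η)`. -/
abbrev PointField : Type := (ℝ × ℝ) × ℝ → (ℝ × ℝ) × ℝ

/-- The coefficient `ξᵗ(t, x, u)` as a function on jet space. -/
def coeffT (V : PointField) (z : Jet) : ℝ := (V ((z.t, z.x), z.u (0, 0))).1.1

/-- The coefficient `ξˣ(t, x, u)` as a function on jet space. -/
def coeffX (V : PointField) (z : Jet) : ℝ := (V ((z.t, z.x), z.u (0, 0))).1.2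

/-- The coefficient `η(t, x, u)` as a function on jet space. -/
def coeffU (V : PointField) (z : Jet) : ℝ := (V ((z.t, z.x), z.u (0, 0))).2

/-- The coefficient `η^{(0,j)}` of `∂/∂u_{0,j}` in the prolongation, by the usual recursion
`η^{J,x} = D_x η^J - u_{J,t} D_x ξᵗ - u_{J,x} D_x ξˣ`. -/
def prolongX (V : PointField) : ℕ → Jet → ℝ
  | 0 => coeffU V
  | j + 1 => fun z =>
      totalX (prolongX V j) z
        - z.u (1, j) * totalX (coeffT V) z - z.u (0, j + 1) * totalX (coeffX V) z

/-- The coefficient `η^{(i,j)}` of `∂/∂u_{i,j}` in the prolongation, by the usual recursion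
`η^{J,t} = D_t η^J - u_{J,t} D_t ξᵗ - u_{J,x} D_t ξˣ`. -/
def prolong (V : PointField) : ℕ → ℕ → Jet → ℝ
  | 0, j => prolongX V j
  | i + 1, j => fun z =>
      totalT (prolong V i j) z
        - z.u (i + 1, j) * totalT (coeffT V) z - z.u (i, j + 1) * totalT (coeffX V) z

/-- The fourth prolongation `X^{[4]}` of a vector field, applied to a function on jet space. -/
def applyProlong (V : PointField) (F : Jet → ℝ) (z : Jet) : ℝ :=
  coeffT V z * partialT F z + coeffX V z * partialX F z
    + ∑ k ∈ indices, prolong V k.1 k.2 z * partialU k F z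

/-! ### Lie point symmetries -/

/-- `V` is a Lie point symmetry, over the domain `U` of the `(t, x)`-plane and the range `I` of
the dependent variable, of the generalized Zoomeron equation: it is smooth there and its fourth
prolongation annihilates the equation on the set of jets that satisfy the equation. -/
def IsLiePointSymmetry (f g : ℝ → ℝ) (U : Set (ℝ × ℝ)) (I : Set ℝ) (V : PointField) : Prop :=
  ContDiffOn ℝ ∞ V (U ×ˢ I) ∧
    ∀ z : Jet, (z.t, z.x) ∈ U → z.u (0, 0) ∈ I → zoomeron f g z = 0 →
      applyProlong V (zoomeron f g) z = 0

/-- The vector fields `e 0, …, e (n - 1)`, restricted to `U × I`, form a basis of the vector space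
of all Lie point symmetries over `U × I`. -/
def IsSymmetryBasis (f g : ℝ → ℝ) (U : Set (ℝ × ℝ)) (I : Set ℝ) {n : ℕ}
    (e : Fin n → PointField) : Prop :=
  LinearIndependent ℝ (fun i => (U ×ˢ I).domRestrict (e i)) ∧
    ∀ V : PointField, IsLiePointSymmetry f g U I V ↔
      ∃ a : Fin n → ℝ, EqOn V (fun p => ∑ i, a i • e i p) (U ×ˢ I)

/-- `e` is a basis of the symmetry algebra that identifies it with the two-dimensional abelian
Lie algebra `2A₁`. -/
def IsBasis2A1 (f g : ℝ → ℝ) (U : Set (ℝ × ℝ)) (I : Set ℝ) (e : Fin 2 → PointField) : Prop :=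
  IsSymmetryBasis f g U I e ∧
    EqOn (VectorField.lieBracket ℝ (e 0) (e 1)) 0 (U ×ˢ I)

/-- `e` is a basis of the symmetry algebra that identifies it with the three-dimensional abelian
Lie algebra `3A₁`. -/
def IsBasis3A1 (f g : ℝ → ℝ) (U : Set (ℝ × ℝ)) (I : Set ℝ) (e : Fin 3 → PointField) : Prop :=
  IsSymmetryBasis f g U I e ∧
    EqOn (VectorField.lieBracket ℝ (e 0) (e 1)) 0 (U ×ˢ I) ∧
    EqOn (VectorField.lieBracket ℝ (e 0) (e 2)) 0 (U ×ˢ I) ∧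
    EqOn (VectorField.lieBracket ℝ (e 1) (e 2)) 0 (U ×ˢ I)

/-- `e` is a basis of the symmetry algebra that identifies it with the Lie algebra `A₃,₃`:
`[e₀, e₁] = 0`, `[e₀, e₂] = e₀`, `[e₁, e₂] = e₁`. -/
def IsBasisA33 (f g : ℝ → ℝ) (U : Set (ℝ × ℝ)) (I : Set ℝ) (e : Fin 3 → PointField) : Prop :=
  IsSymmetryBasis f g U I e ∧
    EqOn (VectorField.lieBracket ℝ (e 0) (e 1)) 0 (U ×ˢ I) ∧
    EqOn (VectorField.lieBracket ℝ (e 0) (e 2)) (e 0) (U ×ˢ I) ∧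
    EqOn (VectorField.lieBracket ℝ (e 1) (e 2)) (e 1) (U ×ˢ I)

/-! ### The vector fields of the classification -/

/-- `∂ₜ` -/
def fieldT : PointField := fun _ => ((1, 0), 0)

/-- `∂ₓ` -/
def fieldX : PointField := fun _ => ((0, 1), 0)

/-- `∂ᵤ` -/
def fieldU : PointField := fun _ => ((0, 0), 1)

/-- `(u - c) ∂ᵤ` -/
def fieldDilU (c : ℝ) : PointField := fun p => ((0, 0), p.2 - c)

/-- `t ∂ₜ + x ∂ₓ + α (u - c) ∂ᵤ` -/
def fieldScale (α c : ℝ) : PointField := fun p => ((p.1.1, p.1.2), α * (p.2 - c))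

/-- `t ∂ₜ + x ∂ₓ + α ∂ᵤ` -/
def fieldShift (α : ℝ) : PointField := fun p => ((p.1.1, p.1.2), α)

/-! ### The families of coefficient functions -/

/-- `f = f₀ |u - c|^K`, `g = g₀ + g₁ |u - c|^(-2/α - (K - 1))`, with `α ≠ 0`. -/
def FamilyA (f g : ℝ → ℝ) (I : Set ℝ) (c K α : ℝ) : Prop :=
  c ∉ I ∧ α ≠ 0 ∧ ∃ f₀ g₀ g₁ : ℝ, ∀ u ∈ I,
    f u = f₀ * |u - c| ^ K ∧ g u = g₀ + g₁ * |u - c| ^ (-2 / α - (K - 1))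

/-- `f = f₀ |u - c|^K`, `g = g₀ + g₁ ln |u - c|`, with `K ≠ 1`. -/
def FamilyB (f g : ℝ → ℝ) (I : Set ℝ) (c K : ℝ) : Prop :=
  c ∉ I ∧ K ≠ 1 ∧ ∃ f₀ g₀ g₁ : ℝ, ∀ u ∈ I,
    f u = f₀ * |u - c| ^ K ∧ g u = g₀ + g₁ * Real.log |u - c|

/-- `f = f₀ exp(K u)`, `g = g₀ + g₁ exp(-(K + 2/α) u)`, with `α ≠ 0`. -/
def FamilyC (f g : ℝ → ℝ) (I : Set ℝ) (K α : ℝ) : Prop :=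
  α ≠ 0 ∧ ∃ f₀ g₀ g₁ : ℝ, ∀ u ∈ I,
    f u = f₀ * Real.exp (K * u) ∧ g u = g₀ + g₁ * Real.exp (-(K + 2 / α) * u)

/-- `f = f₀ exp(K u)`, `g = g₀ + g₁ u`. -/
def FamilyD (f g : ℝ → ℝ) (I : Set ℝ) (K : ℝ) : Prop :=
  ∃ f₀ g₀ g₁ : ℝ, ∀ u ∈ I, f u = f₀ * Real.exp (K * u) ∧ g u = g₀ + g₁ * u

/-- The degenerate power case: `f = f₀ |u - c|^K` with `g = g₀ + g₁ |u - c|^(1 - K)`, or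
`f = f₀ |u - c|` with `g = g₀ + g₁ ln |u - c|`. -/
def DegeneratePower (f g : ℝ → ℝ) (I : Set ℝ) (c : ℝ) : Prop :=
  c ∉ I ∧ ∃ f₀ g₀ g₁ : ℝ,
    (∃ K : ℝ, ∀ u ∈ I, f u = f₀ * |u - c| ^ K ∧ g u = g₀ + g₁ * |u - c| ^ (1 - K)) ∨
    (∀ u ∈ I, f u = f₀ * |u - c| ∧ g u = g₀ + g₁ * Real.log |u - c|)

/-- The degenerate exponential case: `f = f₀ exp(K u)`, `g = g₀ + g₁ exp(-K u)`. -/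
def DegenerateExp (f g : ℝ → ℝ) (I : Set ℝ) : Prop :=
  ∃ K f₀ g₀ g₁ : ℝ, ∀ u ∈ I,
    f u = f₀ * Real.exp (K * u) ∧ g u = g₀ + g₁ * Real.exp (-K * u)

end Zoomeron

end

open Zoomeron

/-! Put h = 1/f. In jet coordinates the equation reads h (u_tttx - u_txxx) plus terms of lower
order, and the symmetry condition has to hold on its zero set (`isLiePointSymmetry_iff`).
Determining equations come from comparing this condition at two jets that both solve the equation
and differ in one or two coordinates.

The coordinates u_tttt and u_xxxx do not occur in the equation. Varying them gives D_x ξᵗ = 0 and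
D_t ξˣ = 0, so locally ξᵗ = τ(t) and ξˣ = χ(x). Varying u_ttt gives η_xu = η_uu = 0, so η = A(t) u +
B(t, x). Varying u_xxx gives A' = 0. Raising u_tttx and u_txxx together gives τ'(t) = χ'(x), so both
are one constant. Varying u_ttx and u_txx gives h' B_t = h' B_x = 0, and h' ≠ 0 somewhere because f
is not constant, so B is constant. Hence over a box every symmetry is (a t + b) ∂ₜ + (a x + c) ∂ₓ +
(A u + B) ∂ᵤ (`IsLiePointSymmetry.exists_scaleField_box`), and analyticity of these fields extends
this to connected U (`IsLiePointSymmetry.exists_scaleField`).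

Such a field is a symmetry iff, for some constant κ, f' (A u + B) = κ f and g'' (A u + B) = -(κ +
2a) g' on I (`isLiePointSymmetry_scaleField_iff`). The translations b, c are free. If A ≠ 0,
dividing by A gives equations of power type centred at c = -B/A: f' (u - c) = K f and g'' (u - c) =
m g'. If A = 0 and B ≠ 0, they are of exponential type: f' = K f and g'' = m g'. If A = B = 0, then
a = 0. Integration gives the families, with a logarithm at m = -1 and a linear function at m = 0.

Conversely, for f, g of such a type the solutions (a, A, B) form a line: B = -A c with (m + K) A =
-2a, or A = 0 with (m + K) B = -2a (`PowerType.determining_iff`, `ExpType.determining_iff`). If m +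
K ≠ 0 the third generator scales t and x and the algebra is A₃,₃; if m + K = 0 then a = 0 and it is
3A₁. If a = 0 for every symmetry, all brackets are multiples of ∂ᵤ, which excludes A₃,₃
(`IsBasisA33.exists_determining`). -/

namespace Zoomeron

/-! ### Directional derivatives on jet space -/

/-- The jets whose base point lies in `U × I`. -/
def jetDomain (U : Set (ℝ × ℝ)) (I : Set ℝ) : Set Jet :=
  {z | (z.t, z.x) ∈ U ∧ z.u (0, 0) ∈ I}

/-- `F` has partial derivatives in all coordinates at `z`, and `d` is their combination with
weights `wt`, `wx`, `w` over the coordinates of order at most four. -/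
def HasDir (wt wx : ℝ) (w : ℕ × ℕ → ℝ) (F : Jet → ℝ) (z : Jet) (d : ℝ) : Prop :=
  ∃ (a b : ℝ) (c : ℕ × ℕ → ℝ),
    HasDerivAt (fun s => F { z with t := s }) a z.t ∧
    HasDerivAt (fun s => F { z with x := s }) b z.x ∧
    (∀ k, HasDerivAt (fun s => F { z with u := Function.update z.u k s }) (c k) (z.u k)) ∧
    d = wt * a + wx * b + ∑ k ∈ indices, w k * c k

/-- The choice of weights turns the same directional derivative into D_t, D_x or the prolonged
field, so one set of differentiation rules computes all three. -/
theorem HasDir.totalT_eq {F : Jet → ℝ} {z : Jet} {d : ℝ}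
    (hF : HasDir 1 0 (fun k => z.u (k.1 + 1, k.2)) F z d) : totalT F z = d := by
  obtain ⟨a, b, c, ha, hb, hc, rfl⟩ := hF
  have hk : ∀ k, partialU k F z = c k := fun k => (hc k).deriv
  simp only [totalT, partialT, ha.deriv, hk]
  ring

theorem HasDir.totalX_eq {F : Jet → ℝ} {z : Jet} {d : ℝ}
    (hF : HasDir 0 1 (fun k => z.u (k.1, k.2 + 1)) F z d) : totalX F z = d := by
  obtain ⟨a, b, c, ha, hb, hc, rfl⟩ := hF
  have hk : ∀ k, partialU k F z = c k := fun k => (hc k).deriv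
  simp only [totalX, partialX, hb.deriv, hk]
  ring

theorem HasDir.applyProlong_eq {V : PointField} {F : Jet → ℝ} {z : Jet} {d : ℝ}
    (hF : HasDir (coeffT V z) (coeffX V z) (fun k => prolong V k.1 k.2 z) F z d) :
    applyProlong V F z = d := by
  obtain ⟨a, b, c, ha, hb, hc, rfl⟩ := hF
  have hk : ∀ k, partialU k F z = c k := fun k => (hc k).deriv
  simp only [applyProlong, partialT, partialX, ha.deriv, hb.deriv, hk]

section rules

variable {wt wx : ℝ} {w : ℕ × ℕ → ℝ} {F G : Jet → ℝ} {z : Jet} {d e : ℝ}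

theorem HasDir.of_eq (hF : HasDir wt wx w F z d) (h : d = e) : HasDir wt wx w F z e := h ▸ hF

theorem HasDir.const (r : ℝ) : HasDir wt wx w (fun _ => r) z 0 :=
  ⟨0, 0, fun _ => 0, hasDerivAt_const _ _, hasDerivAt_const _ _, fun _ => hasDerivAt_const _ _,
    by simp⟩

theorem HasDir.add (hF : HasDir wt wx w F z d) (hG : HasDir wt wx w G z e) :
    HasDir wt wx w (fun z => F z + G z) z (d + e) := by
  obtain ⟨a, b, c, ha, hb, hc, rfl⟩ := hF
  obtain ⟨a', b', c', ha', hb', hc', rfl⟩ := hG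
  refine ⟨a + a', b + b', fun k => c k + c' k, ha.add ha', hb.add hb',
    fun k => (hc k).add (hc' k), ?_⟩
  simp only [mul_add, Finset.sum_add_distrib]
  ring

theorem HasDir.mul (hF : HasDir wt wx w F z d) (hG : HasDir wt wx w G z e) :
    HasDir wt wx w (fun z => F z * G z) z (d * G z + F z * e) := by
  obtain ⟨a, b, c, ha, hb, hc, rfl⟩ := hF
  obtain ⟨a', b', c', ha', hb', hc', rfl⟩ := hG
  refine ⟨a * G z + F z * a', b * G z + F z * b', fun k => c k * G z + F z * c' k, ha.mul ha',
    hb.mul hb', fun k => ?_, ?_⟩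
  · have h := (hc k).mul (hc' k)
    simp only [Function.update_eq_self] at h
    exact h
  · simp only [mul_add, Finset.sum_add_distrib, add_mul, Finset.sum_mul, Finset.mul_sum]
    have h1 : ∀ k, w k * (c k * G z) = w k * c k * G z := fun k => by ring
    have h2 : ∀ k, w k * (F z * c' k) = F z * (w k * c' k) := fun k => by ring
    simp only [h1, h2]
    ring

theorem HasDir.neg (hF : HasDir wt wx w F z d) : HasDir wt wx w (fun z => -F z) z (-d) := by
  have := (HasDir.const (wt := wt) (wx := wx) (w := w) (z := z) (-1)).mul hF
  simpa using this

theorem HasDir.sub (hF : HasDir wt wx w F z d) (hG : HasDir wt wx w G z e) :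
    HasDir wt wx w (fun z => F z - G z) z (d - e) := by
  simpa only [sub_eq_add_neg] using hF.add hG.neg

theorem HasDir.sq (hF : HasDir wt wx w F z d) :
    HasDir wt wx w (fun z => F z ^ 2) z (2 * F z * d) := by
  have := (hF.mul hF).of_eq (e := 2 * F z * d) (by ring)
  simpa only [pow_two] using this

theorem HasDir.coord {m : ℕ × ℕ} (hm : m ∈ indices) :
    HasDir wt wx w (fun z => z.u m) z (w m) := by
  refine ⟨0, 0, fun k => if k = m then 1 else 0, hasDerivAt_const _ _, hasDerivAt_const _ _,
    fun k => ?_, by simp [hm]⟩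
  by_cases hk : k = m
  · subst hk
    simpa using hasDerivAt_id' _
  · simpa [Function.update_of_ne (Ne.symm hk), hk] using hasDerivAt_const _ _

theorem zero_mem_indices : ((0, 0) : ℕ × ℕ) ∈ indices := by decide

theorem HasDir.compU {h : ℝ → ℝ} {h' : ℝ} (hh : HasDerivAt h h' (z.u (0, 0))) :
    HasDir wt wx w (fun z => h (z.u (0, 0))) z (h' * w (0, 0)) := by
  refine ⟨0, 0, fun k => if k = (0, 0) then h' else 0, hasDerivAt_const _ (h (z.u (0, 0))),
    hasDerivAt_const _ (h (z.u (0, 0))), fun k => ?_, by simp [zero_mem_indices, mul_comm]⟩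
  by_cases hk : k = (0, 0)
  · subst hk
    simpa using hh
  · simpa [Function.update_of_ne (Ne.symm hk), hk] using hasDerivAt_const _ _

theorem HasDir.compTX {φ : ℝ → ℝ → ℝ} {a b : ℝ} (ha : HasDerivAt (fun s => φ s z.x) a z.t)
    (hb : HasDerivAt (fun s => φ z.t s) b z.x) :
    HasDir wt wx w (fun z => φ z.t z.x) z (wt * a + wx * b) :=
  ⟨a, b, fun _ => 0, ha, hb, fun _ => hasDerivAt_const _ (φ z.t z.x), by simp⟩

theorem HasDir.compT {τ : ℝ → ℝ} {a : ℝ} (ha : HasDerivAt τ a z.t) :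
    HasDir wt wx w (fun z => τ z.t) z (wt * a) :=
  (HasDir.compTX (φ := fun t _ => τ t) ha (hasDerivAt_const _ _)).of_eq (by ring)

theorem HasDir.compX {χ : ℝ → ℝ} {b : ℝ} (hb : HasDerivAt χ b z.x) :
    HasDir wt wx w (fun z => χ z.x) z (wx * b) :=
  (HasDir.compTX (φ := fun _ x => χ x) (hasDerivAt_const _ _) hb).of_eq (by ring)

end rules

/-! ### Locality -/

section locality

variable {U : Set (ℝ × ℝ)} {I : Set ℝ}

theorem eventually_jetDomain_t (hU : IsOpen U) {z : Jet} (hz : z ∈ jetDomain U I) :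
    ∀ᶠ s in nhds z.t, ({ z with t := s } : Jet) ∈ jetDomain U I := by
  have hc : ContinuousAt (fun s : ℝ => (s, z.x)) z.t := by fun_prop
  filter_upwards [hc.eventually (hU.mem_nhds hz.1)] with s hs using ⟨hs, hz.2⟩

theorem eventually_jetDomain_x (hU : IsOpen U) {z : Jet} (hz : z ∈ jetDomain U I) :
    ∀ᶠ s in nhds z.x, ({ z with x := s } : Jet) ∈ jetDomain U I := by
  have hc : ContinuousAt (fun s : ℝ => (z.t, s)) z.x := by fun_prop
  filter_upwards [hc.eventually (hU.mem_nhds hz.1)] with s hs using ⟨hs, hz.2⟩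

theorem eventually_jetDomain_u (hI : IsOpen I) {z : Jet} (hz : z ∈ jetDomain U I) (k : ℕ × ℕ) :
    ∀ᶠ s in nhds (z.u k), ({ z with u := Function.update z.u k s } : Jet) ∈ jetDomain U I := by
  by_cases hk : k = (0, 0)
  · subst hk
    filter_upwards [hI.mem_nhds hz.2] with s hs
    exact ⟨hz.1, by simpa using hs⟩
  · refine Filter.Eventually.of_forall fun s => ⟨hz.1, ?_⟩
    simpa [Function.update_of_ne (Ne.symm hk)] using hz.2

theorem partialT_congr (hU : IsOpen U) {F G : Jet → ℝ} (hFG : EqOn F G (jetDomain U I)) {z : Jet}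
    (hz : z ∈ jetDomain U I) : partialT F z = partialT G z :=
  Filter.EventuallyEq.deriv_eq ((eventually_jetDomain_t hU hz).mono fun _ hs => hFG hs)

theorem partialX_congr (hU : IsOpen U) {F G : Jet → ℝ} (hFG : EqOn F G (jetDomain U I)) {z : Jet}
    (hz : z ∈ jetDomain U I) : partialX F z = partialX G z :=
  Filter.EventuallyEq.deriv_eq ((eventually_jetDomain_x hU hz).mono fun _ hs => hFG hs)

theorem partialU_congr (hI : IsOpen I) {F G : Jet → ℝ} (hFG : EqOn F G (jetDomain U I)) {z : Jet}
    (hz : z ∈ jetDomain U I) (k : ℕ × ℕ) : partialU k F z = partialU k G z :=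
  Filter.EventuallyEq.deriv_eq ((eventually_jetDomain_u hI hz k).mono fun _ hs => hFG hs)

/-- Iterated total derivatives are computed by replacing the inner one by a closed form. The closed
forms hold only over U × I, and openness makes that enough for the outer derivative. -/
theorem totalT_congr (hU : IsOpen U) (hI : IsOpen I) {F G : Jet → ℝ}
    (hFG : EqOn F G (jetDomain U I)) : EqOn (totalT F) (totalT G) (jetDomain U I) := fun z hz => by
  simp only [totalT, partialT_congr hU hFG hz, partialU_congr hI hFG hz]

theorem totalX_congr (hU : IsOpen U) (hI : IsOpen I) {F G : Jet → ℝ}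
    (hFG : EqOn F G (jetDomain U I)) : EqOn (totalX F) (totalX G) (jetDomain U I) := fun z hz => by
  simp only [totalX, partialX_congr hU hFG hz, partialU_congr hI hFG hz]

theorem HasDir.congr (hU : IsOpen U) (hI : IsOpen I) {F G : Jet → ℝ}
    (hFG : EqOn F G (jetDomain U I)) {z : Jet} (hz : z ∈ jetDomain U I) {wt wx d : ℝ}
    {w : ℕ × ℕ → ℝ} (hG : HasDir wt wx w G z d) : HasDir wt wx w F z d := by
  obtain ⟨a, b, c, ha, hb, hc, rfl⟩ := hG
  exact ⟨a, b, c,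
    ha.congr_of_eventuallyEq ((eventually_jetDomain_t hU hz).mono fun _ hs => hFG hs),
    hb.congr_of_eventuallyEq ((eventually_jetDomain_x hU hz).mono fun _ hs => hFG hs),
    fun k => (hc k).congr_of_eventuallyEq
      ((eventually_jetDomain_u hI hz k).mono fun _ hs => hFG hs), rfl⟩

variable {V W : PointField}

theorem coeffT_congr (h : EqOn V W (U ×ˢ I)) : EqOn (coeffT V) (coeffT W) (jetDomain U I) :=
  fun z hz => by simp only [coeffT]; rw [h (show ((z.t, z.x), z.u (0, 0)) ∈ U ×ˢ I from hz)]

theorem coeffX_congr (h : EqOn V W (U ×ˢ I)) : EqOn (coeffX V) (coeffX W) (jetDomain U I) :=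
  fun z hz => by simp only [coeffX]; rw [h (show ((z.t, z.x), z.u (0, 0)) ∈ U ×ˢ I from hz)]

theorem coeffU_congr (h : EqOn V W (U ×ˢ I)) : EqOn (coeffU V) (coeffU W) (jetDomain U I) :=
  fun z hz => by simp only [coeffU]; rw [h (show ((z.t, z.x), z.u (0, 0)) ∈ U ×ˢ I from hz)]

theorem prolongX_congr (hU : IsOpen U) (hI : IsOpen I) (h : EqOn V W (U ×ˢ I)) (j : ℕ) :
    EqOn (prolongX V j) (prolongX W j) (jetDomain U I) := by
  induction j with
  | zero => exact coeffU_congr h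
  | succ j ih =>
    intro z hz
    simp only [prolongX, totalX_congr hU hI ih hz, totalX_congr hU hI (coeffT_congr h) hz,
      totalX_congr hU hI (coeffX_congr h) hz]

theorem prolong_congr (hU : IsOpen U) (hI : IsOpen I) (h : EqOn V W (U ×ˢ I)) (i j : ℕ) :
    EqOn (prolong V i j) (prolong W i j) (jetDomain U I) := by
  induction i with
  | zero => exact prolongX_congr hU hI h j
  | succ i ih =>
    intro z hz
    simp only [prolong, totalT_congr hU hI ih hz, totalT_congr hU hI (coeffT_congr h) hz,
      totalT_congr hU hI (coeffX_congr h) hz]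

theorem applyProlong_congr (hU : IsOpen U) (hI : IsOpen I) (h : EqOn V W (U ×ˢ I))
    (F : Jet → ℝ) : EqOn (applyProlong V F) (applyProlong W F) (jetDomain U I) := fun z hz => by
  simp only [applyProlong, coeffT_congr h hz, coeffX_congr h hz, prolong_congr hU hI h _ _ hz]

theorem IsLiePointSymmetry.congr {f g : ℝ → ℝ} (hU : IsOpen U) (hI : IsOpen I)
    (h : EqOn V W (U ×ˢ I)) (hV : IsLiePointSymmetry f g U I V) :
    IsLiePointSymmetry f g U I W :=
  ⟨hV.1.congr fun _ hp => (h hp).symm, fun z hzU hzI hz => by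
    rw [← applyProlong_congr hU hI h _ (show z ∈ jetDomain U I from ⟨hzU, hzI⟩)]
    exact hV.2 z hzU hzI hz⟩

theorem IsLiePointSymmetry.mono {f g : ℝ → ℝ} {U' : Set (ℝ × ℝ)} (hU : U' ⊆ U)
    (hV : IsLiePointSymmetry f g U I V) : IsLiePointSymmetry f g U' I V :=
  ⟨hV.1.mono (prod_mono hU Subset.rfl), fun z hz => hV.2 z (hU hz)⟩

end locality

/-! ### The equation in jet coordinates -/

theorem contDiffOn_iterate_deriv {h : ℝ → ℝ} {I : Set ℝ} (hI : IsOpen I)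
    (hh : ContDiffOn ℝ ∞ h I) (n : ℕ) : ContDiffOn ℝ ∞ (deriv^[n] h) I := by
  induction n with
  | zero => exact hh
  | succ n ih =>
    rw [Function.iterate_succ_apply']
    exact ih.deriv_of_isOpen hI (by simp)

theorem hasDerivAt_iterate_deriv {h : ℝ → ℝ} {I : Set ℝ} (hI : IsOpen I)
    (hh : ContDiffOn ℝ ∞ h I) (n : ℕ) {u : ℝ} (hu : u ∈ I) :
    HasDerivAt (deriv^[n] h) (deriv^[n + 1] h u) u := by
  rw [Function.iterate_succ_apply']
  exact (((contDiffOn_iterate_deriv hI hh n).contDiffAt (hI.mem_nhds hu)).differentiableAt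
    (by simp)).hasDerivAt

/-- The left-hand side of the Zoomeron equation in jet coordinates, with `h = 1 / f`. -/
noncomputable def zoomPoly (h g : ℝ → ℝ) (z : Jet) : ℝ :=
  h (z.u (0, 0)) * (z.u (3, 1) - z.u (1, 3))
    + 2 * deriv^[1] h (z.u (0, 0)) * (z.u (1, 0) * z.u (2, 1) - z.u (0, 1) * z.u (1, 2))
    + (deriv^[2] h (z.u (0, 0)) * (z.u (1, 0) ^ 2 - z.u (0, 1) ^ 2)
      + deriv^[1] h (z.u (0, 0)) * (z.u (2, 0) - z.u (0, 2))) * z.u (1, 1)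
    + 2 * deriv^[1] g (z.u (0, 0)) * z.u (1, 1)
    + 2 * deriv^[2] g (z.u (0, 0)) * (z.u (1, 0) * z.u (0, 1))

/-- The derivative of `zoomPoly` in the direction with jet components `e`. -/
noncomputable def zoomVar (h g : ℝ → ℝ) (e : ℕ × ℕ → ℝ) (z : Jet) : ℝ :=
  deriv^[1] h (z.u (0, 0)) * e (0, 0) * (z.u (3, 1) - z.u (1, 3))
    + h (z.u (0, 0)) * (e (3, 1) - e (1, 3))
    + 2 * deriv^[2] h (z.u (0, 0)) * e (0, 0)
      * (z.u (1, 0) * z.u (2, 1) - z.u (0, 1) * z.u (1, 2))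
    + 2 * deriv^[1] h (z.u (0, 0)) * (e (1, 0) * z.u (2, 1) + z.u (1, 0) * e (2, 1)
      - e (0, 1) * z.u (1, 2) - z.u (0, 1) * e (1, 2))
    + (deriv^[3] h (z.u (0, 0)) * e (0, 0) * (z.u (1, 0) ^ 2 - z.u (0, 1) ^ 2)
      + 2 * deriv^[2] h (z.u (0, 0)) * (z.u (1, 0) * e (1, 0) - z.u (0, 1) * e (0, 1))
      + deriv^[2] h (z.u (0, 0)) * e (0, 0) * (z.u (2, 0) - z.u (0, 2))
      + deriv^[1] h (z.u (0, 0)) * (e (2, 0) - e (0, 2))) * z.u (1, 1)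
    + (deriv^[2] h (z.u (0, 0)) * (z.u (1, 0) ^ 2 - z.u (0, 1) ^ 2)
      + deriv^[1] h (z.u (0, 0)) * (z.u (2, 0) - z.u (0, 2))) * e (1, 1)
    + 2 * deriv^[1] g (z.u (0, 0)) * e (1, 1)
    + 2 * deriv^[2] g (z.u (0, 0)) * e (0, 0) * z.u (1, 1)
    + 2 * deriv^[3] g (z.u (0, 0)) * e (0, 0) * (z.u (1, 0) * z.u (0, 1))
    + 2 * deriv^[2] g (z.u (0, 0)) * (e (1, 0) * z.u (0, 1) + z.u (1, 0) * e (0, 1))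

section

variable {f g : ℝ → ℝ} {U : Set (ℝ × ℝ)} {I : Set ℝ}

theorem zoomeron_eqOn (hU : IsOpen U) (hI : IsOpen I) (hh : ContDiffOn ℝ ∞ (fun u => (f u)⁻¹) I)
    (hg : ContDiffOn ℝ ∞ g I) :
    EqOn (zoomeron f g) (zoomPoly (fun u => (f u)⁻¹) g) (jetDomain U I) := by
  set h : ℝ → ℝ := fun u => (f u)⁻¹ with hdef
  have mk : ∀ m ∈ indices, ∀ (wt wx : ℝ) (w : ℕ × ℕ → ℝ) (z : Jet),
      HasDir wt wx w (fun z => z.u m) z (w m) := fun m hm _ _ _ _ => HasDir.coord hm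
  have hH : ∀ n, ∀ (wt wx : ℝ) (w : ℕ × ℕ → ℝ), ∀ z ∈ jetDomain U I,
      HasDir wt wx w (fun z => deriv^[n] h (z.u (0, 0))) z
        (deriv^[n + 1] h (z.u (0, 0)) * w (0, 0)) := fun n _ _ _ z hz =>
    HasDir.compU (hasDerivAt_iterate_deriv hI hh n hz.2)
  have hG : ∀ n, ∀ (wt wx : ℝ) (w : ℕ × ℕ → ℝ), ∀ z ∈ jetDomain U I,
      HasDir wt wx w (fun z => deriv^[n] g (z.u (0, 0))) z
        (deriv^[n + 1] g (z.u (0, 0)) * w (0, 0)) := fun n _ _ _ z hz =>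
    HasDir.compU (hasDerivAt_iterate_deriv hI hg n hz.2)
  have e0 : (fun w : Jet => w.u (1, 1) / f (w.u (0, 0)))
      = fun w => w.u (1, 1) * deriv^[0] h (w.u (0, 0)) := by
    funext w; simp [hdef, div_eq_mul_inv]
  have e1 : EqOn (totalT fun w => w.u (1, 1) / f (w.u (0, 0)))
      (fun z => z.u (2, 1) * deriv^[0] h (z.u (0, 0))
        + z.u (1, 1) * (deriv^[1] h (z.u (0, 0)) * z.u (1, 0))) (jetDomain U I) := fun z hz => by
    rw [e0]
    exact ((mk (1, 1) (by decide) _ _ _ z).mul (hH 0 _ _ _ z hz)).totalT_eq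
  have e2 : EqOn (totalX fun w => w.u (1, 1) / f (w.u (0, 0)))
      (fun z => z.u (1, 2) * deriv^[0] h (z.u (0, 0))
        + z.u (1, 1) * (deriv^[1] h (z.u (0, 0)) * z.u (0, 1))) (jetDomain U I) := fun z hz => by
    rw [e0]
    exact ((mk (1, 1) (by decide) _ _ _ z).mul (hH 0 _ _ _ z hz)).totalX_eq
  have e3 : EqOn (totalX fun w => g (w.u (0, 0)))
      (fun z => deriv^[1] g (z.u (0, 0)) * z.u (0, 1)) (jetDomain U I) := fun z hz =>
    (hG 0 _ _ _ z hz).totalX_eq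
  intro z hz
  have t1 := (((mk (2, 1) (by decide) _ _ _ z).mul (hH 0 _ _ _ z hz)).add
    ((mk (1, 1) (by decide) _ _ _ z).mul
      ((hH 1 _ _ _ z hz).mul (mk (1, 0) (by decide) _ _ _ z)))).totalT_eq
  have t2 := (((mk (1, 2) (by decide) _ _ _ z).mul (hH 0 _ _ _ z hz)).add
    ((mk (1, 1) (by decide) _ _ _ z).mul
      ((hH 1 _ _ _ z hz).mul (mk (0, 1) (by decide) _ _ _ z)))).totalX_eq
  have t3 := ((hG 1 _ _ _ z hz).mul (mk (0, 1) (by decide) _ _ _ z)).totalT_eq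
  rw [zoomeron, totalT_congr hU hI e1 hz, totalX_congr hU hI e2 hz, totalT_congr hU hI e3 hz,
    t1, t2, t3]
  simp only [zoomPoly, Function.iterate_zero, id, zero_add, Nat.reduceAdd]
  ring

/-- The closed form of the left-hand side holds on an open set of jets, so it may be differentiated
in its place. -/
theorem applyProlong_zoomeron (hU : IsOpen U) (hI : IsOpen I)
    (hh : ContDiffOn ℝ ∞ (fun u => (f u)⁻¹) I) (hg : ContDiffOn ℝ ∞ g I) (V : PointField)
    {z : Jet} (hz : z ∈ jetDomain U I) :
    applyProlong V (zoomeron f g) z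
      = zoomVar (fun u => (f u)⁻¹) g (fun k => prolong V k.1 k.2 z) z := by
  have key := zoomeron_eqOn (f := f) hU hI hh hg
  set h : ℝ → ℝ := fun u => (f u)⁻¹ with hdef
  set wt := coeffT V z
  set wx := coeffX V z
  set w : ℕ × ℕ → ℝ := fun k => prolong V k.1 k.2 z with hw
  have mk : ∀ m ∈ indices, HasDir wt wx w (fun z => z.u m) z (w m) := fun m hm => HasDir.coord hm
  have hH : ∀ n, HasDir wt wx w (fun z => deriv^[n] h (z.u (0, 0))) z
        (deriv^[n + 1] h (z.u (0, 0)) * w (0, 0)) := fun n =>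
    HasDir.compU (hasDerivAt_iterate_deriv hI hh n hz.2)
  have hG : ∀ n, HasDir wt wx w (fun z => deriv^[n] g (z.u (0, 0))) z
        (deriv^[n + 1] g (z.u (0, 0)) * w (0, 0)) := fun n =>
    HasDir.compU (hasDerivAt_iterate_deriv hI hg n hz.2)
  have h2 := HasDir.const (wt := wt) (wx := wx) (w := w) (z := z) 2
  have m10 := mk (1, 0) (by decide)
  have m01 := mk (0, 1) (by decide)
  have m11 := mk (1, 1) (by decide)
  have all := (((((hH 0).mul ((mk (3, 1) (by decide)).sub (mk (1, 3) (by decide)))).add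
    ((h2.mul (hH 1)).mul ((m10.mul (mk (2, 1) (by decide))).sub
      (m01.mul (mk (1, 2) (by decide)))))).add
    ((((hH 2).mul (m10.sq.sub m01.sq)).add
      ((hH 1).mul ((mk (2, 0) (by decide)).sub (mk (0, 2) (by decide))))).mul m11)).add
    ((h2.mul (hG 1)).mul m11)).add ((h2.mul (hG 2)).mul (m10.mul m01))
  refine ((all.congr hU hI key hz).of_eq ?_).applyProlong_eq
  simp only [zoomVar, Function.iterate_zero, id, zero_add, Nat.reduceAdd]
  ring

/-- The symmetry condition in jet coordinates. -/
theorem isLiePointSymmetry_iff (hU : IsOpen U) (hI : IsOpen I)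
    (hh : ContDiffOn ℝ ∞ (fun u => (f u)⁻¹) I) (hg : ContDiffOn ℝ ∞ g I) (V : PointField) :
    IsLiePointSymmetry f g U I V ↔ ContDiffOn ℝ ∞ V (U ×ˢ I) ∧
      ∀ z ∈ jetDomain U I, zoomPoly (fun u => (f u)⁻¹) g z = 0 →
        zoomVar (fun u => (f u)⁻¹) g (fun k => prolong V k.1 k.2 z) z = 0 := by
  refine and_congr_right fun _ => ⟨fun H z hz h0 => ?_, fun H z hzU hzI h0 => ?_⟩
  · rw [← applyProlong_zoomeron hU hI hh hg V hz]
    exact H z hz.1 hz.2 (by rwa [zoomeron_eqOn hU hI hh hg hz])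
  · have hz : z ∈ jetDomain U I := ⟨hzU, hzI⟩
    rw [applyProlong_zoomeron hU hI hh hg V hz]
    exact H z hz (by rwa [← zoomeron_eqOn hU hI hh hg hz])

end

/-! ### Which jet coordinates occur in the prolongation coefficients -/

/-- The jet `z` with the coordinate `u_k` replaced by `s`. -/
def Jet.set (z : Jet) (k : ℕ × ℕ) (s : ℝ) : Jet := { z with u := Function.update z.u k s }

@[simp] theorem Jet.set_t (z : Jet) (k : ℕ × ℕ) (s : ℝ) : (z.set k s).t = z.t := rfl

@[simp] theorem Jet.set_x (z : Jet) (k : ℕ × ℕ) (s : ℝ) : (z.set k s).x = z.x := rfl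

theorem Jet.set_u (z : Jet) (k m : ℕ × ℕ) (s : ℝ) :
    (z.set k s).u m = if m = k then s else z.u m := Function.update_apply ..

/-- `F` depends only on `t`, `x` and the coordinates `u_k` with `k ∈ S`. -/
def OnlyUses (S : Set (ℕ × ℕ)) (F : Jet → ℝ) : Prop :=
  ∀ z z' : Jet, z.t = z'.t → z.x = z'.x → (∀ k ∈ S, z.u k = z'.u k) → F z = F z'

section

variable {S T : Set (ℕ × ℕ)} {F G : Jet → ℝ}

theorem OnlyUses.mono (hF : OnlyUses S F) (h : S ⊆ T) : OnlyUses T F :=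
  fun z z' ht hx hu => hF z z' ht hx fun k hk => hu k (h hk)

theorem OnlyUses.coord {m : ℕ × ℕ} (hm : m ∈ S) : OnlyUses S fun z => z.u m :=
  fun _ _ _ _ hu => hu m hm

theorem OnlyUses.sub (hF : OnlyUses S F) (hG : OnlyUses S G) : OnlyUses S fun z => F z - G z :=
  fun z z' ht hx hu => by simp only [hF z z' ht hx hu, hG z z' ht hx hu]

theorem OnlyUses.mul (hF : OnlyUses S F) (hG : OnlyUses S G) : OnlyUses S fun z => F z * G z :=
  fun z z' ht hx hu => by simp only [hF z z' ht hx hu, hG z z' ht hx hu]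

theorem OnlyUses.set_eq (hF : OnlyUses S F) {m : ℕ × ℕ} (hm : m ∉ S) (z : Jet) (s : ℝ) :
    F (z.set m s) = F z :=
  hF _ _ rfl rfl fun k hk => by
    rw [Jet.set_u, if_neg (by rintro rfl; exact hm hk)]

theorem OnlyUses.partialT (hF : OnlyUses S F) : OnlyUses S (partialT F) := by
  intro z z' ht hx hu
  have : (fun s => F { z with t := s }) = fun s => F { z' with t := s } :=
    funext fun s => hF _ _ rfl hx hu
  simp only [Zoomeron.partialT, this, ht]

theorem OnlyUses.partialX (hF : OnlyUses S F) : OnlyUses S (partialX F) := by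
  intro z z' ht hx hu
  have : (fun s => F { z with x := s }) = fun s => F { z' with x := s } :=
    funext fun s => hF _ _ ht rfl hu
  simp only [Zoomeron.partialX, this, hx]

/-- No smoothness is needed: in a coordinate that does not occur, the function being differentiated
is constant. This makes the bookkeeping below valid for arbitrary vector fields. -/
theorem OnlyUses.partialU_eq_zero (hF : OnlyUses S F) {k : ℕ × ℕ} (hk : k ∉ S) (z : Jet) :
    partialU k F z = 0 := by
  have : (fun s => F { z with u := Function.update z.u k s }) = fun _ => F z :=
    funext fun s => hF.set_eq hk z s
  simp [Zoomeron.partialU, this]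

theorem OnlyUses.partialU (hF : OnlyUses S F) (k : ℕ × ℕ) : OnlyUses S (partialU k F) := by
  intro z z' ht hx hu
  by_cases hk : k ∈ S
  · have : (fun s => F { z with u := Function.update z.u k s })
        = fun s => F { z' with u := Function.update z'.u k s } :=
      funext fun s => hF _ _ ht hx fun m hm => by
        simp only [Function.update_apply, hu m hm]
    simp only [Zoomeron.partialU, this, hu k hk]
  · rw [hF.partialU_eq_zero hk, hF.partialU_eq_zero hk]

theorem OnlyUses.totalT (hF : OnlyUses S F) (hST : S ⊆ T)
    (h : ∀ k ∈ S, (k.1 + 1, k.2) ∈ T) : OnlyUses T (totalT F) := by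
  intro z z' ht hx hu
  have hS : ∀ k ∈ S, z.u k = z'.u k := fun k hk => hu k (hST hk)
  simp only [Zoomeron.totalT, hF.partialT z z' ht hx hS]
  congr 1
  refine Finset.sum_congr rfl fun k _ => ?_
  by_cases hk : k ∈ S
  · rw [hu _ (h k hk), hF.partialU k z z' ht hx hS]
  · simp [hF.partialU_eq_zero hk]

theorem OnlyUses.totalX (hF : OnlyUses S F) (hST : S ⊆ T)
    (h : ∀ k ∈ S, (k.1, k.2 + 1) ∈ T) : OnlyUses T (totalX F) := by
  intro z z' ht hx hu
  have hS : ∀ k ∈ S, z.u k = z'.u k := fun k hk => hu k (hST hk)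
  simp only [Zoomeron.totalX, hF.partialX z z' ht hx hS]
  congr 1
  refine Finset.sum_congr rfl fun k _ => ?_
  by_cases hk : k ∈ S
  · rw [hu _ (h k hk), hF.partialU k z z' ht hx hS]
  · simp [hF.partialU_eq_zero hk]

theorem OnlyUses.totalX_eq (hF : OnlyUses {(0, 0)} F) (z : Jet) :
    Zoomeron.totalX F z = Zoomeron.partialX F z + z.u (0, 1) * Zoomeron.partialU (0, 0) F z := by
  rw [Zoomeron.totalX, Finset.sum_eq_single_of_mem (0, 0) zero_mem_indices]
  intro k _ hk
  rw [hF.partialU_eq_zero (by simpa using hk), mul_zero]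

theorem OnlyUses.totalT_eq (hF : OnlyUses {(0, 0)} F) (z : Jet) :
    Zoomeron.totalT F z = Zoomeron.partialT F z + z.u (1, 0) * Zoomeron.partialU (0, 0) F z := by
  rw [Zoomeron.totalT, Finset.sum_eq_single_of_mem (0, 0) zero_mem_indices]
  intro k _ hk
  rw [hF.partialU_eq_zero (by simpa using hk), mul_zero]

/-- A total derivative is affine in the coordinates of top order. -/
theorem OnlyUses.totalT_set (hF : OnlyUses S F) {i j : ℕ} (hm : (i + 1, j) ∉ S)
    (hij : (i, j) ∈ indices) (z : Jet) (s : ℝ) :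
    Zoomeron.totalT F (z.set (i + 1, j) s)
      = Zoomeron.totalT F z + (s - z.u (i + 1, j)) * Zoomeron.partialU (i, j) F z := by
  simp only [Zoomeron.totalT, hF.partialT.set_eq hm, (hF.partialU _).set_eq hm]
  rw [← Finset.add_sum_erase _ _ hij, ← Finset.add_sum_erase indices _ hij]
  have : ∀ k ∈ indices.erase (i, j), (z.set (i + 1, j) s).u (k.1 + 1, k.2)
      * Zoomeron.partialU k F z = z.u (k.1 + 1, k.2) * Zoomeron.partialU k F z := by
    intro k hk
    have hne : (k.1 + 1, k.2) ≠ (i + 1, j) := fun h => by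
      simp only [Prod.mk.injEq, add_left_inj] at h
      exact Finset.ne_of_mem_erase hk (Prod.ext h.1 h.2)
    rw [Jet.set_u, if_neg hne]
  rw [Finset.sum_congr rfl this, Jet.set_u, if_pos rfl]
  ring

theorem partialU_eq_of_set {m : ℕ × ℕ} {z : Jet} {c : ℝ}
    (h : ∀ s, F (z.set m s) = F z + (s - z.u m) * c) : Zoomeron.partialU m F z = c := by
  have h' : (fun s => F { z with u := Function.update z.u m s })
      = fun s => F z + (s - z.u m) * c := funext h
  rw [Zoomeron.partialU, h']
  simp

end

variable (V : PointField)

theorem onlyUses_coeffT : OnlyUses {(0, 0)} (coeffT V) := fun z z' ht hx hu => by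
  simp only [coeffT, ht, hx, hu (0, 0) rfl]

theorem onlyUses_coeffX : OnlyUses {(0, 0)} (coeffX V) := fun z z' ht hx hu => by
  simp only [coeffX, ht, hx, hu (0, 0) rfl]

theorem onlyUses_coeffU : OnlyUses {(0, 0)} (coeffU V) := fun z z' ht hx hu => by
  simp only [coeffU, ht, hx, hu (0, 0) rfl]

theorem OnlyUses.totalT_point {F : Jet → ℝ} (hF : OnlyUses {(0, 0)} F) :
    OnlyUses {(0, 0), (1, 0)} (Zoomeron.totalT F) :=
  hF.totalT (by simp) (by simp)

theorem OnlyUses.totalX_point {F : Jet → ℝ} (hF : OnlyUses {(0, 0)} F) :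
    OnlyUses {(0, 0), (0, 1)} (Zoomeron.totalX F) :=
  hF.totalX (by simp) (by simp)

/-- Coordinates that can occur in the coefficient `η^{(i,j)}` for a general vector field. -/
def prolongSupport (i j : ℕ) : Set (ℕ × ℕ) := {k | k.1 ≤ i + 1 ∧ k.2 ≤ j + 1 ∧ k.1 + k.2 ≤ i + j}

theorem onlyUses_prolongX (j : ℕ) : OnlyUses (prolongSupport 0 j) (prolongX V j) := by
  induction j with
  | zero =>
    exact (onlyUses_coeffU V).mono (by simp [prolongSupport])
  | succ j ih =>
    have hsub : ({(0, 0), (0, 1)} : Set (ℕ × ℕ)) ⊆ prolongSupport 0 (j + 1) := by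
      rintro k (rfl | rfl) <;> simp [prolongSupport]
    refine ((ih.totalX ?_ ?_).sub ((OnlyUses.coord ?_).mul
      ((onlyUses_coeffT V).totalX_point.mono hsub))).sub
      ((OnlyUses.coord ?_).mul ((onlyUses_coeffX V).totalX_point.mono hsub))
    all_goals intros; simp only [prolongSupport, mem_ofPred_eq, Set.subset_def] at *
    all_goals grind

/-- The bounds exceed i and j by one because the terms u_{J,t} D_x ξᵗ and u_{J,x} D_t ξˣ trade one
x-derivative for a t-derivative or conversely. The order stays at most i + j. -/
theorem onlyUses_prolong (i j : ℕ) : OnlyUses (prolongSupport i j) (prolong V i j) := by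
  induction i with
  | zero => exact onlyUses_prolongX V j
  | succ i ih =>
    have hsub : ({(0, 0), (1, 0)} : Set (ℕ × ℕ)) ⊆ prolongSupport (i + 1) j := by
      rintro k (rfl | rfl) <;> simp [prolongSupport]; omega
    refine ((ih.totalT ?_ ?_).sub ((OnlyUses.coord ?_).mul
      ((onlyUses_coeffT V).totalT_point.mono hsub))).sub
      ((OnlyUses.coord ?_).mul ((onlyUses_coeffX V).totalT_point.mono hsub))
    all_goals intros; simp only [prolongSupport, mem_ofPred_eq, Set.subset_def] at *
    all_goals grind

/-- A coordinate of top order enters D_t η^{(i,j)} only through the chain rule. The conditions `h₁`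
and `h₂` keep it distinct from the two explicit factors u_{i+1,j} and u_{i,j+1} of the recursion,
and `hm` keeps it distinct from u_t, which occurs in D_t ξᵗ and D_t ξˣ. -/
theorem prolong_succ_set {i j m n : ℕ} (h₀ : m + n = i + j) (h₁ : m ≠ i) (h₂ : m + 1 ≠ i)
    (hmn : (m, n) ∈ indices) (hm : m ≠ 0) (z : Jet) (s : ℝ) :
    prolong V (i + 1) j (z.set (m + 1, n) s)
      = prolong V (i + 1) j z + (s - z.u (m + 1, n)) * partialU (m, n) (prolong V i j) z := by
  have hS : (m + 1, n) ∉ prolongSupport i j := by simp [prolongSupport]; omega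
  simp only [prolong]
  rw [(onlyUses_prolong V i j).totalT_set hS hmn,
    (onlyUses_coeffT V).totalT_point.set_eq (by simp [hm]),
    (onlyUses_coeffX V).totalT_point.set_eq (by simp [hm]), Jet.set_u, Jet.set_u,
    if_neg (by simp; omega), if_neg (by simp; omega)]
  ring

theorem partialU_prolongX_one (z : Jet) :
    partialU (1, 0) (prolongX V 1) z = -totalX (coeffT V) z := by
  refine partialU_eq_of_set fun s => ?_
  simp only [prolongX]
  rw [(onlyUses_coeffU V).totalX_point.set_eq (by simp),
    (onlyUses_coeffT V).totalX_point.set_eq (by simp),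
    (onlyUses_coeffX V).totalX_point.set_eq (by simp), Jet.set_u, Jet.set_u,
    if_pos rfl, if_neg (by simp)]
  ring

/-- The slope -D_x ξᵗ of η^{(0,1)} in u_t is handed on by each D_t: to u_tt in η^{(1,1)}, to u_ttt
in η^{(2,1)} and to u_tttt in η^{(3,1)}. -/
theorem prolong_three_one_set (z : Jet) (s : ℝ) :
    prolong V 3 1 (z.set (4, 0) s)
      = prolong V 3 1 z - (s - z.u (4, 0)) * totalX (coeffT V) z := by
  have h1 : partialU (2, 0) (prolong V 1 1) z = -totalX (coeffT V) z := by
    rw [← partialU_prolongX_one]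
    exact partialU_eq_of_set fun s => prolong_succ_set V (i := 0) (j := 1) (m := 1) (n := 0)
      rfl (by simp) (by simp) (by decide) (by simp) z s
  have h2 : partialU (3, 0) (prolong V 2 1) z = -totalX (coeffT V) z := by
    rw [← h1]
    exact partialU_eq_of_set fun s => prolong_succ_set V (i := 1) (j := 1) (m := 2) (n := 0)
      rfl (by simp) (by simp) (by decide) (by simp) z s
  rw [prolong_succ_set V (i := 2) (j := 1) (m := 3) (n := 0) rfl (by simp) (by simp) (by decide)
    (by simp) z s, h2]
  ring

/-- No chain is needed here, unlike for u_tttt: the recursion takes the x-derivatives first, so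
u_xxxx appears only as an explicit factor in the last step. -/
theorem prolong_one_three_set (z : Jet) (s : ℝ) :
    prolong V 1 3 (z.set (0, 4) s)
      = prolong V 1 3 z - (s - z.u (0, 4)) * totalT (coeffX V) z := by
  have hT : OnlyUses {k | k ≠ (0, 4)} (totalT (prolong V 0 3)) :=
    (onlyUses_prolong V 0 3).totalT (by intro k; simp only [prolongSupport, mem_ofPred_eq]; grind)
      (by simp)
  have e : prolong V 1 3 = fun z => totalT (prolong V 0 3) z
      - z.u (1, 3) * totalT (coeffT V) z - z.u (0, 4) * totalT (coeffX V) z := rfl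
  simp only [e]
  rw [hT.set_eq (by simp),
    (onlyUses_coeffT V).totalT_point.set_eq (by simp),
    (onlyUses_coeffX V).totalT_point.set_eq (by simp), Jet.set_u, Jet.set_u,
    if_neg (by simp), if_pos (by simp)]
  ring

/-! ### Vanishing of D_x ξᵗ and D_t ξˣ -/

section

variable {V} {f g : ℝ → ℝ} {U : Set (ℝ × ℝ)} {I : Set ℝ}

/-- Raising u_tttt by one keeps a solution jet a solution, and changes the symmetry condition only
by -h D_x ξᵗ, with h ≠ 0. -/
theorem IsLiePointSymmetry.totalX_coeffT_eq_zero (hU : IsOpen U) (hI : IsOpen I)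
    (hh : ContDiffOn ℝ ∞ (fun u => (f u)⁻¹) I) (hg : ContDiffOn ℝ ∞ g I)
    (hf0 : ∀ u ∈ I, f u ≠ 0) (hV : IsLiePointSymmetry f g U I V) {z : Jet}
    (hz : z ∈ jetDomain U I) (h0 : zoomPoly (fun u => (f u)⁻¹) g z = 0) :
    totalX (coeffT V) z = 0 := by
  have H := ((isLiePointSymmetry_iff hU hI hh hg V).1 hV).2
  have e1 := H z hz h0
  have hz' : z.set (4, 0) (z.u (4, 0) + 1) ∈ jetDomain U I := by
    refine ⟨hz.1, ?_⟩
    simpa [Jet.set_u] using hz.2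
  have e2 := H _ hz' (by simpa [zoomPoly, Jet.set_u] using h0)
  have low : ∀ i j, (4, 0) ∉ prolongSupport i j →
      prolong V i j (z.set (4, 0) (z.u (4, 0) + 1)) = prolong V i j z :=
    fun i j h => (onlyUses_prolong V i j).set_eq h _ _
  simp only [zoomVar, Jet.set_u, prolong_three_one_set] at e2
  rw [low 0 0 (by simp [prolongSupport]), low 1 0 (by simp [prolongSupport]),
    low 0 1 (by simp [prolongSupport]), low 1 1 (by simp [prolongSupport]),
    low 2 0 (by simp [prolongSupport]), low 0 2 (by simp [prolongSupport]),
    low 2 1 (by simp [prolongSupport]), low 1 2 (by simp [prolongSupport]),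
    low 1 3 (by simp [prolongSupport])] at e2
  simp only [zoomVar] at e1
  simp at e2
  have hne : (f (z.u (0, 0)))⁻¹ ≠ 0 := inv_ne_zero (hf0 _ hz.2)
  refine (mul_eq_zero.1 (?_ : (f (z.u (0, 0)))⁻¹ * totalX (coeffT V) z = 0)).resolve_left hne
  simp at e1
  linear_combination e1 - e2

theorem IsLiePointSymmetry.totalT_coeffX_eq_zero (hU : IsOpen U) (hI : IsOpen I)
    (hh : ContDiffOn ℝ ∞ (fun u => (f u)⁻¹) I) (hg : ContDiffOn ℝ ∞ g I)
    (hf0 : ∀ u ∈ I, f u ≠ 0) (hV : IsLiePointSymmetry f g U I V) {z : Jet}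
    (hz : z ∈ jetDomain U I) (h0 : zoomPoly (fun u => (f u)⁻¹) g z = 0) :
    totalT (coeffX V) z = 0 := by
  have H := ((isLiePointSymmetry_iff hU hI hh hg V).1 hV).2
  have e1 := H z hz h0
  have hz' : z.set (0, 4) (z.u (0, 4) + 1) ∈ jetDomain U I := by
    refine ⟨hz.1, ?_⟩
    simpa [Jet.set_u] using hz.2
  have e2 := H _ hz' (by simpa [zoomPoly, Jet.set_u] using h0)
  have low : ∀ i j, (0, 4) ∉ prolongSupport i j →
      prolong V i j (z.set (0, 4) (z.u (0, 4) + 1)) = prolong V i j z :=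
    fun i j h => (onlyUses_prolong V i j).set_eq h _ _
  simp only [zoomVar, Jet.set_u, prolong_one_three_set] at e2
  rw [low 0 0 (by simp [prolongSupport]), low 1 0 (by simp [prolongSupport]),
    low 0 1 (by simp [prolongSupport]), low 1 1 (by simp [prolongSupport]),
    low 2 0 (by simp [prolongSupport]), low 0 2 (by simp [prolongSupport]),
    low 2 1 (by simp [prolongSupport]), low 1 2 (by simp [prolongSupport]),
    low 3 1 (by simp [prolongSupport])] at e2
  simp only [zoomVar] at e1
  simp at e2
  have hne : (f (z.u (0, 0)))⁻¹ ≠ 0 := inv_ne_zero (hf0 _ hz.2)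
  refine (mul_eq_zero.1 (?_ : (f (z.u (0, 0)))⁻¹ * totalT (coeffX V) z = 0)).resolve_left hne
  simp at e1
  linear_combination e2 - e1

/-- The jet with `u`, `u_t`, `u_x` prescribed and all other derivative coordinates zero. -/
def Jet.first (t x u p q : ℝ) : Jet where
  t := t
  x := x
  u k := if k = (0, 0) then u else if k = (1, 0) then p else if k = (0, 1) then q else 0

/-- D_x ξᵗ = ξᵗ_x + u_x ξᵗ_u is affine in the free coordinate u_x, so both coefficients vanish. A
jet with only u and u_x nonzero solves the equation, since every term contains a derivative of order
at least two or the product u_t u_x. -/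
theorem IsLiePointSymmetry.deriv_coeffT (hU : IsOpen U) (hI : IsOpen I)
    (hh : ContDiffOn ℝ ∞ (fun u => (f u)⁻¹) I) (hg : ContDiffOn ℝ ∞ g I)
    (hf0 : ∀ u ∈ I, f u ≠ 0) (hV : IsLiePointSymmetry f g U I V) {t x u : ℝ}
    (htx : (t, x) ∈ U) (hu : u ∈ I) :
    deriv (fun s => (V ((t, s), u)).1.1) x = 0 ∧ deriv (fun s => (V ((t, x), s)).1.1) u = 0 := by
  have key : ∀ q, deriv (fun s => (V ((t, s), u)).1.1) x
      + q * deriv (fun s => (V ((t, x), s)).1.1) u = 0 := fun q => by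
    have := hV.totalX_coeffT_eq_zero hU hI hh hg hf0 (z := Jet.first t x u 0 q)
      ⟨htx, by simpa [Jet.first] using hu⟩ (by simp [Jet.first, zoomPoly])
    rw [(onlyUses_coeffT V).totalX_eq] at this
    simpa [partialX, partialU, Jet.first, coeffT] using this
  constructor <;> linarith [key 0, key 1]

theorem IsLiePointSymmetry.deriv_coeffX (hU : IsOpen U) (hI : IsOpen I)
    (hh : ContDiffOn ℝ ∞ (fun u => (f u)⁻¹) I) (hg : ContDiffOn ℝ ∞ g I)
    (hf0 : ∀ u ∈ I, f u ≠ 0) (hV : IsLiePointSymmetry f g U I V) {t x u : ℝ}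
    (htx : (t, x) ∈ U) (hu : u ∈ I) :
    deriv (fun s => (V ((s, x), u)).1.2) t = 0 ∧ deriv (fun s => (V ((t, x), s)).1.2) u = 0 := by
  have key : ∀ q, deriv (fun s => (V ((s, x), u)).1.2) t
      + q * deriv (fun s => (V ((t, x), s)).1.2) u = 0 := fun q => by
    have := hV.totalT_coeffX_eq_zero hU hI hh hg hf0 (z := Jet.first t x u q 0)
      ⟨htx, by simpa [Jet.first] using hu⟩ (by simp [Jet.first, zoomPoly])
    rw [(onlyUses_coeffX V).totalT_eq] at this
    simpa [partialT, partialU, Jet.first, coeffX] using this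
  constructor <;> linarith [key 0, key 1]

end

/-! ### Vector fields whose base components are functions of `t` alone and of `x` alone -/

/-- `τ(t) ∂ₜ + χ(x) ∂ₓ + η(t, x, u) ∂ᵤ` -/
def sepField (τ χ : ℝ → ℝ) (η : (ℝ × ℝ) × ℝ → ℝ) : PointField :=
  fun p => ((τ p.1.1, χ p.1.2), η p)

section sepField

variable (τ χ : ℝ → ℝ) (η : (ℝ × ℝ) × ℝ → ℝ)

theorem totalT_coeffT_sepField (z : Jet) : totalT (coeffT (sepField τ χ η)) z = deriv τ z.t := by
  rw [(onlyUses_coeffT _).totalT_eq]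
  simp [partialT, partialU, coeffT, sepField]

theorem totalX_coeffT_sepField (z : Jet) : totalX (coeffT (sepField τ χ η)) z = 0 := by
  rw [(onlyUses_coeffT _).totalX_eq]
  simp [partialX, partialU, coeffT, sepField]

theorem totalT_coeffX_sepField (z : Jet) : totalT (coeffX (sepField τ χ η)) z = 0 := by
  rw [(onlyUses_coeffX _).totalT_eq]
  simp [partialT, partialU, coeffX, sepField]

theorem totalX_coeffX_sepField (z : Jet) : totalX (coeffX (sepField τ χ η)) z = deriv χ z.x := by
  rw [(onlyUses_coeffX _).totalX_eq]
  simp [partialX, partialU, coeffX, sepField]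

theorem prolongX_succ_sepField (j : ℕ) (z : Jet) :
    prolongX (sepField τ χ η) (j + 1) z
      = totalX (prolongX (sepField τ χ η) j) z - z.u (0, j + 1) * deriv χ z.x := by
  simp only [prolongX, totalX_coeffT_sepField, totalX_coeffX_sepField]
  ring

theorem prolong_succ_sepField (i j : ℕ) (z : Jet) :
    prolong (sepField τ χ η) (i + 1) j z
      = totalT (prolong (sepField τ χ η) i j) z - z.u (i + 1, j) * deriv τ z.t := by
  simp only [prolong, totalT_coeffT_sepField, totalT_coeffX_sepField]
  ring

/-- With D_x ξᵗ = D_t ξˣ = 0 no derivative is traded between t and x any more, so the support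
shrinks from `prolongSupport` to a rectangle. -/
theorem onlyUses_prolongX_sepField (j : ℕ) :
    OnlyUses {k | k.1 ≤ 0 ∧ k.2 ≤ j} (prolongX (sepField τ χ η) j) := by
  induction j with
  | zero => exact (onlyUses_coeffU _).mono (by simp)
  | succ j ih =>
    have h : OnlyUses {k | k.1 ≤ 0 ∧ k.2 ≤ j + 1} fun z =>
        totalX (prolongX (sepField τ χ η) j) z - z.u (0, j + 1) * deriv χ z.x :=
      (ih.totalX (by intro k; simp; omega) (by simp)).sub
        ((OnlyUses.coord (by simp)).mul fun z z' _ hx _ => by rw [hx])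
    rwa [← funext (prolongX_succ_sepField τ χ η j)] at h

theorem onlyUses_prolong_sepField (i j : ℕ) :
    OnlyUses {k | k.1 ≤ i ∧ k.2 ≤ j} (prolong (sepField τ χ η) i j) := by
  induction i with
  | zero => exact onlyUses_prolongX_sepField τ χ η j
  | succ i ih =>
    have h : OnlyUses {k | k.1 ≤ i + 1 ∧ k.2 ≤ j} fun z =>
        totalT (prolong (sepField τ χ η) i j) z - z.u (i + 1, j) * deriv τ z.t :=
      (ih.totalT (by intro k; simp; omega) (by simp)).sub
        ((OnlyUses.coord (by simp)).mul fun z z' ht _ _ => by rw [ht])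
    rwa [← funext (prolong_succ_sepField τ χ η i j)] at h

theorem prolong_sepField_set {i : ℕ} (hi : (i, 0) ∈ indices) (z : Jet) (s : ℝ) :
    prolong (sepField τ χ η) (i + 1) 1 (z.set (i + 1, 0) s)
      = prolong (sepField τ χ η) (i + 1) 1 z
        + (s - z.u (i + 1, 0)) * partialU (i, 0) (prolong (sepField τ χ η) i 1) z := by
  rw [prolong_succ_sepField, prolong_succ_sepField,
    (onlyUses_prolong_sepField τ χ η i 1).totalT_set (by simp) hi, Jet.set_u, if_neg (by simp),
    Jet.set_t]
  ring

/-- Each D_t moves the slope of η^{(i,1)} in u_{i,0} unchanged to the slope of η^{(i+1,1)} in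
u_{i+1,0}. It starts at ∂η^{(0,1)}/∂u = η_xu + u_x η_uu. -/
theorem partialU_prolong_sepField {i : ℕ} (hi : i ≤ 4) (z : Jet) :
    partialU (i, 0) (prolong (sepField τ χ η) i 1) z
      = partialU (0, 0) (prolong (sepField τ χ η) 0 1) z := by
  induction i with
  | zero => rfl
  | succ i ih =>
    rw [← ih (by omega)]
    exact partialU_eq_of_set fun s =>
      prolong_sepField_set τ χ η (by simp [indices]; omega) z s

theorem prolong_zero_one_sepField (z : Jet) :
    prolong (sepField τ χ η) 0 1 z
      = deriv (fun s => η ((z.t, s), z.u (0, 0))) z.x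
        + z.u (0, 1) * deriv (fun s => η ((z.t, z.x), s)) (z.u (0, 0))
        - z.u (0, 1) * deriv χ z.x := by
  rw [prolong, prolongX_succ_sepField]
  change totalX (coeffU _) z - _ = _
  rw [(onlyUses_coeffU _).totalX_eq]
  simp [partialX, partialU, coeffU, sepField]

variable {τ χ η} {f g : ℝ → ℝ} {U : Set (ℝ × ℝ)} {I : Set ℝ}

/-- The coordinate u_ttt is absent from the equation, and among the coefficients in `zoomVar` it
occurs only in η^{(3,1)}. Raising it by one isolates its slope there. -/
theorem IsLiePointSymmetry.partialU_prolong_sepField_eq_zero (hU : IsOpen U) (hI : IsOpen I)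
    (hh : ContDiffOn ℝ ∞ (fun u => (f u)⁻¹) I) (hg : ContDiffOn ℝ ∞ g I)
    (hf0 : ∀ u ∈ I, f u ≠ 0) (hV : IsLiePointSymmetry f g U I (sepField τ χ η)) {z : Jet}
    (hz : z ∈ jetDomain U I) (h0 : zoomPoly (fun u => (f u)⁻¹) g z = 0) :
    partialU (0, 0) (prolong (sepField τ χ η) 0 1) z = 0 := by
  have H := ((isLiePointSymmetry_iff hU hI hh hg _).1 hV).2
  have e1 := H z hz h0
  have hz' : z.set (3, 0) (z.u (3, 0) + 1) ∈ jetDomain U I := by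
    refine ⟨hz.1, ?_⟩
    simpa [Jet.set_u] using hz.2
  have e2 := H _ hz' (by simpa [zoomPoly, Jet.set_u] using h0)
  have low : ∀ i j, ¬ 3 ≤ i → prolong (sepField τ χ η) i j (z.set (3, 0) (z.u (3, 0) + 1))
      = prolong (sepField τ χ η) i j z :=
    fun i j h => (onlyUses_prolong_sepField τ χ η i j).set_eq (by simpa using h) _ _
  simp only [zoomVar, Jet.set_u] at e2
  rw [prolong_sepField_set τ χ η (i := 2) (by decide) z,
    partialU_prolong_sepField τ χ η (i := 2) (by simp), low 0 0 (by simp), low 1 0 (by simp),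
    low 0 1 (by simp), low 1 1 (by simp), low 2 0 (by simp), low 0 2 (by simp),
    low 2 1 (by simp), low 1 2 (by simp), low 1 3 (by simp)] at e2
  simp only [zoomVar] at e1
  have hne : (f (z.u (0, 0)))⁻¹ ≠ 0 := inv_ne_zero (hf0 _ hz.2)
  refine (mul_eq_zero.1 (?_ : (f (z.u (0, 0)))⁻¹
    * partialU (0, 0) (prolong (sepField τ χ η) 0 1) z = 0)).resolve_left hne
  simp at e1 e2
  linear_combination e2 - e1

theorem IsLiePointSymmetry.deriv_sepField (hU : IsOpen U) (hI : IsOpen I)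
    (hh : ContDiffOn ℝ ∞ (fun u => (f u)⁻¹) I) (hg : ContDiffOn ℝ ∞ g I)
    (hf0 : ∀ u ∈ I, f u ≠ 0) (hV : IsLiePointSymmetry f g U I (sepField τ χ η)) {t x u : ℝ}
    (htx : (t, x) ∈ U) (hu : u ∈ I) (q : ℝ) :
    deriv (fun v => deriv (fun s => η ((t, s), v)) x
      + q * deriv (fun s => η ((t, x), s)) v - q * deriv χ x) u = 0 := by
  have := hV.partialU_prolong_sepField_eq_zero hU hI hh hg hf0 (z := Jet.first t x u 0 q)
    ⟨htx, by simpa [Jet.first] using hu⟩ (by simp [Jet.first, zoomPoly])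
  simp only [partialU, prolong_zero_one_sepField] at this
  simpa [Jet.first] using this

end sepField

/-! ### Smooth functions on open sets and their derivatives along lines -/

section smooth

variable {E : Type*} [NormedAddCommGroup E] [NormedSpace ℝ E] {φ : E → ℝ} {S : Set E}

theorem contDiffOn_fderiv_apply (hS : IsOpen S) (hφ : ContDiffOn ℝ ∞ φ S) (v : E) :
    ContDiffOn ℝ ∞ (fun p => fderiv ℝ φ p v) S :=
  (hφ.fderiv_of_isOpen hS (by simp)).clm_apply contDiffOn_const

theorem hasDerivAt_comp_line (hS : IsOpen S) (hφ : ContDiffOn ℝ ∞ φ S) {γ : ℝ → E} {v : E} {s : ℝ}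
    (hγ : HasDerivAt γ v s) (hs : γ s ∈ S) :
    HasDerivAt (fun r => φ (γ r)) (fderiv ℝ φ (γ s) v) s :=
  (((hφ.contDiffAt (hS.mem_nhds hs)).differentiableAt (by simp)).hasFDerivAt).comp_hasDerivAt s hγ

theorem hasDerivAt_fst_fst (t x u : ℝ) :
    HasDerivAt (fun s : ℝ => ((s, x), u)) (((1, 0), 0) : (ℝ × ℝ) × ℝ) t :=
  ((hasDerivAt_id t).prodMk (hasDerivAt_const _ _)).prodMk (hasDerivAt_const _ _)

theorem hasDerivAt_fst_snd (t x u : ℝ) :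
    HasDerivAt (fun s : ℝ => ((t, s), u)) (((0, 1), 0) : (ℝ × ℝ) × ℝ) x :=
  ((hasDerivAt_const _ _).prodMk (hasDerivAt_id x)).prodMk (hasDerivAt_const _ _)

theorem hasDerivAt_snd (t x u : ℝ) :
    HasDerivAt (fun s : ℝ => ((t, x), s)) (((0, 0), 1) : (ℝ × ℝ) × ℝ) u :=
  (hasDerivAt_const _ _).prodMk (hasDerivAt_id u)

theorem eq_of_hasDerivAt_zero {J : Set ℝ} (hJ : IsOpen J) (hJc : IsPreconnected J) {φ : ℝ → ℝ}
    (hφ : ∀ s ∈ J, HasDerivAt φ 0 s) {a b : ℝ} (ha : a ∈ J) (hb : b ∈ J) : φ a = φ b :=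
  hJ.is_const_of_deriv_eq_zero hJc
    (fun s hs => (hφ s hs).differentiableAt.differentiableWithinAt)
    (fun s hs => (hφ s hs).deriv) ha hb

end smooth

/-! ### Shape of a symmetry over a product of intervals -/

section box

variable {f g : ℝ → ℝ} {J₁ J₂ I : Set ℝ} {V : PointField}

/-- Over a product of intervals, the base components of a symmetry separate. -/
theorem IsLiePointSymmetry.exists_sepField (hJ₁ : IsOpen J₁) (hJ₁c : IsPreconnected J₁)
    (hJ₂ : IsOpen J₂) (hJ₂c : IsPreconnected J₂) (hI : IsOpen I) (hIc : IsPreconnected I)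
    (hh : ContDiffOn ℝ ∞ (fun u => (f u)⁻¹) I) (hg : ContDiffOn ℝ ∞ g I)
    (hf0 : ∀ u ∈ I, f u ≠ 0) (hV : IsLiePointSymmetry f g (J₁ ×ˢ J₂) I V) {t₀ x₀ u₀ : ℝ}
    (ht₀ : t₀ ∈ J₁) (hx₀ : x₀ ∈ J₂) (hu₀ : u₀ ∈ I) :
    EqOn V (sepField (fun t => (V ((t, x₀), u₀)).1.1) (fun x => (V ((t₀, x), u₀)).1.2)
      fun p => (V p).2) ((J₁ ×ˢ J₂) ×ˢ I) := by
  have hU : IsOpen (J₁ ×ˢ J₂) := hJ₁.prod hJ₂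
  have hS : IsOpen ((J₁ ×ˢ J₂) ×ˢ I) := hU.prod hI
  have hT : ContDiffOn ℝ ∞ (fun p => (V p).1.1) ((J₁ ×ˢ J₂) ×ˢ I) := hV.1.fst.fst
  have hX : ContDiffOn ℝ ∞ (fun p => (V p).1.2) ((J₁ ×ˢ J₂) ×ˢ I) := hV.1.fst.snd
  rintro ⟨⟨t, x⟩, u⟩ ⟨⟨ht : t ∈ J₁, hx : x ∈ J₂⟩, hu : u ∈ I⟩
  have a1 : (V ((t, x), u)).1.1 = (V ((t, x₀), u)).1.1 :=
    eq_of_hasDerivAt_zero hJ₂ hJ₂c (φ := fun s => (V ((t, s), u)).1.1) (fun s hs => by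
      have h := hasDerivAt_comp_line hS hT (hasDerivAt_fst_snd t s u) ⟨⟨ht, hs⟩, hu⟩
      rwa [← h.deriv, (hV.deriv_coeffT hU hI hh hg hf0 (x := s) ⟨ht, hs⟩ hu).1] at h) hx hx₀
  have a2 : (V ((t, x₀), u)).1.1 = (V ((t, x₀), u₀)).1.1 :=
    eq_of_hasDerivAt_zero hI hIc (φ := fun s => (V ((t, x₀), s)).1.1) (fun s hs => by
      have h := hasDerivAt_comp_line hS hT (hasDerivAt_snd t x₀ s) ⟨⟨ht, hx₀⟩, hs⟩
      rwa [← h.deriv, (hV.deriv_coeffT hU hI hh hg hf0 (x := x₀) ⟨ht, hx₀⟩ hs).2] at h) hu hu₀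
  have b1 : (V ((t, x), u)).1.2 = (V ((t₀, x), u)).1.2 :=
    eq_of_hasDerivAt_zero hJ₁ hJ₁c (φ := fun s => (V ((s, x), u)).1.2) (fun s hs => by
      have h := hasDerivAt_comp_line hS hX (hasDerivAt_fst_fst s x u) ⟨⟨hs, hx⟩, hu⟩
      rwa [← h.deriv, (hV.deriv_coeffX hU hI hh hg hf0 (t := s) ⟨hs, hx⟩ hu).1] at h) ht ht₀
  have b2 : (V ((t₀, x), u)).1.2 = (V ((t₀, x), u₀)).1.2 :=
    eq_of_hasDerivAt_zero hI hIc (φ := fun s => (V ((t₀, x), s)).1.2) (fun s hs => by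
      have h := hasDerivAt_comp_line hS hX (hasDerivAt_snd t₀ x s) ⟨⟨ht₀, hx⟩, hs⟩
      rwa [← h.deriv, (hV.deriv_coeffX hU hI hh hg hf0 (t := t₀) ⟨ht₀, hx⟩ hs).2] at h) hu hu₀
  exact Prod.ext (Prod.ext (a1.trans a2) (b1.trans b2)) rfl

/-- Over a product of intervals, the `∂ᵤ` component of a symmetry is affine in `u`, with slope
depending on `t` only. -/
theorem IsLiePointSymmetry.exists_affine (hJ₁ : IsOpen J₁)
    (hJ₂ : IsOpen J₂) (hJ₂c : IsPreconnected J₂) (hI : IsOpen I) (hIc : IsPreconnected I)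
    (hh : ContDiffOn ℝ ∞ (fun u => (f u)⁻¹) I) (hg : ContDiffOn ℝ ∞ g I)
    (hf0 : ∀ u ∈ I, f u ≠ 0) {τ χ : ℝ → ℝ} {η : (ℝ × ℝ) × ℝ → ℝ}
    (hη : ContDiffOn ℝ ∞ η ((J₁ ×ˢ J₂) ×ˢ I))
    (hV : IsLiePointSymmetry f g (J₁ ×ˢ J₂) I (sepField τ χ η)) {x₀ u₀ : ℝ}
    (hx₀ : x₀ ∈ J₂) (hu₀ : u₀ ∈ I) {t x u : ℝ} (ht : t ∈ J₁) (hx : x ∈ J₂) (hu : u ∈ I) :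
    η ((t, x), u)
      = fderiv ℝ η ((t, x₀), u₀) ((0, 0), 1) * (u - u₀) + η ((t, x), u₀) := by
  have hU : IsOpen (J₁ ×ˢ J₂) := hJ₁.prod hJ₂
  have hS : IsOpen ((J₁ ×ˢ J₂) ×ˢ I) := hU.prod hI
  have dx : ∀ y ∈ J₂, ∀ v ∈ I, HasDerivAt (fun s => η ((t, s), v))
      (fderiv ℝ η ((t, y), v) ((0, 1), 0)) y := fun y hy v hv =>
    hasDerivAt_comp_line hS hη (hasDerivAt_fst_snd t y v) ⟨⟨ht, hy⟩, hv⟩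
  have du : ∀ y ∈ J₂, ∀ v ∈ I, HasDerivAt (fun s => η ((t, y), s))
      (fderiv ℝ η ((t, y), v) ((0, 0), 1)) v := fun y hy v hv =>
    hasDerivAt_comp_line hS hη (hasDerivAt_snd t y v) ⟨⟨ht, hy⟩, hv⟩
  have ddu : ∀ w, ∀ y ∈ J₂, ∀ v ∈ I, HasDerivAt (fun s => fderiv ℝ η ((t, y), s) w)
      (fderiv ℝ (fun p => fderiv ℝ η p w) ((t, y), v) ((0, 0), 1)) v := fun w y hy v hv =>
    hasDerivAt_comp_line hS (contDiffOn_fderiv_apply hS hη w) (hasDerivAt_snd t y v)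
      ⟨⟨ht, hy⟩, hv⟩
  -- This is η_xu + q η_uu = 0, where q is the value of u_x; the term q χ' does not depend on u. The
  -- values q = 0 and q = 1 separate the two derivatives.
  have key : ∀ q, ∀ y ∈ J₂, ∀ v ∈ I,
      fderiv ℝ (fun p => fderiv ℝ η p ((0, 1), 0)) ((t, y), v) ((0, 0), 1)
      + q * fderiv ℝ (fun p => fderiv ℝ η p ((0, 0), 1)) ((t, y), v) ((0, 0), 1) = 0 := by
    intro q y hy v hv
    have h := hV.deriv_sepField hU hI hh hg hf0 (t := t) (x := y) ⟨ht, hy⟩ hv q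
    refine Eq.trans ?_ h
    have h2 := (((ddu ((0, 1), 0) y hy v hv).add
      ((ddu ((0, 0), 1) y hy v hv).const_mul q)).sub_const (q * deriv χ y))
    refine (HasDerivAt.deriv (h2.congr_of_eventuallyEq ?_)).symm
    filter_upwards [hI.mem_nhds hv] with s hs
    simp only [(dx y hy s hs).deriv, (du y hy s hs).deriv, Pi.add_apply]
  have kx : ∀ y ∈ J₂, ∀ v ∈ I,
      fderiv ℝ (fun p => fderiv ℝ η p ((0, 1), 0)) ((t, y), v) ((0, 0), 1) = 0 :=
    fun y hy v hv => by simpa using key 0 y hy v hv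
  have ku : ∀ y ∈ J₂, ∀ v ∈ I,
      fderiv ℝ (fun p => fderiv ℝ η p ((0, 0), 1)) ((t, y), v) ((0, 0), 1) = 0 :=
    fun y hy v hv => by simpa [kx y hy v hv] using key 1 y hy v hv
  have cx : ∀ y ∈ J₂, ∀ v ∈ I, fderiv ℝ η ((t, y), v) ((0, 1), 0)
      = fderiv ℝ η ((t, y), u₀) ((0, 1), 0) := fun y hy v hv =>
    eq_of_hasDerivAt_zero hI hIc (φ := fun s => fderiv ℝ η ((t, y), s) ((0, 1), 0))
      (fun s hs => by simpa only [kx y hy s hs] using ddu ((0, 1), 0) y hy s hs) hv hu₀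
  have cu : ∀ y ∈ J₂, ∀ v ∈ I, fderiv ℝ η ((t, y), v) ((0, 0), 1)
      = fderiv ℝ η ((t, y), u₀) ((0, 0), 1) := fun y hy v hv =>
    eq_of_hasDerivAt_zero hI hIc (φ := fun s => fderiv ℝ η ((t, y), s) ((0, 0), 1))
      (fun s hs => by simpa only [ku y hy s hs] using ddu ((0, 0), 1) y hy s hs) hv hu₀
  -- Since η_xu = 0, the increment of η in u does not depend on x, so the slope at x₀ serves for
  -- every x.
  have l1 : η ((t, x), u) - η ((t, x), u₀) = η ((t, x₀), u) - η ((t, x₀), u₀) :=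
    eq_of_hasDerivAt_zero hJ₂ hJ₂c (φ := fun s => η ((t, s), u) - η ((t, s), u₀)) (fun s hs => by
      have := (dx s hs u hu).sub (dx s hs u₀ hu₀)
      rwa [cx s hs u hu, sub_self] at this) hx hx₀
  have l2 := eq_of_hasDerivAt_zero hI hIc
    (φ := fun s => η ((t, x₀), s) - s * fderiv ℝ η ((t, x₀), u₀) ((0, 0), 1)) (fun s hs => by
      have := (du x₀ hx₀ s hs).sub
        ((hasDerivAt_id' s).mul_const (fderiv ℝ η ((t, x₀), u₀) ((0, 0), 1)))
      rwa [cu x₀ hx₀ s hs, one_mul, sub_self] at this) hu hu₀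
  linear_combination l1 + l2

end box

/-! ### Prolongation of `τ(t) ∂ₜ + χ(x) ∂ₓ + (A(t) u + B(t, x)) ∂ᵤ` -/

/-- The derivative of a function of `(t, x)` in the direction of `t`. -/
noncomputable def dirT (φ : ℝ × ℝ → ℝ) (p : ℝ × ℝ) : ℝ := fderiv ℝ φ p (1, 0)

/-- The derivative of a function of `(t, x)` in the direction of `x`. -/
noncomputable def dirX (φ : ℝ × ℝ → ℝ) (p : ℝ × ℝ) : ℝ := fderiv ℝ φ p (0, 1)

theorem HasDir.compPair {U : Set (ℝ × ℝ)} {I : Set ℝ} (hU : IsOpen U) {φ : ℝ × ℝ → ℝ}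
    (hφ : ContDiffOn ℝ ∞ φ U) {z : Jet} (hz : z ∈ jetDomain U I) (wt wx : ℝ) (w : ℕ × ℕ → ℝ) :
    HasDir wt wx w (fun z => φ (z.t, z.x)) z
      (wt * dirT φ (z.t, z.x) + wx * dirX φ (z.t, z.x)) :=
  HasDir.compTX (φ := fun t x => φ (t, x))
    (hasDerivAt_comp_line hU hφ ((hasDerivAt_id z.t).prodMk (hasDerivAt_const z.t z.x)) hz.1)
    (hasDerivAt_comp_line hU hφ ((hasDerivAt_const z.x z.t).prodMk (hasDerivAt_id z.x)) hz.1)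

section

variable {J₁ J₂ I : Set ℝ} {τ χ A : ℝ → ℝ} {B : ℝ × ℝ → ℝ}

/-- `τ(t) ∂ₜ + χ(x) ∂ₓ + (A(t) u + B(t, x)) ∂ᵤ` -/
def affineField (τ χ A : ℝ → ℝ) (B : ℝ × ℝ → ℝ) : PointField :=
  sepField τ χ fun p => A p.1.1 * p.2 + B p.1

/-- These are the ten coefficients that enter `zoomVar`. Each follows from its predecessor by one
total derivative, x-derivatives first; η^{(0,3)} is computed only on the way to η^{(1,3)}. -/
theorem prolong_affineField (hJ₁ : IsOpen J₁) (hJ₂ : IsOpen J₂) (hI : IsOpen I)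
    (hτ : ContDiffOn ℝ ∞ τ J₁) (hχ : ContDiffOn ℝ ∞ χ J₂) (hA : ContDiffOn ℝ ∞ A J₁)
    (hB : ContDiffOn ℝ ∞ B (J₁ ×ˢ J₂)) {z : Jet} (hz : z ∈ jetDomain (J₁ ×ˢ J₂) I) :
    (prolong (affineField τ χ A B) 0 0 z = A z.t * z.u (0, 0) + B (z.t, z.x)) ∧
    (prolong (affineField τ χ A B) 0 1 z
      = A z.t * z.u (0, 1) + dirX B (z.t, z.x) - z.u (0, 1) * deriv^[1] χ z.x) ∧
    (prolong (affineField τ χ A B) 0 2 z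
      = A z.t * z.u (0, 2) + dirX (dirX B) (z.t, z.x) - 2 * z.u (0, 2) * deriv^[1] χ z.x
        - z.u (0, 1) * deriv^[2] χ z.x) ∧
    (prolong (affineField τ χ A B) 1 0 z
      = deriv^[1] A z.t * z.u (0, 0) + A z.t * z.u (1, 0) + dirT B (z.t, z.x)
        - z.u (1, 0) * deriv^[1] τ z.t) ∧
    (prolong (affineField τ χ A B) 2 0 z
      = deriv^[2] A z.t * z.u (0, 0) + 2 * deriv^[1] A z.t * z.u (1, 0) + A z.t * z.u (2, 0)
        + dirT (dirT B) (z.t, z.x) - 2 * z.u (2, 0) * deriv^[1] τ z.t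
        - z.u (1, 0) * deriv^[2] τ z.t) ∧
    (prolong (affineField τ χ A B) 1 1 z
      = deriv^[1] A z.t * z.u (0, 1) + A z.t * z.u (1, 1) + dirT (dirX B) (z.t, z.x)
        - z.u (1, 1) * deriv^[1] χ z.x - z.u (1, 1) * deriv^[1] τ z.t) ∧
    (prolong (affineField τ χ A B) 1 2 z
      = deriv^[1] A z.t * z.u (0, 2) + A z.t * z.u (1, 2) + dirT (dirX (dirX B)) (z.t, z.x)
        - 2 * z.u (1, 2) * deriv^[1] χ z.x - z.u (1, 1) * deriv^[2] χ z.x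
        - z.u (1, 2) * deriv^[1] τ z.t) ∧
    (prolong (affineField τ χ A B) 1 3 z
      = deriv^[1] A z.t * z.u (0, 3) + A z.t * z.u (1, 3)
        + dirT (dirX (dirX (dirX B))) (z.t, z.x) - 3 * z.u (1, 3) * deriv^[1] χ z.x
        - 3 * z.u (1, 2) * deriv^[2] χ z.x - z.u (1, 1) * deriv^[3] χ z.x
        - z.u (1, 3) * deriv^[1] τ z.t) ∧
    (prolong (affineField τ χ A B) 2 1 z
      = deriv^[2] A z.t * z.u (0, 1) + 2 * deriv^[1] A z.t * z.u (1, 1) + A z.t * z.u (2, 1)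
        + dirT (dirT (dirX B)) (z.t, z.x) - z.u (2, 1) * deriv^[1] χ z.x
        - 2 * z.u (2, 1) * deriv^[1] τ z.t - z.u (1, 1) * deriv^[2] τ z.t) ∧
    (prolong (affineField τ χ A B) 3 1 z
      = deriv^[3] A z.t * z.u (0, 1) + 3 * deriv^[2] A z.t * z.u (1, 1)
        + 3 * deriv^[1] A z.t * z.u (2, 1) + A z.t * z.u (3, 1)
        + dirT (dirT (dirT (dirX B))) (z.t, z.x) - z.u (3, 1) * deriv^[1] χ z.x
        - 3 * z.u (3, 1) * deriv^[1] τ z.t - 3 * z.u (2, 1) * deriv^[2] τ z.t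
        - z.u (1, 1) * deriv^[3] τ z.t) := by
  have hU : IsOpen (J₁ ×ˢ J₂) := hJ₁.prod hJ₂
  have lτ : ∀ n, ∀ z ∈ jetDomain (J₁ ×ˢ J₂) I, ∀ wt wx w,
      HasDir wt wx w (fun z => deriv^[n] τ z.t) z (wt * deriv^[n + 1] τ z.t) :=
    fun n z hz _ _ _ => HasDir.compT (hasDerivAt_iterate_deriv hJ₁ hτ n hz.1.1)
  have lA : ∀ n, ∀ z ∈ jetDomain (J₁ ×ˢ J₂) I, ∀ wt wx w,
      HasDir wt wx w (fun z => deriv^[n] A z.t) z (wt * deriv^[n + 1] A z.t) :=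
    fun n z hz _ _ _ => HasDir.compT (hasDerivAt_iterate_deriv hJ₁ hA n hz.1.1)
  have lχ : ∀ n, ∀ z ∈ jetDomain (J₁ ×ˢ J₂) I, ∀ wt wx w,
      HasDir wt wx w (fun z => deriv^[n] χ z.x) z (wx * deriv^[n + 1] χ z.x) :=
    fun n z hz _ _ _ => HasDir.compX (hasDerivAt_iterate_deriv hJ₂ hχ n hz.1.2)
  have lA0 : ∀ z ∈ jetDomain (J₁ ×ˢ J₂) I, ∀ wt wx w,
      HasDir wt wx w (fun z => A z.t) z (wt * deriv^[1] A z.t) := lA 0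
  have sT : ∀ {φ : ℝ × ℝ → ℝ}, ContDiffOn ℝ ∞ φ (J₁ ×ˢ J₂) →
      ContDiffOn ℝ ∞ (dirT φ) (J₁ ×ˢ J₂) := fun h => contDiffOn_fderiv_apply hU h _
  have sX : ∀ {φ : ℝ × ℝ → ℝ}, ContDiffOn ℝ ∞ φ (J₁ ×ˢ J₂) →
      ContDiffOn ℝ ∞ (dirX φ) (J₁ ×ˢ J₂) := fun h => contDiffOn_fderiv_apply hU h _
  have c1 := sX hB
  have c2 := sX c1
  have c3 := sX c2
  have c4 := sT hB
  have c6 := sT c1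
  have c7 := sT c6
  have c8 := sT c2
  set D := jetDomain (J₁ ×ˢ J₂) I with hD
  set V := affineField τ χ A B with hV
  have pT : ∀ {i j : ℕ} {G : Jet → ℝ}, EqOn (prolong V i j) G D → ∀ {z} {d e : ℝ}, z ∈ D →
      HasDir 1 0 (fun k => z.u (k.1 + 1, k.2)) G z d →
      d - z.u (i + 1, j) * deriv^[1] τ z.t = e → prolong V (i + 1) j z = e :=
    fun hG z _ _ hz hd he => by
      rw [hV, affineField, prolong_succ_sepField, ← affineField, ← hV,
        totalT_congr hU hI hG hz, hd.totalT_eq]; exact he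
  have pX : ∀ {j : ℕ} {G : Jet → ℝ}, EqOn (prolong V 0 j) G D → ∀ {z} {d e : ℝ}, z ∈ D →
      HasDir 0 1 (fun k => z.u (k.1, k.2 + 1)) G z d →
      d - z.u (0, j + 1) * deriv^[1] χ z.x = e → prolong V 0 (j + 1) z = e :=
    fun {j} {G} hG z _ _ hz hd he => by
      have hG' : EqOn (prolongX V j) G D := hG
      rw [prolong, hV, affineField, prolongX_succ_sepField, ← affineField, ← hV,
        totalX_congr hU hI hG' hz, hd.totalX_eq]; exact he
  have E00 : EqOn (prolong V 0 0) (fun z => A z.t * z.u (0, 0) + B (z.t, z.x)) D :=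
    fun z _ => rfl
  have E01 : EqOn (prolong V 0 1) (fun z =>
      A z.t * z.u (0, 1) + dirX B (z.t, z.x) - z.u (0, 1) * deriv^[1] χ z.x) D := fun z hz => by
    apply pX E00 hz
    · repeat' first | exact HasDir.coord (by decide) | exact lA0 z hz _ _ _
                    | exact lA _ z hz _ _ _ | exact lτ _ z hz _ _ _ | exact lχ _ z hz _ _ _
                    | exact HasDir.compPair hU (by assumption) hz _ _ _ | exact HasDir.const _
                    | apply HasDir.sub | apply HasDir.add | apply HasDir.mul
    · simp only [Nat.reduceAdd]
      ring
  have E02 : EqOn (prolong V 0 2) (fun z =>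
      A z.t * z.u (0, 2) + dirX (dirX B) (z.t, z.x) - 2 * z.u (0, 2) * deriv^[1] χ z.x - z.u (0,
      1) * deriv^[2] χ z.x) D := fun z hz => by
    apply pX E01 hz
    · repeat' first | exact HasDir.coord (by decide) | exact lA0 z hz _ _ _
                    | exact lA _ z hz _ _ _ | exact lτ _ z hz _ _ _ | exact lχ _ z hz _ _ _
                    | exact HasDir.compPair hU (by assumption) hz _ _ _ | exact HasDir.const _
                    | apply HasDir.sub | apply HasDir.add | apply HasDir.mul
    · simp only [Nat.reduceAdd]
      ring
  have E03 : EqOn (prolong V 0 3) (fun z =>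
      A z.t * z.u (0, 3) + dirX (dirX (dirX B)) (z.t, z.x) - 3 * z.u (0, 3) * deriv^[1] χ z.x -
      3 * z.u (0, 2) * deriv^[2] χ z.x - z.u (0, 1) * deriv^[3] χ z.x) D := fun z hz => by
    apply pX E02 hz
    · repeat' first | exact HasDir.coord (by decide) | exact lA0 z hz _ _ _
                    | exact lA _ z hz _ _ _ | exact lτ _ z hz _ _ _ | exact lχ _ z hz _ _ _
                    | exact HasDir.compPair hU (by assumption) hz _ _ _ | exact HasDir.const _
                    | apply HasDir.sub | apply HasDir.add | apply HasDir.mul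
    · simp only [Nat.reduceAdd]
      ring
  have E10 : EqOn (prolong V 1 0) (fun z =>
      deriv^[1] A z.t * z.u (0, 0) + A z.t * z.u (1, 0) + dirT B (z.t, z.x) - z.u (1, 0) *
      deriv^[1] τ z.t) D := fun z hz => by
    apply pT E00 hz
    · repeat' first | exact HasDir.coord (by decide) | exact lA0 z hz _ _ _
                    | exact lA _ z hz _ _ _ | exact lτ _ z hz _ _ _ | exact lχ _ z hz _ _ _
                    | exact HasDir.compPair hU (by assumption) hz _ _ _ | exact HasDir.const _
                    | apply HasDir.sub | apply HasDir.add | apply HasDir.mul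
    · simp only [Nat.reduceAdd]
      ring
  have E11 : EqOn (prolong V 1 1) (fun z =>
      deriv^[1] A z.t * z.u (0, 1) + A z.t * z.u (1, 1) + dirT (dirX B) (z.t, z.x) - z.u (1, 1)
      * deriv^[1] χ z.x - z.u (1, 1) * deriv^[1] τ z.t) D := fun z hz => by
    apply pT E01 hz
    · repeat' first | exact HasDir.coord (by decide) | exact lA0 z hz _ _ _
                    | exact lA _ z hz _ _ _ | exact lτ _ z hz _ _ _ | exact lχ _ z hz _ _ _
                    | exact HasDir.compPair hU (by assumption) hz _ _ _ | exact HasDir.const _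
                    | apply HasDir.sub | apply HasDir.add | apply HasDir.mul
    · simp only [Nat.reduceAdd]
      ring
  have E12 : EqOn (prolong V 1 2) (fun z =>
      deriv^[1] A z.t * z.u (0, 2) + A z.t * z.u (1, 2) + dirT (dirX (dirX B)) (z.t, z.x) - 2 *
      z.u (1, 2) * deriv^[1] χ z.x - z.u (1, 1) * deriv^[2] χ z.x - z.u (1, 2) * deriv^[1] τ z.t) D := fun z hz => by
    apply pT E02 hz
    · repeat' first | exact HasDir.coord (by decide) | exact lA0 z hz _ _ _
                    | exact lA _ z hz _ _ _ | exact lτ _ z hz _ _ _ | exact lχ _ z hz _ _ _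
                    | exact HasDir.compPair hU (by assumption) hz _ _ _ | exact HasDir.const _
                    | apply HasDir.sub | apply HasDir.add | apply HasDir.mul
    · simp only [Nat.reduceAdd]
      ring
  have E13 : EqOn (prolong V 1 3) (fun z =>
      deriv^[1] A z.t * z.u (0, 3) + A z.t * z.u (1, 3) + dirT (dirX (dirX (dirX B))) (z.t, z.x)
      - 3 * z.u (1, 3) * deriv^[1] χ z.x - 3 * z.u (1, 2) * deriv^[2] χ z.x - z.u (1, 1) *
      deriv^[3] χ z.x - z.u (1, 3) * deriv^[1] τ z.t) D := fun z hz => by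
    apply pT E03 hz
    · repeat' first | exact HasDir.coord (by decide) | exact lA0 z hz _ _ _
                    | exact lA _ z hz _ _ _ | exact lτ _ z hz _ _ _ | exact lχ _ z hz _ _ _
                    | exact HasDir.compPair hU (by assumption) hz _ _ _ | exact HasDir.const _
                    | apply HasDir.sub | apply HasDir.add | apply HasDir.mul
    · simp only [Nat.reduceAdd]
      ring
  have E20 : EqOn (prolong V 2 0) (fun z =>
      deriv^[2] A z.t * z.u (0, 0) + 2 * deriv^[1] A z.t * z.u (1, 0) + A z.t * z.u (2, 0) +
      dirT (dirT B) (z.t, z.x) - 2 * z.u (2, 0) * deriv^[1] τ z.t - z.u (1, 0) * deriv^[2] τ z.t) D := fun z hz => by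
    apply pT E10 hz
    · repeat' first | exact HasDir.coord (by decide) | exact lA0 z hz _ _ _
                    | exact lA _ z hz _ _ _ | exact lτ _ z hz _ _ _ | exact lχ _ z hz _ _ _
                    | exact HasDir.compPair hU (by assumption) hz _ _ _ | exact HasDir.const _
                    | apply HasDir.sub | apply HasDir.add | apply HasDir.mul
    · simp only [Nat.reduceAdd]
      ring
  have E21 : EqOn (prolong V 2 1) (fun z =>
      deriv^[2] A z.t * z.u (0, 1) + 2 * deriv^[1] A z.t * z.u (1, 1) + A z.t * z.u (2, 1) +
      dirT (dirT (dirX B)) (z.t, z.x) - z.u (2, 1) * deriv^[1] χ z.x - 2 * z.u (2, 1) *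
      deriv^[1] τ z.t - z.u (1, 1) * deriv^[2] τ z.t) D := fun z hz => by
    apply pT E11 hz
    · repeat' first | exact HasDir.coord (by decide) | exact lA0 z hz _ _ _
                    | exact lA _ z hz _ _ _ | exact lτ _ z hz _ _ _ | exact lχ _ z hz _ _ _
                    | exact HasDir.compPair hU (by assumption) hz _ _ _ | exact HasDir.const _
                    | apply HasDir.sub | apply HasDir.add | apply HasDir.mul
    · simp only [Nat.reduceAdd]
      ring
  have E31 : EqOn (prolong V 3 1) (fun z =>
      deriv^[3] A z.t * z.u (0, 1) + 3 * deriv^[2] A z.t * z.u (1, 1) + 3 * deriv^[1] A z.t *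
      z.u (2, 1) + A z.t * z.u (3, 1) + dirT (dirT (dirT (dirX B))) (z.t, z.x) - z.u (3, 1) *
      deriv^[1] χ z.x - 3 * z.u (3, 1) * deriv^[1] τ z.t - 3 * z.u (2, 1) * deriv^[2] τ z.t -
      z.u (1, 1) * deriv^[3] τ z.t) D := fun z hz => by
    apply pT E21 hz
    · repeat' first | exact HasDir.coord (by decide) | exact lA0 z hz _ _ _
                    | exact lA _ z hz _ _ _ | exact lτ _ z hz _ _ _ | exact lχ _ z hz _ _ _
                    | exact HasDir.compPair hU (by assumption) hz _ _ _ | exact HasDir.const _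
                    | apply HasDir.sub | apply HasDir.add | apply HasDir.mul
    · simp only [Nat.reduceAdd]
      ring
  exact ⟨E00 hz, E01 hz, E02 hz, E10 hz, E20 hz, E11 hz, E12 hz, E13 hz, E21 hz, E31 hz⟩

end

/-! ### Determining equations for an affine η -/

section

variable {f g : ℝ → ℝ} {J₁ J₂ I : Set ℝ} {τ χ A : ℝ → ℝ} {B : ℝ × ℝ → ℝ}

/-- The condition at the jet with only u nonzero is compared with the condition after switching on
u_xxx (for A'), u_tttx and u_txxx together (for τ' = χ'), u_ttx (for B_t) and u_txx (for B_x). The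
last two comparisons also produce τ'' and χ''. These vanish once τ' = χ' is known at all points,
hence the implications. -/
theorem IsLiePointSymmetry.affineField_coeffs (hJ₁ : IsOpen J₁) (hJ₂ : IsOpen J₂) (hI : IsOpen I)
    (hτ : ContDiffOn ℝ ∞ τ J₁) (hχ : ContDiffOn ℝ ∞ χ J₂) (hA : ContDiffOn ℝ ∞ A J₁)
    (hB : ContDiffOn ℝ ∞ B (J₁ ×ˢ J₂))
    (hh : ContDiffOn ℝ ∞ (fun u => (f u)⁻¹) I) (hg : ContDiffOn ℝ ∞ g I)
    (hf0 : ∀ u ∈ I, f u ≠ 0)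
    (hV : IsLiePointSymmetry f g (J₁ ×ˢ J₂) I (affineField τ χ A B)) {t x u : ℝ}
    (ht : t ∈ J₁) (hx : x ∈ J₂) (hu : u ∈ I) :
    deriv^[1] A t = 0 ∧ deriv^[1] τ t = deriv^[1] χ x ∧
      (deriv^[2] τ t = 0 → deriv (fun v => (f v)⁻¹) u * dirT B (t, x) = 0) ∧
      (deriv^[2] χ x = 0 → deriv (fun v => (f v)⁻¹) u * dirX B (t, x) = 0) := by
  have H := ((isLiePointSymmetry_iff (hJ₁.prod hJ₂) hI hh hg _).1 hV).2
  have hne : (f u)⁻¹ ≠ 0 := inv_ne_zero (hf0 _ hu)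
  have P : ∀ z ∈ jetDomain (J₁ ×ˢ J₂) I, _ := fun z hz =>
    prolong_affineField hJ₁ hJ₂ hI hτ hχ hA hB (z := z) hz
  set ζ : Jet := Jet.first t x u 0 0 with hζ
  have ut : ζ.t = t := rfl
  have ux : ζ.x = x := rfl
  have uu : ∀ k, ζ.u k = if k = (0, 0) then u else 0 := fun k => by
    simp [hζ, Jet.first]
  have hD : ζ ∈ jetDomain (J₁ ×ˢ J₂) I := ⟨⟨ht, hx⟩, by simpa [uu] using hu⟩
  have hDs : ∀ k s, k ≠ (0, 0) → ζ.set k s ∈ jetDomain (J₁ ×ˢ J₂) I := fun k s hk =>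
    ⟨⟨ht, hx⟩, by simpa [uu, Jet.set_u, hk.symm] using hu⟩
  have e0 := H ζ hD (by simp [zoomPoly, uu])
  obtain ⟨p00, p01, p02, p10, p20, p11, p12, p13, p21, p31⟩ := P ζ hD
  simp only [zoomVar, p00, p01, p02, p10, p20, p11, p12, p13, p21, p31, uu, ut, ux] at e0
  simp at e0
  have hA' : deriv A t = 0 := by
    have e1 := H (ζ.set (0, 3) 1) (hDs _ _ (by simp)) (by simp [zoomPoly, uu, Jet.set_u])
    obtain ⟨p00, p01, p02, p10, p20, p11, p12, p13, p21, p31⟩ :=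
      P (ζ.set (0, 3) 1) (hDs _ _ (by simp))
    simp only [zoomVar, p00, p01, p02, p10, p20, p11, p12, p13, p21, p31, uu, ut, ux,
      Jet.set_u, Jet.set_t, Jet.set_x] at e1
    simp at e1
    refine (mul_eq_zero.1 (?_ : (f u)⁻¹ * deriv A t = 0)).resolve_left hne
    linear_combination e0 - e1
  refine ⟨hA', ?_, fun hτ2 => ?_, fun hχ2 => ?_⟩
  -- Both coordinates are raised equally, so that h (u_tttx - u_txxx) stays zero.
  · have hk : ((ζ.set (3, 1) 1).set (1, 3) 1) ∈ jetDomain (J₁ ×ˢ J₂) I :=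
      ⟨⟨ht, hx⟩, by simpa [uu, Jet.set_u] using hu⟩
    have e1 := H _ hk (by simp [zoomPoly, uu, Jet.set_u])
    obtain ⟨p00, p01, p02, p10, p20, p11, p12, p13, p21, p31⟩ := P _ hk
    simp only [zoomVar, p00, p01, p02, p10, p20, p11, p12, p13, p21, p31, uu, ut, ux,
      Jet.set_u, Jet.set_t, Jet.set_x] at e1
    simp at e1
    have : (f u)⁻¹ * (deriv τ t - deriv χ x) = 0 := by linear_combination (e0 - e1) / 2
    exact sub_eq_zero.1 ((mul_eq_zero.1 this).resolve_left hne)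
  · have e1 := H (ζ.set (2, 1) 1) (hDs _ _ (by simp)) (by simp [zoomPoly, uu, Jet.set_u])
    obtain ⟨p00, p01, p02, p10, p20, p11, p12, p13, p21, p31⟩ :=
      P (ζ.set (2, 1) 1) (hDs _ _ (by simp))
    simp only [zoomVar, p00, p01, p02, p10, p20, p11, p12, p13, p21, p31, uu, ut, ux,
      Jet.set_u, Jet.set_t, Jet.set_x, hτ2] at e1
    simp [hA'] at e0 e1
    linear_combination (e1 - e0) / 2
  · have e1 := H (ζ.set (1, 2) 1) (hDs _ _ (by simp)) (by simp [zoomPoly, uu, Jet.set_u])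
    obtain ⟨p00, p01, p02, p10, p20, p11, p12, p13, p21, p31⟩ :=
      P (ζ.set (1, 2) 1) (hDs _ _ (by simp))
    simp only [zoomVar, p00, p01, p02, p10, p20, p11, p12, p13, p21, p31, uu, ut, ux,
      Jet.set_u, Jet.set_t, Jet.set_x, hχ2] at e1
    simp [hA'] at e0 e1
    linear_combination (e0 - e1) / 2

end

/-- `(a t + b) ∂ₜ + (a x + c) ∂ₓ + (A u + B) ∂ᵤ` -/
def scaleField (a b c A B : ℝ) : PointField :=
  fun p => ((a * p.1.1 + b, a * p.1.2 + c), A * p.2 + B)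

/-! ### Local form of the symmetries -/

section box

variable {f g : ℝ → ℝ} {J₁ J₂ I : Set ℝ} {V : PointField}

theorem eq_affine_of_deriv_eq {J : Set ℝ} (hJ : IsOpen J) (hJc : IsPreconnected J) {φ : ℝ → ℝ}
    {a : ℝ} (hφ : DifferentiableOn ℝ φ J) (hφ' : ∀ s ∈ J, deriv φ s = a) {s₀ : ℝ} (hs₀ : s₀ ∈ J)
    {s : ℝ} (hs : s ∈ J) : φ s = a * s + (φ s₀ - a * s₀) := by
  have := eq_of_hasDerivAt_zero hJ hJc (φ := fun s => φ s - a * s) (fun r hr => by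
    have h1 := ((hφ.differentiableAt (hJ.mem_nhds hr)).hasDerivAt).sub
      ((hasDerivAt_id' r).const_mul a)
    rwa [hφ' r hr, mul_one, sub_self] at h1) hs hs₀
  linarith

/-- Over a product of intervals, every symmetry is of the form `scaleField`. -/
theorem IsLiePointSymmetry.exists_scaleField_box (hJ₁ : IsOpen J₁) (hJ₁c : IsPreconnected J₁)
    (hJ₂ : IsOpen J₂) (hJ₂c : IsPreconnected J₂) (hI : IsOpen I) (hIc : IsPreconnected I)
    (hh : ContDiffOn ℝ ∞ (fun u => (f u)⁻¹) I) (hg : ContDiffOn ℝ ∞ g I)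
    (hf0 : ∀ u ∈ I, f u ≠ 0) (hV : IsLiePointSymmetry f g (J₁ ×ˢ J₂) I V) {t₀ x₀ u₀ : ℝ}
    (ht₀ : t₀ ∈ J₁) (hx₀ : x₀ ∈ J₂) (hu₀ : u₀ ∈ I) (hd : deriv (fun v => (f v)⁻¹) u₀ ≠ 0) :
    ∃ a b c A B : ℝ, EqOn V (scaleField a b c A B) ((J₁ ×ˢ J₂) ×ˢ I) := by
  have hU : IsOpen (J₁ ×ˢ J₂) := hJ₁.prod hJ₂
  have hS : IsOpen ((J₁ ×ˢ J₂) ×ˢ I) := hU.prod hI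
  have sep := hV.exists_sepField hJ₁ hJ₁c hJ₂ hJ₂c hI hIc hh hg hf0 ht₀ hx₀ hu₀
  set τ : ℝ → ℝ := fun t => (V ((t, x₀), u₀)).1.1 with hτ
  set χ : ℝ → ℝ := fun x => (V ((t₀, x), u₀)).1.2 with hχ
  set η : (ℝ × ℝ) × ℝ → ℝ := fun p => (V p).2 with hη
  have sη : ContDiffOn ℝ ∞ η ((J₁ ×ˢ J₂) ×ˢ I) := hV.1.snd
  have sτ : ContDiffOn ℝ ∞ τ J₁ := hV.1.fst.fst.comp (g := fun p => (V p).1.1)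
    (f := fun t => ((t, x₀), u₀)) (by fun_prop) fun t ht => ⟨⟨ht, hx₀⟩, hu₀⟩
  have sχ : ContDiffOn ℝ ∞ χ J₂ := hV.1.fst.snd.comp (g := fun p => (V p).1.2)
    (f := fun x => ((t₀, x), u₀)) (by fun_prop) fun x hx => ⟨⟨ht₀, hx⟩, hu₀⟩
  set A : ℝ → ℝ := fun t => fderiv ℝ η ((t, x₀), u₀) ((0, 0), 1) with hA
  have sA : ContDiffOn ℝ ∞ A J₁ := (contDiffOn_fderiv_apply hS sη ((0, 0), 1)).comp
    (f := fun t => ((t, x₀), u₀)) (by fun_prop) fun t ht => ⟨⟨ht, hx₀⟩, hu₀⟩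
  set B : ℝ × ℝ → ℝ := fun p => η (p, u₀) - A p.1 * u₀ with hB
  have sB : ContDiffOn ℝ ∞ B (J₁ ×ˢ J₂) :=
    (sη.comp (f := fun p : ℝ × ℝ => (p, u₀)) (by fun_prop) fun p hp => ⟨hp, hu₀⟩).sub
      ((sA.comp contDiffOn_fst fun p hp => hp.1).mul contDiffOn_const)
  have aff : EqOn V (affineField τ χ A B) ((J₁ ×ˢ J₂) ×ˢ I) := by
    rintro ⟨⟨t, x⟩, u⟩ hp
    rw [sep hp]
    refine Prod.ext rfl ?_
    have := (hV.congr hU hI sep).exists_affine hJ₁ hJ₂ hJ₂c hI hIc hh hg hf0 sη hx₀ hu₀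
      hp.1.1 hp.1.2 hp.2
    change η ((t, x), u) = A t * u + (η ((t, x), u₀) - A t * u₀)
    rw [this]
    ring
  have C := fun {t x} (ht : t ∈ J₁) (hx : x ∈ J₂) => (hV.congr hU hI aff).affineField_coeffs
    hJ₁ hJ₂ hI sτ sχ sA sB hh hg hf0 ht hx hu₀
  -- A function of t equal to a function of x is constant; χ'(x₀) names the constant.
  have dτ : ∀ t ∈ J₁, deriv τ t = deriv χ x₀ := fun t ht => (C ht hx₀).2.1
  have dχ : ∀ x ∈ J₂, deriv χ x = deriv χ x₀ := fun x hx =>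
    (C ht₀ hx).2.1.symm.trans (dτ t₀ ht₀)
  have second : ∀ {φ : ℝ → ℝ} {J : Set ℝ}, IsOpen J → (∀ s ∈ J, deriv φ s = deriv χ x₀) →
      ∀ s ∈ J, deriv^[2] φ s = 0 := fun {φ J} hJ h s hs => by
    have : deriv φ =ᶠ[nhds s] fun _ => deriv χ x₀ :=
      Filter.eventually_of_mem (hJ.mem_nhds hs) h
    change deriv (deriv φ) s = 0
    rw [this.deriv_eq, deriv_const]
  -- B does not involve u, so one point u₀ with h'(u₀) ≠ 0 is enough.
  have dB : ∀ p ∈ J₁ ×ˢ J₂, fderiv ℝ B p = 0 := by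
    rintro ⟨t, x⟩ ⟨ht, hx⟩
    have h1 : fderiv ℝ B (t, x) (1, 0) = 0 :=
      (mul_eq_zero.1 ((C ht hx).2.2.1 (second hJ₁ dτ t ht))).resolve_left hd
    have h2 : fderiv ℝ B (t, x) (0, 1) = 0 :=
      (mul_eq_zero.1 ((C ht hx).2.2.2 (second hJ₂ dχ x hx))).resolve_left hd
    ext <;> simp [h1, h2]
  refine ⟨deriv χ x₀, τ t₀ - deriv χ x₀ * t₀, χ x₀ - deriv χ x₀ * x₀, A t₀, B (t₀, x₀),
    fun p hp => ?_⟩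
  rw [aff hp]
  refine Prod.ext (Prod.ext ?_ ?_) ?_
  · exact eq_affine_of_deriv_eq hJ₁ hJ₁c (sτ.differentiableOn (by simp)) dτ ht₀ hp.1.1
  · exact eq_affine_of_deriv_eq hJ₂ hJ₂c (sχ.differentiableOn (by simp)) dχ hx₀ hp.1.2
  · have e1 : A p.1.1 = A t₀ := hJ₁.is_const_of_deriv_eq_zero hJ₁c
      (sA.differentiableOn (by simp)) (fun t ht => (C ht hx₀).1) hp.1.1 ht₀
    have e2 : B p.1 = B (t₀, x₀) := hU.is_const_of_fderiv_eq_zero (hJ₁c.prod hJ₂c)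
      (sB.differentiableOn (by simp)) (fun q hq => dB q hq) hp.1 ⟨ht₀, hx₀⟩
    change A p.1.1 * p.2 + B p.1 = A t₀ * p.2 + B (t₀, x₀)
    rw [e1, e2]

end box

/-! ### From local to global -/

section globalization

/-- The coefficients are polynomials, so the identity theorem for analytic functions applies. -/
theorem scaleField_eq_of_eventuallyEq {a b c A B a' b' c' A' B' : ℝ} {p : (ℝ × ℝ) × ℝ}
    (h : scaleField a b c A B =ᶠ[nhds p] scaleField a' b' c' A' B') :
    scaleField a b c A B = scaleField a' b' c' A' B' := by
  have key : ∀ a b c A B, AnalyticOnNhd ℝ (scaleField a b c A B) univ :=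
    fun a b c A B => by
      have : ContDiff ℝ ω (scaleField a b c A B) := by unfold scaleField; fun_prop
      exact contDiff_omega_iff_analyticOnNhd.1 this
  exact (key a b c A B).eq_of_eventuallyEq (key a' b' c' A' B') h

variable {f g : ℝ → ℝ} {U : Set (ℝ × ℝ)} {I : Set ℝ} {V : PointField}

/-- The set of points near which V equals one fixed `scaleField` is open. It is also relatively
closed in U × I: near a limit point V equals some `scaleField`, and the two agree on a nonempty open
set, hence everywhere. -/
theorem IsLiePointSymmetry.exists_scaleField (hU : IsOpen U) (hUc : IsConnected U)
    (hI : IsOpen I) (hIc : IsPreconnected I)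
    (hh : ContDiffOn ℝ ∞ (fun u => (f u)⁻¹) I) (hg : ContDiffOn ℝ ∞ g I)
    (hf0 : ∀ u ∈ I, f u ≠ 0) {u₀ : ℝ} (hu₀ : u₀ ∈ I) (hd : deriv (fun v => (f v)⁻¹) u₀ ≠ 0)
    (hV : IsLiePointSymmetry f g U I V) :
    ∃ a b c A B : ℝ, EqOn V (scaleField a b c A B) (U ×ˢ I) := by
  have loc : ∀ p ∈ U ×ˢ I, ∃ a b c A B : ℝ, V =ᶠ[nhds p] scaleField a b c A B := by
    rintro ⟨⟨t, x⟩, u⟩ ⟨hp, hu⟩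
    obtain ⟨r, hr, hrU⟩ := Metric.isOpen_iff.1 hU _ hp
    rw [← ball_prod_same] at hrU
    -- The box shrinks only in t and x and keeps all of I, so the same u₀ serves everywhere.
    obtain ⟨a, b, c, A, B, h⟩ := (hV.mono hrU).exists_scaleField_box Metric.isOpen_ball
      (convex_ball t r).isPreconnected Metric.isOpen_ball (convex_ball x r).isPreconnected hI hIc
      hh hg hf0 (Metric.mem_ball_self hr) (Metric.mem_ball_self hr) hu₀ hd
    refine ⟨a, b, c, A, B, Filter.eventually_of_mem
      (((Metric.isOpen_ball.prod Metric.isOpen_ball).prod hI).mem_nhds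
        ⟨⟨Metric.mem_ball_self hr, Metric.mem_ball_self hr⟩, hu⟩) h⟩
  obtain ⟨p₀, hp₀⟩ := hUc.nonempty
  obtain ⟨a, b, c, A, B, h₀⟩ := loc (p₀, u₀) ⟨hp₀, hu₀⟩
  refine ⟨a, b, c, A, B, ?_⟩
  have hsub : U ×ˢ I ⊆ {p | V =ᶠ[nhds p] scaleField a b c A B} := by
    refine (hUc.isPreconnected.prod hIc).subset_of_closure_inter_subset
      (isOpen_setOfPred_eventually_nhds) ⟨(p₀, u₀), ⟨hp₀, hu₀⟩, h₀⟩ ?_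
    rintro q ⟨hq, hqS⟩
    obtain ⟨a', b', c', A', B', h'⟩ := loc q hqS
    obtain ⟨r, hr, hr'⟩ := mem_closure_iff_nhds.1 hq _ h'.eventually_nhds
    have : scaleField a b c A B = scaleField a' b' c' A' B' :=
      scaleField_eq_of_eventuallyEq (Filter.EventuallyEq.trans hr'.symm hr)
    exact this ▸ h'
  exact fun p hp => (hsub hp).self_of_nhds

end globalization

/-! ### The symmetry condition for `scaleField` -/

/-- Every derivative coordinate of order n ≥ 1 is scaled with weight A - n a. -/
theorem prolong_scaleField (a b c A B : ℝ) (z : Jet) :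
    (prolong (scaleField a b c A B) 0 0 z = A * z.u (0, 0) + B) ∧
    (prolong (scaleField a b c A B) 0 1 z = (A - a) * z.u (0, 1)) ∧
    (prolong (scaleField a b c A B) 0 2 z = (A - 2 * a) * z.u (0, 2)) ∧
    (prolong (scaleField a b c A B) 1 0 z = (A - a) * z.u (1, 0)) ∧
    (prolong (scaleField a b c A B) 2 0 z = (A - 2 * a) * z.u (2, 0)) ∧
    (prolong (scaleField a b c A B) 1 1 z = (A - 2 * a) * z.u (1, 1)) ∧
    (prolong (scaleField a b c A B) 1 2 z = (A - 3 * a) * z.u (1, 2)) ∧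
    (prolong (scaleField a b c A B) 1 3 z = (A - 4 * a) * z.u (1, 3)) ∧
    (prolong (scaleField a b c A B) 2 1 z = (A - 3 * a) * z.u (2, 1)) ∧
    (prolong (scaleField a b c A B) 3 1 z = (A - 4 * a) * z.u (3, 1)) := by
  have hV : scaleField a b c A B
      = affineField (fun t => a * t + b) (fun x => a * x + c) (fun _ => A) (fun _ => B) := rfl
  have hX : dirX (fun _ => B) = fun _ => 0 := by funext p; simp [dirX]
  have hT : dirT (fun _ => B) = fun _ => 0 := by funext p; simp [dirT]
  have hX0 : dirX (fun _ => 0) = fun _ => 0 := by funext p; simp [dirX]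
  have hT0 : dirT (fun _ => 0) = fun _ => 0 := by funext p; simp [dirT]
  have hd : ∀ r : ℝ, deriv (fun t => a * t + r) = fun _ => a := fun r => by
    funext t
    simp
  obtain ⟨p00, p01, p02, p10, p20, p11, p12, p13, p21, p31⟩ :=
    prolong_affineField (J₁ := univ) (J₂ := univ) (I := univ) (τ := fun t => a * t + b)
      (χ := fun x => a * x + c) (A := fun _ => A) (B := fun _ => B) isOpen_univ isOpen_univ
      isOpen_univ (by fun_prop) (by fun_prop) (by fun_prop) (by fun_prop) (z := z)
      ⟨⟨mem_univ _, mem_univ _⟩, mem_univ _⟩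
  rw [hV, p00, p01, p02, p10, p20, p11, p12, p13, p21, p31]
  simp only [hX, hT, hX0, hT0, Function.iterate_succ, Function.iterate_zero, id, Function.comp,
    hd, deriv_const']
  refine ⟨trivial, ?_, ?_, ?_, ?_, ?_, ?_, ?_, ?_, ?_⟩ <;> ring

theorem HasDerivAt.eq_of_eqOn {J : Set ℝ} (hJ : IsOpen J) {φ ψ : ℝ → ℝ} (h : EqOn φ ψ J)
    {s a b : ℝ} (hs : s ∈ J) (hφ : HasDerivAt φ a s) (hψ : HasDerivAt ψ b s) : a = b :=
  hφ.unique (hψ.congr_of_eventuallyEq (Filter.eventually_of_mem (hJ.mem_nhds hs) h))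

variable {f g : ℝ → ℝ} {U : Set (ℝ × ℝ)} {I : Set ℝ}

/-- The jet with only `u`, `u_t`, `u_tx`, `u_ttx` and `u_txxx` nonzero. -/
def Jet.mixed (t x u p q r s : ℝ) : Jet where
  t := t
  x := x
  u k := if k = (0, 0) then u else if k = (1, 0) then p else if k = (1, 1) then q
    else if k = (2, 1) then r else if k = (1, 3) then s else 0

/-- Here κ is the constant value of f' (A u + B) / f. Conversely, the two equations and their
derivatives make every term of the equation scale by the same factor, so the prolonged field
multiplies the left-hand side by A - 4a - κ. -/
theorem isLiePointSymmetry_scaleField_iff (hU : IsOpen U) (hUn : U.Nonempty) (hI : IsOpen I)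
    (hIc : IsConnected I) (hf : ContDiffOn ℝ ∞ f I) (hg : ContDiffOn ℝ ∞ g I)
    (hf0 : ∀ u ∈ I, f u ≠ 0) (a b c A B : ℝ) :
    IsLiePointSymmetry f g U I (scaleField a b c A B) ↔
      ∃ κ : ℝ, ∀ u ∈ I, deriv f u * (A * u + B) = κ * f u ∧
        deriv (deriv g) u * (A * u + B) = -(κ + 2 * a) * deriv g u := by
  have hh : ContDiffOn ℝ ∞ (fun u => (f u)⁻¹) I := hf.inv hf0
  rw [isLiePointSymmetry_iff hU hI hh hg]
  set h : ℝ → ℝ := fun u => (f u)⁻¹ with hdef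
  have dh : ∀ n, ∀ u ∈ I, HasDerivAt (deriv^[n] h) (deriv^[n + 1] h u) u := fun n u hu =>
    hasDerivAt_iterate_deriv hI hh n hu
  have dg : ∀ n, ∀ u ∈ I, HasDerivAt (deriv^[n] g) (deriv^[n + 1] g u) u := fun n u hu =>
    hasDerivAt_iterate_deriv hI hg n hu
  have df : ∀ u ∈ I, HasDerivAt f (deriv f u) u := fun u hu =>
    hasDerivAt_iterate_deriv hI hf 0 hu
  have hhf : ∀ u ∈ I, h u * f u = 1 := fun u hu => inv_mul_cancel₀ (hf0 u hu)
  have hh1 : ∀ u ∈ I, deriv^[1] h u * f u ^ 2 = -deriv f u := fun u hu => by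
    have : deriv^[1] h u = -deriv f u / f u ^ 2 := ((df u hu).fun_inv (hf0 u hu)).deriv
    rw [this, div_mul_cancel₀ _ (pow_ne_zero 2 (hf0 u hu))]
  have dη : ∀ u : ℝ, HasDerivAt (fun u => A * u + B) A u := fun u => by
    simpa using ((hasDerivAt_id u).const_mul A).add_const B
  have smooth : ContDiffOn ℝ ∞ (scaleField a b c A B) (U ×ˢ I) := by
    unfold scaleField; fun_prop
  constructor
  · rintro ⟨-, H⟩
    obtain ⟨⟨t, x⟩, htx⟩ := hUn
    obtain ⟨u₀, hu₀⟩ := hIc.nonempty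
    -- The jet has u_t = u_ttx = 1, and u_txxx = 2 h' f is solved from the equation. With η = A u +
    -- B the result says that h' η / h has derivative zero.
    have C1 : ∀ u ∈ I, h u * (deriv^[2] h u * (A * u + B) + deriv^[1] h u * A)
        = deriv^[1] h u ^ 2 * (A * u + B) := fun u hu => by
      have e := H (Jet.mixed t x u 1 0 1 (2 * deriv^[1] h u * f u))
        ⟨htx, by simpa [Jet.mixed] using hu⟩ (by
          simp [Jet.mixed, zoomPoly]
          linear_combination (-2 * deriv h u) * hhf u hu)
      obtain ⟨p00, p01, p02, p10, p20, p11, p12, p13, p21, p31⟩ :=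
        prolong_scaleField a b c A B (Jet.mixed t x u 1 0 1 (2 * deriv^[1] h u * f u))
      simp only [zoomVar, p00, p01, p02, p10, p20, p11, p12, p13, p21, p31] at e
      simp [Jet.mixed] at e
      have k := hhf u hu
      simp only [Function.iterate_succ, Function.iterate_zero, id, Function.comp] at e ⊢
      linear_combination (h u / 2) * e + (deriv h u ^ 2 * (A * u + B) +
        (A - 4 * a) * deriv h u * h u) * k
    -- With u_tx = 1 and u_t = u_x = 0 only h u_txxx = 2 g' u_tx remains of the equation, whence
    -- u_txxx = 2 g' f.
    have C2 : ∀ u ∈ I, h u * (deriv^[2] g u * (A * u + B) + 2 * a * deriv^[1] g u)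
        = deriv^[1] h u * (A * u + B) * deriv^[1] g u := fun u hu => by
      have e := H (Jet.mixed t x u 0 1 0 (2 * deriv^[1] g u * f u))
        ⟨htx, by simpa [Jet.mixed] using hu⟩ (by
          simp [Jet.mixed, zoomPoly]
          linear_combination (-2 * deriv g u) * hhf u hu)
      obtain ⟨p00, p01, p02, p10, p20, p11, p12, p13, p21, p31⟩ :=
        prolong_scaleField a b c A B (Jet.mixed t x u 0 1 0 (2 * deriv^[1] g u * f u))
      simp only [zoomVar, p00, p01, p02, p10, p20, p11, p12, p13, p21, p31] at e
      simp [Jet.mixed] at e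
      have k := hhf u hu
      simp only [Function.iterate_succ, Function.iterate_zero, id, Function.comp] at e ⊢
      linear_combination (h u / 2) * e + (deriv h u * (A * u + B) * deriv g u +
        (A - 4 * a) * deriv g u * h u) * k
    -- Since f = 1/h, this quantity is h' η / h = -κ.
    have const : ∀ u ∈ I, deriv^[1] h u * f u * (A * u + B)
        = deriv^[1] h u₀ * f u₀ * (A * u₀ + B) := fun u hu =>
      eq_of_hasDerivAt_zero hI hIc.isPreconnected
        (φ := fun u => deriv^[1] h u * f u * (A * u + B)) (fun u hu => by
          have d := (((dh 1 u hu).mul (df u hu)).mul (dη u))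
          refine d.congr_deriv ?_
          have k := hhf u hu
          simp only [Pi.mul_apply]
          linear_combination (deriv^[1] h u * (A * u + B)) * hh1 u hu + f u ^ 2 * C1 u hu
            - f u * (deriv^[2] h u * (A * u + B) + deriv^[1] h u * A) * k) hu hu₀
    refine ⟨-(deriv^[1] h u₀ * f u₀ * (A * u₀ + B)), fun u hu => ⟨?_, ?_⟩⟩
    · linear_combination (-f u) * const u hu + (A * u + B) * hh1 u hu
    · have k := hhf u hu
      change deriv^[2] g u * _ = _ * deriv^[1] g u
      linear_combination f u * C2 u hu + (deriv^[1] g u) * const u hu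
        - (deriv^[2] g u * (A * u + B) + 2 * a * deriv^[1] g u) * k
  · rintro ⟨κ, hκ⟩
    refine ⟨smooth, fun z hz h0 => ?_⟩
    have D1 : ∀ u ∈ I, deriv^[1] h u * (A * u + B) = -κ * h u := fun u hu => by
      have hne : f u ^ 2 ≠ 0 := pow_ne_zero 2 (hf0 u hu)
      refine mul_right_cancel₀ hne ?_
      linear_combination (A * u + B) * hh1 u hu - (hκ u hu).1 + κ * f u * hhf u hu
    have D2 : ∀ u ∈ I, deriv^[2] h u * (A * u + B) + deriv^[1] h u * A = -κ * deriv^[1] h u :=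
      fun u hu => HasDerivAt.eq_of_eqOn hI D1 hu ((dh 1 u hu).mul (dη u))
        ((dh 0 u hu).const_mul (-κ))
    have D3 : ∀ u ∈ I, deriv^[3] h u * (A * u + B) + deriv^[2] h u * A + deriv^[2] h u * A
        = -κ * deriv^[2] h u := fun u hu =>
      HasDerivAt.eq_of_eqOn hI D2 hu (((dh 2 u hu).mul (dη u)).add ((dh 1 u hu).mul_const A))
        ((dh 1 u hu).const_mul (-κ))
    have G2 : ∀ u ∈ I, deriv^[2] g u * (A * u + B) = -(κ + 2 * a) * deriv^[1] g u :=
      fun u hu => (hκ u hu).2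
    have G3 : ∀ u ∈ I, deriv^[3] g u * (A * u + B) + deriv^[2] g u * A
        = -(κ + 2 * a) * deriv^[2] g u := fun u hu =>
      HasDerivAt.eq_of_eqOn hI G2 hu ((dg 2 u hu).mul (dη u)) ((dg 1 u hu).const_mul _)
    obtain ⟨p00, p01, p02, p10, p20, p11, p12, p13, p21, p31⟩ :=
      prolong_scaleField a b c A B z
    simp only [zoomVar, p00, p01, p02, p10, p20, p11, p12, p13, p21, p31]
    rw [zoomPoly] at h0
    have hu := hz.2
    linear_combination (-κ + A - 4 * a) * h0 + (z.u (3, 1) - z.u (1, 3)) * D1 _ hu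
      + (2 * (z.u (1, 0) * z.u (2, 1) - z.u (0, 1) * z.u (1, 2))
        + (z.u (2, 0) - z.u (0, 2)) * z.u (1, 1)) * D2 _ hu
      + (z.u (1, 0) ^ 2 - z.u (0, 1) ^ 2) * z.u (1, 1) * D3 _ hu
      + 2 * z.u (1, 1) * G2 _ hu + 2 * z.u (1, 0) * z.u (0, 1) * G3 _ hu

/-! ### The ordinary differential equations for the coefficient functions -/

section ode

variable {I : Set ℝ} {c : ℝ}

/-- `Real.log` is even, so |u - c|^K = exp(K log(u - c)) on both sides of c and no case distinction
is needed. -/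
theorem hasDerivAt_abs_sub_rpow (K : ℝ) {u : ℝ} (hu : u ≠ c) :
    HasDerivAt (fun u => |u - c| ^ K) (K * |u - c| ^ K / (u - c)) u := by
  have hne : u - c ≠ 0 := sub_ne_zero.2 hu
  have h1 : HasDerivAt (fun u => Real.exp (Real.log (u - c) * K))
      (Real.exp (Real.log (u - c) * K) * (1 / (u - c) * K)) u :=
    ((((hasDerivAt_id u).sub_const c).log hne).mul_const K).exp
  have key : ∀ v, v ≠ c → |v - c| ^ K = Real.exp (Real.log (v - c) * K) := fun v hv => by
    rw [Real.rpow_def_of_pos (abs_pos.2 (sub_ne_zero.2 hv)), Real.log_abs]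
  rw [key u hu]
  refine (h1.congr_of_eventuallyEq ?_).congr_deriv (by ring)
  filter_upwards [isOpen_ne.mem_nhds hu] with v hv using key v hv

/-- The integrating factor is |u - c|^(-K). -/
theorem eq_abs_rpow_of_deriv (hI : IsOpen I) (hIc : IsConnected I) (hc : c ∉ I) {φ φ' : ℝ → ℝ}
    {K : ℝ} (hφ : ∀ u ∈ I, HasDerivAt φ (φ' u) u) (h : ∀ u ∈ I, φ' u * (u - c) = K * φ u) :
    ∃ φ₀ : ℝ, ∀ u ∈ I, φ u = φ₀ * |u - c| ^ K := by
  obtain ⟨u₀, hu₀⟩ := hIc.nonempty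
  have hne : ∀ u ∈ I, u ≠ c := fun u hu h => hc (h ▸ hu)
  refine ⟨φ u₀ * |u₀ - c| ^ (-K), fun u hu => ?_⟩
  have e := eq_of_hasDerivAt_zero hI hIc.isPreconnected (φ := fun u => φ u * |u - c| ^ (-K))
    (fun v hv => by
      refine ((hφ v hv).mul (hasDerivAt_abs_sub_rpow (-K) (hne v hv))).congr_deriv ?_
      have := sub_ne_zero.2 (hne v hv)
      field_simp
      linear_combination |v - c| ^ (-K) * h v hv) hu hu₀
  have hpos : 0 < |u - c| := abs_pos.2 (sub_ne_zero.2 (hne u hu))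
  have e' : φ u * |u - c| ^ (-K) = φ u₀ * |u₀ - c| ^ (-K) := e
  rw [← e', mul_assoc, ← Real.rpow_add hpos]
  simp

theorem eq_exp_of_deriv (hI : IsOpen I) (hIc : IsConnected I) {φ φ' : ℝ → ℝ}
    {K : ℝ} (hφ : ∀ u ∈ I, HasDerivAt φ (φ' u) u) (h : ∀ u ∈ I, φ' u = K * φ u) :
    ∃ φ₀ : ℝ, ∀ u ∈ I, φ u = φ₀ * Real.exp (K * u) := by
  obtain ⟨u₀, hu₀⟩ := hIc.nonempty
  refine ⟨φ u₀ * Real.exp (-K * u₀), fun u hu => ?_⟩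
  have e := eq_of_hasDerivAt_zero hI hIc.isPreconnected (φ := fun u => φ u * Real.exp (-K * u))
    (fun v hv => by
      refine ((hφ v hv).mul (((hasDerivAt_id v).const_mul (-K)).exp)).congr_deriv ?_
      simp only [id]
      linear_combination Real.exp (-K * v) * h v hv) hu hu₀
  have e' : φ u * Real.exp (-K * u) = φ u₀ * Real.exp (-K * u₀) := e
  rw [← e', mul_assoc, ← Real.exp_add]
  simp

theorem eq_const_add_of_hasDerivAt (hI : IsOpen I) (hIc : IsConnected I) {φ ψ φ' : ℝ → ℝ}
    (hφ : ∀ u ∈ I, HasDerivAt φ (φ' u) u) (hψ : ∀ u ∈ I, HasDerivAt ψ (φ' u) u) :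
    ∃ r : ℝ, ∀ u ∈ I, φ u = r + ψ u := by
  obtain ⟨u₀, hu₀⟩ := hIc.nonempty
  refine ⟨φ u₀ - ψ u₀, fun u hu => ?_⟩
  have e : φ u - ψ u = φ u₀ - ψ u₀ := eq_of_hasDerivAt_zero hI hIc.isPreconnected
    (φ := fun u => φ u - ψ u) (fun v hv => ((hφ v hv).sub (hψ v hv)).congr_deriv (sub_self _)) hu hu₀
  linarith

end ode

/-! ### Coefficient functions of power type and of exponential type -/

/-- The differential equations of the families built from powers and logarithms of `|u - c|`. -/
def PowerType (f g : ℝ → ℝ) (I : Set ℝ) (c K m : ℝ) : Prop :=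
  c ∉ I ∧ ∀ u ∈ I, deriv f u * (u - c) = K * f u ∧ deriv (deriv g) u * (u - c) = m * deriv g u

/-- The differential equations of the families built from exponential functions. -/
def ExpType (f g : ℝ → ℝ) (I : Set ℝ) (K m : ℝ) : Prop :=
  ∀ u ∈ I, deriv f u = K * f u ∧ deriv (deriv g) u = m * deriv g u

section types

variable {f g : ℝ → ℝ} {I : Set ℝ} {c K m : ℝ}

theorem hasDerivAt_of_contDiffOn {φ : ℝ → ℝ} (hI : IsOpen I) (hφ : ContDiffOn ℝ ∞ φ I) {u : ℝ}
    (hu : u ∈ I) : HasDerivAt φ (deriv φ u) u := hasDerivAt_iterate_deriv hI hφ 0 hu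

theorem hasDerivAt_deriv_of_contDiffOn {φ : ℝ → ℝ} (hI : IsOpen I) (hφ : ContDiffOn ℝ ∞ φ I)
    {u : ℝ} (hu : u ∈ I) : HasDerivAt (deriv φ) (deriv (deriv φ) u) u :=
  hasDerivAt_iterate_deriv hI hφ 1 hu

theorem PowerType.exists_rpow (hI : IsOpen I) (hIc : IsConnected I) (hf : ContDiffOn ℝ ∞ f I)
    (hg : ContDiffOn ℝ ∞ g I) (h : PowerType f g I c K m) (hm : m ≠ -1) :
    ∃ f₀ g₀ g₁ : ℝ, ∀ u ∈ I, f u = f₀ * |u - c| ^ K ∧ g u = g₀ + g₁ * |u - c| ^ (m + 1) := by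
  obtain ⟨f₀, hf₀⟩ := eq_abs_rpow_of_deriv hI hIc h.1
    (fun u hu => hasDerivAt_of_contDiffOn hI hf hu) fun u hu => (h.2 u hu).1
  -- The product g' (u - c) satisfies the first-order equation with exponent m + 1, which is the
  -- exponent of its antiderivative in g. For m = -1 the exponent is 0 and g becomes a logarithm.
  obtain ⟨C, hC⟩ := eq_abs_rpow_of_deriv hI hIc h.1 (K := m + 1)
    (fun u hu => (hasDerivAt_deriv_of_contDiffOn hI hg hu).mul ((hasDerivAt_id u).sub_const c))
    fun u hu => by
      simp only [id, Pi.mul_apply]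
      linear_combination (u - c) * (h.2 u hu).2
  have hm1 : m + 1 ≠ 0 := fun e => hm (by linarith)
  obtain ⟨g₀, hg₀⟩ := eq_const_add_of_hasDerivAt hI hIc (φ := g)
    (ψ := fun u => C / (m + 1) * |u - c| ^ (m + 1))
    (fun u hu => hasDerivAt_of_contDiffOn hI hg hu) fun u hu => by
      have hne : u ≠ c := fun e => h.1 (e ▸ hu)
      refine ((hasDerivAt_abs_sub_rpow (m + 1) hne).const_mul _).congr_deriv ?_
      have := sub_ne_zero.2 hne
      have e : deriv g u * (u - c) = C * |u - c| ^ (m + 1) := hC u hu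
      field_simp
      linear_combination -e
  exact ⟨f₀, g₀, C / (m + 1), fun u hu => ⟨hf₀ u hu, hg₀ u hu⟩⟩

theorem PowerType.exists_log (hI : IsOpen I) (hIc : IsConnected I) (hf : ContDiffOn ℝ ∞ f I)
    (hg : ContDiffOn ℝ ∞ g I) (h : PowerType f g I c K (-1)) :
    ∃ f₀ g₀ g₁ : ℝ, ∀ u ∈ I, f u = f₀ * |u - c| ^ K ∧ g u = g₀ + g₁ * Real.log |u - c| := by
  obtain ⟨f₀, hf₀⟩ := eq_abs_rpow_of_deriv hI hIc h.1
    (fun u hu => hasDerivAt_of_contDiffOn hI hf hu) fun u hu => (h.2 u hu).1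
  obtain ⟨C, hC⟩ := eq_abs_rpow_of_deriv hI hIc h.1 (K := 0)
    (fun u hu => (hasDerivAt_deriv_of_contDiffOn hI hg hu).mul ((hasDerivAt_id u).sub_const c))
    fun u hu => by
      simp only [id, Pi.mul_apply]
      linear_combination (u - c) * (h.2 u hu).2
  obtain ⟨g₀, hg₀⟩ := eq_const_add_of_hasDerivAt hI hIc (φ := g)
    (ψ := fun u => C * Real.log |u - c|)
    (fun u hu => hasDerivAt_of_contDiffOn hI hg hu) fun u hu => by
      have hne : u - c ≠ 0 := sub_ne_zero.2 fun e => h.1 (e ▸ hu)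
      have e : deriv g u * (u - c) = C * |u - c| ^ (0 : ℝ) := hC u hu
      rw [Real.rpow_zero] at e
      simp only [Real.log_abs]
      refine ((((hasDerivAt_id u).sub_const c).log hne).const_mul C).congr_deriv ?_
      simp only [id]
      field_simp
      linear_combination -e
  exact ⟨f₀, g₀, C, fun u hu => ⟨hf₀ u hu, hg₀ u hu⟩⟩

theorem ExpType.exists_exp (hI : IsOpen I) (hIc : IsConnected I) (hf : ContDiffOn ℝ ∞ f I)
    (hg : ContDiffOn ℝ ∞ g I) (h : ExpType f g I K m) (hm : m ≠ 0) :
    ∃ f₀ g₀ g₁ : ℝ, ∀ u ∈ I, f u = f₀ * Real.exp (K * u) ∧ g u = g₀ + g₁ * Real.exp (m * u) := by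
  obtain ⟨f₀, hf₀⟩ := eq_exp_of_deriv hI hIc
    (fun u hu => hasDerivAt_of_contDiffOn hI hf hu) fun u hu => (h u hu).1
  obtain ⟨C, hC⟩ := eq_exp_of_deriv hI hIc
    (fun u hu => hasDerivAt_deriv_of_contDiffOn hI hg hu) fun u hu => (h u hu).2
  obtain ⟨g₀, hg₀⟩ := eq_const_add_of_hasDerivAt hI hIc (φ := g)
    (ψ := fun u => C / m * Real.exp (m * u))
    (fun u hu => hasDerivAt_of_contDiffOn hI hg hu) fun u hu => by
      refine ((((hasDerivAt_id u).const_mul m).exp).const_mul (C / m)).congr_deriv ?_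
      rw [hC u hu]
      simp only [id]
      field_simp
  exact ⟨f₀, g₀, C / m, fun u hu => ⟨hf₀ u hu, hg₀ u hu⟩⟩

theorem ExpType.exists_linear (hI : IsOpen I) (hIc : IsConnected I) (hf : ContDiffOn ℝ ∞ f I)
    (hg : ContDiffOn ℝ ∞ g I) (h : ExpType f g I K 0) :
    ∃ f₀ g₀ g₁ : ℝ, ∀ u ∈ I, f u = f₀ * Real.exp (K * u) ∧ g u = g₀ + g₁ * u := by
  obtain ⟨f₀, hf₀⟩ := eq_exp_of_deriv hI hIc
    (fun u hu => hasDerivAt_of_contDiffOn hI hf hu) fun u hu => (h u hu).1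
  obtain ⟨C, hC⟩ := eq_exp_of_deriv hI hIc
    (fun u hu => hasDerivAt_deriv_of_contDiffOn hI hg hu) fun u hu => (h u hu).2
  obtain ⟨g₀, hg₀⟩ := eq_const_add_of_hasDerivAt hI hIc (φ := g) (ψ := fun u => C * u)
    (fun u hu => hasDerivAt_of_contDiffOn hI hg hu) fun u hu => by
      refine ((hasDerivAt_id u).const_mul C).congr_deriv ?_
      rw [hC u hu]
      simp
  exact ⟨f₀, g₀, C, fun u hu => ⟨hf₀ u hu, hg₀ u hu⟩⟩

/-- Powers and logarithms are treated together: g' (u - c) = C |u - c|^e holds for g a power with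
exponent e, and for the logarithm with e = 0. -/
theorem PowerType.of_deriv (hI : IsOpen I) (hg : ContDiffOn ℝ ∞ g I) (hc : c ∉ I) {f₀ C e : ℝ}
    (hf₀ : ∀ u ∈ I, f u = f₀ * |u - c| ^ K)
    (hC : ∀ u ∈ I, deriv g u * (u - c) = C * |u - c| ^ e) :
    PowerType f g I c K (e - 1) := by
  have hne : ∀ u ∈ I, u ≠ c := fun u hu h => hc (h ▸ hu)
  refine ⟨hc, fun u hu => ⟨?_, ?_⟩⟩
  · have h1 : HasDerivAt f (f₀ * (K * |u - c| ^ K / (u - c))) u :=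
      ((hasDerivAt_abs_sub_rpow K (hne u hu)).const_mul f₀).congr_of_eventuallyEq
        (Filter.eventually_of_mem (hI.mem_nhds hu) hf₀)
    have := sub_ne_zero.2 (hne u hu)
    rw [h1.deriv, hf₀ u hu]
    field_simp
  · have h1 := HasDerivAt.eq_of_eqOn hI hC hu
      ((hasDerivAt_deriv_of_contDiffOn hI hg hu).mul ((hasDerivAt_id u).sub_const c))
      ((hasDerivAt_abs_sub_rpow e (hne u hu)).const_mul C)
    simp only [mul_one] at h1
    have hn := sub_ne_zero.2 (hne u hu)
    have h2 : C * (e * |u - c| ^ e / (u - c)) = e * deriv g u := by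
      rw [mul_div_assoc', div_eq_iff hn]
      linear_combination (-e) * hC u hu
    linear_combination h1 + h2

theorem PowerType.of_rpow (hI : IsOpen I) (hg : ContDiffOn ℝ ∞ g I) (hc : c ∉ I)
    {f₀ g₀ g₁ e : ℝ} (h : ∀ u ∈ I, f u = f₀ * |u - c| ^ K ∧ g u = g₀ + g₁ * |u - c| ^ e) :
    PowerType f g I c K (e - 1) :=
  PowerType.of_deriv hI hg hc (C := g₁ * e) (fun u hu => (h u hu).1) fun u hu => by
    have hne : u ≠ c := fun e => hc (e ▸ hu)
    have h1 : HasDerivAt g (g₁ * (e * |u - c| ^ e / (u - c))) u :=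
      (((hasDerivAt_abs_sub_rpow e hne).const_mul g₁).const_add g₀).congr_of_eventuallyEq
        (Filter.eventually_of_mem (hI.mem_nhds hu) fun v hv => (h v hv).2)
    have := sub_ne_zero.2 hne
    rw [h1.deriv]
    field_simp

theorem PowerType.of_log (hI : IsOpen I) (hg : ContDiffOn ℝ ∞ g I) (hc : c ∉ I)
    {f₀ g₀ g₁ : ℝ} (h : ∀ u ∈ I, f u = f₀ * |u - c| ^ K ∧ g u = g₀ + g₁ * Real.log |u - c|) :
    PowerType f g I c K (-1) := by
  have := PowerType.of_deriv hI hg hc (C := g₁) (e := 0) (fun u hu => (h u hu).1) fun u hu => by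
    have hne : u - c ≠ 0 := sub_ne_zero.2 fun e => hc (e ▸ hu)
    have h1 : HasDerivAt g (g₁ * (1 / (u - c))) u :=
      (((((hasDerivAt_id u).sub_const c).log hne).const_mul g₁).const_add g₀).congr_of_eventuallyEq
        (Filter.eventually_of_mem (hI.mem_nhds hu) fun v hv => by
          simpa only [Real.log_abs, id] using (h v hv).2)
    rw [h1.deriv, Real.rpow_zero]
    field_simp
  simpa using this

theorem ExpType.of_deriv (hI : IsOpen I) (hg : ContDiffOn ℝ ∞ g I) {f₀ C : ℝ}
    (hf₀ : ∀ u ∈ I, f u = f₀ * Real.exp (K * u))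
    (hC : ∀ u ∈ I, deriv g u = C * Real.exp (m * u)) : ExpType f g I K m := fun u hu => by
  have de : ∀ r, HasDerivAt (fun u => Real.exp (r * u)) (Real.exp (r * u) * r) u := fun r => by
    simpa using ((hasDerivAt_id u).const_mul r).exp
  constructor
  · have h1 : HasDerivAt f (f₀ * (Real.exp (K * u) * K)) u :=
      ((de K).const_mul f₀).congr_of_eventuallyEq
        (Filter.eventually_of_mem (hI.mem_nhds hu) hf₀)
    rw [h1.deriv, hf₀ u hu]
    ring
  · have h1 := HasDerivAt.eq_of_eqOn hI hC hu (hasDerivAt_deriv_of_contDiffOn hI hg hu)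
      ((de m).const_mul C)
    rw [h1, hC u hu]
    ring

theorem ExpType.of_exp (hI : IsOpen I) (hg : ContDiffOn ℝ ∞ g I) {f₀ g₀ g₁ : ℝ}
    (h : ∀ u ∈ I, f u = f₀ * Real.exp (K * u) ∧ g u = g₀ + g₁ * Real.exp (m * u)) :
    ExpType f g I K m :=
  ExpType.of_deriv hI hg (C := g₁ * m) (fun u hu => (h u hu).1) fun u hu => by
    have h1 : HasDerivAt g (g₁ * (Real.exp (m * u) * (m * 1))) u :=
      ((((hasDerivAt_id u).const_mul m).exp.const_mul g₁).const_add g₀).congr_of_eventuallyEq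
        (Filter.eventually_of_mem (hI.mem_nhds hu) fun v hv => (h v hv).2)
    rw [h1.deriv]
    ring

theorem ExpType.of_linear (hI : IsOpen I) (hg : ContDiffOn ℝ ∞ g I) {f₀ g₀ g₁ : ℝ}
    (h : ∀ u ∈ I, f u = f₀ * Real.exp (K * u) ∧ g u = g₀ + g₁ * u) :
    ExpType f g I K 0 :=
  ExpType.of_deriv hI hg (C := g₁) (fun u hu => (h u hu).1) fun u hu => by
    have h1 : HasDerivAt g (g₁ * 1) u :=
      (((hasDerivAt_id u).const_mul g₁).const_add g₀).congr_of_eventuallyEq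
        (Filter.eventually_of_mem (hI.mem_nhds hu) fun v hv => (h v hv).2)
    rw [h1.deriv]
    simp

theorem exists_deriv_ne_zero {φ : ℝ → ℝ} (hI : IsOpen I) (hIc : IsConnected I)
    (hφ : ContDiffOn ℝ ∞ φ I) (hφc : ¬ ∃ r : ℝ, ∀ u ∈ I, φ u = r) :
    ∃ u ∈ I, deriv φ u ≠ 0 := by
  by_contra! h
  obtain ⟨r, hr⟩ := eq_const_add_of_hasDerivAt hI hIc (ψ := fun _ => 0)
    (fun u hu => hasDerivAt_of_contDiffOn hI hφ hu)
    fun u hu => by rw [h u hu]; exact hasDerivAt_const _ _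
  exact hφc ⟨r, by simpa using hr⟩

theorem eq_zero_of_affine_eq_zero (hI : IsOpen I) (hIn : I.Nonempty) {r s : ℝ}
    (h : ∀ u ∈ I, r * u + s = 0) : r = 0 ∧ s = 0 := by
  obtain ⟨u, hu⟩ := hIn
  have h1 : HasDerivAt (fun u => r * u + s) r u := by
    simpa using ((hasDerivAt_id u).const_mul r).add_const s
  have hr : r = 0 := HasDerivAt.eq_of_eqOn hI h hu h1 (hasDerivAt_const _ _)
  exact ⟨hr, by simpa [hr] using h u hu⟩

/-- The determining equations for `scaleField a b c A B`. -/
def Determining (f g : ℝ → ℝ) (I : Set ℝ) (a A B : ℝ) : Prop :=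
  ∃ κ : ℝ, ∀ u ∈ I, deriv f u * (A * u + B) = κ * f u ∧
    deriv (deriv g) u * (A * u + B) = -(κ + 2 * a) * deriv g u

variable {a A B : ℝ}

/-- Eliminating f'/f gives K (A u + B) = κ (u - c) on I, hence κ = K A and, as K ≠ 0 for nonconstant
f, B = -A c. The equation for g at a point with g' ≠ 0 then gives the relation between a and A. -/
theorem PowerType.determining_iff (hI : IsOpen I) (hIn : I.Nonempty) (hf0 : ∀ u ∈ I, f u ≠ 0)
    (hf' : ∃ u ∈ I, deriv f u ≠ 0) (hg' : ∃ u ∈ I, deriv g u ≠ 0) (h : PowerType f g I c K m) :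
    Determining f g I a A B ↔ B = -A * c ∧ (m + K) * A = -2 * a := by
  constructor
  · rintro ⟨κ, hκ⟩
    have hK : K ≠ 0 := by
      rintro rfl
      obtain ⟨u, hu, hne⟩ := hf'
      have hc : u - c ≠ 0 := sub_ne_zero.2 fun e => h.1 (e ▸ hu)
      exact mul_ne_zero hne hc (by simpa using (h.2 u hu).1)
    obtain ⟨e1, e2⟩ := eq_zero_of_affine_eq_zero hI hIn (r := K * A - κ) (s := K * B + κ * c)
      fun u hu => mul_left_cancel₀ (hf0 u hu) (by
        linear_combination (u - c) * (hκ u hu).1 - (A * u + B) * (h.2 u hu).1)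
    have hB : B = -A * c := mul_left_cancel₀ hK (by linear_combination e2 + c * e1)
    refine ⟨hB, ?_⟩
    obtain ⟨u, hu, hne⟩ := hg'
    refine mul_left_cancel₀ hne ?_
    linear_combination (hκ u hu).2 - A * (h.2 u hu).2 + deriv g u * e1
      - deriv (deriv g) u * hB
  · rintro ⟨hB, hA⟩
    refine ⟨K * A, fun u hu => ⟨?_, ?_⟩⟩
    · linear_combination A * (h.2 u hu).1 + deriv f u * hB
    · linear_combination A * (h.2 u hu).2 + deriv (deriv g) u * hB + deriv g u * hA

theorem ExpType.ne_zero (hf' : ∃ u ∈ I, deriv f u ≠ 0) (h : ExpType f g I K m) : K ≠ 0 := by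
  rintro rfl
  obtain ⟨u, hu, hne⟩ := hf'
  exact hne (by simpa using (h u hu).1)

/-- Here the elimination gives K (A u + B) = κ on I, so A = 0 and κ = K B. -/
theorem ExpType.determining_iff (hI : IsOpen I) (hIn : I.Nonempty) (hf0 : ∀ u ∈ I, f u ≠ 0)
    (hf' : ∃ u ∈ I, deriv f u ≠ 0) (hg' : ∃ u ∈ I, deriv g u ≠ 0) (h : ExpType f g I K m) :
    Determining f g I a A B ↔ A = 0 ∧ (m + K) * B = -2 * a := by
  constructor
  · rintro ⟨κ, hκ⟩
    have hK := h.ne_zero hf'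
    obtain ⟨e1, e2⟩ := eq_zero_of_affine_eq_zero hI hIn (r := K * A) (s := K * B - κ)
      fun u hu => mul_left_cancel₀ (hf0 u hu) (by
        linear_combination (hκ u hu).1 - (A * u + B) * (h u hu).1)
    have hA : A = 0 := (mul_eq_zero.1 e1).resolve_left hK
    refine ⟨hA, ?_⟩
    obtain ⟨u, hu, hne⟩ := hg'
    refine mul_left_cancel₀ hne ?_
    linear_combination (hκ u hu).2 - B * (h u hu).2 + deriv g u * e2
      - deriv (deriv g) u * u * hA
  · rintro ⟨rfl, hB⟩
    refine ⟨K * B, fun u hu => ⟨?_, ?_⟩⟩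
    · linear_combination B * (h u hu).1
    · linear_combination B * (h u hu).2 + deriv g u * hB

theorem Determining.powerType (hI : IsOpen I) (hf : ContDiffOn ℝ ∞ f I)
    (hf0 : ∀ u ∈ I, f u ≠ 0) (hf' : ∃ u ∈ I, deriv f u ≠ 0)
    (h : Determining f g I a A B) (hA : A ≠ 0) :
    ∃ c K m, PowerType f g I c K m ∧ (m + K) * A = -2 * a := by
  obtain ⟨κ, hκ⟩ := h
  refine ⟨-B / A, κ / A, -(κ + 2 * a) / A, ⟨fun hc => ?_, fun u hu => ⟨?_, ?_⟩⟩, ?_⟩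
  -- If the zero c of A u + B lay in I, then κ = 0 because f(c) ≠ 0, so f' (A u + B) would vanish on
  -- I. Where f' ≠ 0 this forces A u + B = 0, and differentiating the product there gives f' A = 0.
  · have hz : A * (-B / A) + B = 0 := by field_simp; ring
    have hκ0 : κ = 0 := by
      have := (hκ _ hc).1
      rw [hz, mul_zero] at this
      exact (mul_eq_zero.1 this.symm).resolve_right (hf0 _ hc)
    obtain ⟨u, hu, hne⟩ := hf'
    have hprod : ∀ u ∈ I, deriv f u * (A * u + B) = 0 := fun u hu => by
      rw [(hκ u hu).1, hκ0, zero_mul]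
    have hu0 : A * u + B = 0 := (mul_eq_zero.1 (hprod u hu)).resolve_left hne
    have d := HasDerivAt.eq_of_eqOn hI hprod hu ((hasDerivAt_deriv_of_contDiffOn hI hf hu).mul
      (((hasDerivAt_id u).const_mul A).add_const B)) (hasDerivAt_const _ _)
    simp only [hu0, mul_zero, zero_add, mul_one] at d
    exact mul_ne_zero hne hA d
  · have := (hκ u hu).1
    field_simp
    linear_combination this
  · have := (hκ u hu).2
    field_simp
    linear_combination this
  · field_simp
    ring

theorem Determining.expType (h : Determining f g I a 0 B) (hB : B ≠ 0) :
    ∃ K m, ExpType f g I K m ∧ (m + K) * B = -2 * a := by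
  obtain ⟨κ, hκ⟩ := h
  refine ⟨κ / B, -(κ + 2 * a) / B, fun u hu => ⟨?_, ?_⟩, ?_⟩
  · have := (hκ u hu).1
    field_simp
    linear_combination this
  · have := (hκ u hu).2
    field_simp
    linear_combination this
  · field_simp
    ring

theorem Determining.eq_zero (hf0 : ∀ u ∈ I, f u ≠ 0)
    (hg' : ∃ u ∈ I, deriv g u ≠ 0) (h : Determining f g I a 0 0) : a = 0 := by
  obtain ⟨κ, hκ⟩ := h
  obtain ⟨u, hu, hne⟩ := hg'
  have hκ0 : κ = 0 := by
    have := (hκ u hu).1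
    simp only [zero_mul, add_zero, mul_zero] at this
    exact (mul_eq_zero.1 this.symm).resolve_right (hf0 u hu)
  have := (hκ u hu).2
  simp only [zero_mul, add_zero, mul_zero, hκ0] at this
  have := (mul_eq_zero.1 this.symm).resolve_right hne
  linarith

end types

/-! ### The symmetry algebra -/

section algebra

variable {f g : ℝ → ℝ} {U : Set (ℝ × ℝ)} {I : Set ℝ}

theorem isLiePointSymmetry_iff_exists (hU : IsOpen U) (hUc : IsConnected U) (hI : IsOpen I)
    (hIc : IsConnected I) (hf : ContDiffOn ℝ ∞ f I) (hg : ContDiffOn ℝ ∞ g I)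
    (hf0 : ∀ u ∈ I, f u ≠ 0) (hf' : ∃ u ∈ I, deriv f u ≠ 0) (V : PointField) :
    IsLiePointSymmetry f g U I V ↔ ∃ a b c A B : ℝ,
      EqOn V (scaleField a b c A B) (U ×ˢ I) ∧ Determining f g I a A B := by
  have key := isLiePointSymmetry_scaleField_iff hU hUc.nonempty hI hIc hf hg hf0
  constructor
  · intro hV
    obtain ⟨u₀, hu₀, hne⟩ := hf'
    have hd : deriv (fun v => (f v)⁻¹) u₀ ≠ 0 := by
      rw [((hasDerivAt_of_contDiffOn hI hf hu₀).fun_inv (hf0 u₀ hu₀)).deriv]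
      exact div_ne_zero (neg_ne_zero.2 hne) (pow_ne_zero 2 (hf0 u₀ hu₀))
    obtain ⟨a, b, c, A, B, h⟩ := hV.exists_scaleField hU hUc hI hIc.isPreconnected (hf.inv hf0) hg
      hf0 hu₀ hd
    exact ⟨a, b, c, A, B, h, (key a b c A B).1 (hV.congr hU hI h)⟩
  · rintro ⟨a, b, c, A, B, h, hD⟩
    exact ((key a b c A B).2 hD).congr hU hI h.symm

theorem scaleField_eqOn_zero (hU : IsOpen U) (hUn : U.Nonempty) (hI : IsOpen I)
    (hIn : I.Nonempty) {a b c A B : ℝ} (h : EqOn (scaleField a b c A B) 0 (U ×ˢ I)) :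
    a = 0 ∧ b = 0 ∧ c = 0 ∧ A = 0 ∧ B = 0 := by
  obtain ⟨p, hp⟩ := hUn
  obtain ⟨u, hu⟩ := hIn
  have h0 : (0 : PointField) = scaleField 0 0 0 0 0 := by
    funext p
    simp only [scaleField, zero_mul, add_zero]
    rfl
  have e : scaleField a b c A B = scaleField 0 0 0 0 0 :=
    scaleField_eq_of_eventuallyEq (p := (p, u)) (by
      rw [← h0]
      exact Filter.eventually_of_mem ((hU.prod hI).mem_nhds ⟨hp, hu⟩) h)
  -- The fields agree on the whole space, so the evaluation points need not lie in U × I.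
  have e0 := congrFun e ((0, 0), 0)
  have e1 := congrFun e ((1, 0), 1)
  simp only [scaleField, Prod.mk.injEq] at e0 e1
  obtain ⟨⟨hb, hc⟩, hB⟩ := e0
  obtain ⟨⟨ha, -⟩, hA⟩ := e1
  refine ⟨?_, ?_, ?_, ?_, ?_⟩ <;> linarith

theorem fieldT_eq : fieldT = scaleField 0 1 0 0 0 := by
  funext p; simp [fieldT, scaleField]

theorem fieldX_eq : fieldX = scaleField 0 0 1 0 0 := by
  funext p; simp [fieldX, scaleField]

theorem fieldU_eq : fieldU = scaleField 0 0 0 0 1 := by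
  funext p; simp [fieldU, scaleField]

theorem fieldDilU_eq (c : ℝ) : fieldDilU c = scaleField 0 0 0 1 (-c) := by
  funext p; simp [fieldDilU, scaleField, sub_eq_add_neg]

theorem fieldScale_eq (α c : ℝ) : fieldScale α c = scaleField 1 0 0 α (-α * c) := by
  funext p; simp [fieldScale, scaleField]; ring

theorem fieldShift_eq (α : ℝ) : fieldShift α = scaleField 1 0 0 0 α := by
  funext p; simp [fieldShift, scaleField]

theorem lieBracket_scaleField (a b c A B a' b' c' A' B' : ℝ) :
    VectorField.lieBracket ℝ (scaleField a b c A B) (scaleField a' b' c' A' B')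
      = scaleField 0 (a' * b - a * b') (a' * c - a * c') 0 (A' * B - A * B') := by
  have fd : ∀ (a b c A B : ℝ) (p v : (ℝ × ℝ) × ℝ),
      fderiv ℝ (scaleField a b c A B) p v = ((a * v.1.1, a * v.1.2), A * v.2) := by
    intro a b c A B p v
    have h1 : HasFDerivAt (fun p : (ℝ × ℝ) × ℝ => p.1.1)
        ((ContinuousLinearMap.fst ℝ ℝ ℝ).comp (ContinuousLinearMap.fst ℝ (ℝ × ℝ) ℝ)) p :=
      hasFDerivAt_fst.comp p hasFDerivAt_fst
    have h2 : HasFDerivAt (fun p : (ℝ × ℝ) × ℝ => p.1.2)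
        ((ContinuousLinearMap.snd ℝ ℝ ℝ).comp (ContinuousLinearMap.fst ℝ (ℝ × ℝ) ℝ)) p :=
      hasFDerivAt_snd.comp p hasFDerivAt_fst
    have h := ((((h1.const_mul a).add_const b).prodMk ((h2.const_mul a).add_const c)).prodMk
      (((hasFDerivAt_snd (𝕜 := ℝ) (p := p)).const_mul A).add_const B))
    change fderiv ℝ (fun p : (ℝ × ℝ) × ℝ => ((a * p.1.1 + b, a * p.1.2 + c), A * p.2 + B)) p v = _
    rw [h.fderiv]
    simp
  funext p
  rw [VectorField.lieBracket, fd, fd]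
  simp only [scaleField]
  refine Prod.ext (Prod.ext ?_ ?_) ?_ <;> simp only [Prod.fst_sub, Prod.snd_sub] <;> ring

theorem lieBracket_congr (hU : IsOpen U) (hI : IsOpen I) {V W V' W' : PointField}
    (hV : EqOn V V' (U ×ˢ I)) (hW : EqOn W W' (U ×ˢ I)) :
    EqOn (VectorField.lieBracket ℝ V W) (VectorField.lieBracket ℝ V' W') (U ×ˢ I) := fun p hp => by
  have hn := (hU.prod hI).mem_nhds hp
  rw [VectorField.lieBracket, VectorField.lieBracket,
    (Filter.eventuallyEq_of_mem hn hV).fderiv_eq,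
    (Filter.eventuallyEq_of_mem hn hW).fderiv_eq, hV hp, hW hp]

/-- If the solutions of the determining equations form a line, the symmetries have a basis of
two translations and one more vector field. -/
theorem isSymmetryBasis_three (hU : IsOpen U) (hUc : IsConnected U) (hI : IsOpen I)
    (hIc : IsConnected I) (hf : ContDiffOn ℝ ∞ f I) (hg : ContDiffOn ℝ ∞ g I)
    (hf0 : ∀ u ∈ I, f u ≠ 0) (hf' : ∃ u ∈ I, deriv f u ≠ 0) {a₀ A₀ B₀ : ℝ}
    (hne : a₀ ≠ 0 ∨ A₀ ≠ 0 ∨ B₀ ≠ 0)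
    (h : ∀ a A B, Determining f g I a A B ↔ ∃ r, a = r * a₀ ∧ A = r * A₀ ∧ B = r * B₀) :
    IsSymmetryBasis f g U I ![fieldT, fieldX, scaleField a₀ 0 0 A₀ B₀] := by
  have comb : ∀ (r : Fin 3 → ℝ) (p : (ℝ × ℝ) × ℝ),
      ∑ i, r i • (![fieldT, fieldX, scaleField a₀ 0 0 A₀ B₀] : Fin 3 → PointField) i p
        = scaleField (r 2 * a₀) (r 0) (r 1) (r 2 * A₀) (r 2 * B₀) p := fun r p => by
    simp only [Fin.sum_univ_three, Matrix.cons_val_zero, Matrix.cons_val_one, Matrix.cons_val]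
    simp only [fieldT, fieldX, scaleField]
    refine Prod.ext (Prod.ext ?_ ?_) ?_ <;>
      simp only [Prod.fst_add, Prod.snd_add, Prod.smul_fst, Prod.smul_snd, smul_eq_mul] <;> ring
  refine ⟨?_, fun V => ?_⟩
  · rw [Fintype.linearIndependent_iff]
    intro r hr
    obtain ⟨h1, h2, h3, h4, h5⟩ := scaleField_eqOn_zero hU hUc.nonempty hI hIc.nonempty
      (a := r 2 * a₀) (b := r 0) (c := r 1) (A := r 2 * A₀) (B := r 2 * B₀) fun p hp => by
        rw [← comb]
        simpa [Finset.sum_apply] using congrFun hr ⟨p, hp⟩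
    have h6 : r 2 = 0 := by
      rcases hne with hne | hne | hne
      · exact (mul_eq_zero.1 h1).resolve_right hne
      · exact (mul_eq_zero.1 h4).resolve_right hne
      · exact (mul_eq_zero.1 h5).resolve_right hne
    intro i
    fin_cases i
    · exact h2
    · exact h3
    · exact h6
  · rw [isLiePointSymmetry_iff_exists hU hUc hI hIc hf hg hf0 hf']
    constructor
    · rintro ⟨a, b, c, A, B, hV, hD⟩
      obtain ⟨r, rfl, rfl, rfl⟩ := (h a A B).1 hD
      refine ⟨![b, c, r], fun p hp => ?_⟩
      refine (hV hp).trans ((comb _ p).trans ?_).symm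
      simp
    · rintro ⟨r, hr⟩
      exact ⟨r 2 * a₀, r 0, r 1, r 2 * A₀, r 2 * B₀, fun p hp => (hr hp).trans (comb r p),
        (h _ _ _).2 ⟨r 2, rfl, rfl, rfl⟩⟩

theorem isBasisA33_of_determining (hU : IsOpen U) (hUc : IsConnected U) (hI : IsOpen I)
    (hIc : IsConnected I) (hf : ContDiffOn ℝ ∞ f I) (hg : ContDiffOn ℝ ∞ g I)
    (hf0 : ∀ u ∈ I, f u ≠ 0) (hf' : ∃ u ∈ I, deriv f u ≠ 0) {A₀ B₀ : ℝ}
    (h : ∀ a A B, Determining f g I a A B ↔ A = a * A₀ ∧ B = a * B₀) :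
    IsBasisA33 f g U I ![fieldT, fieldX, scaleField 1 0 0 A₀ B₀] := by
  refine ⟨isSymmetryBasis_three hU hUc hI hIc hf hg hf0 hf' (by simp) fun a A B => ?_, ?_, ?_, ?_⟩
  · rw [h]
    simp
  all_goals
    intro p _
    simp only [Matrix.cons_val_zero, Matrix.cons_val_one, Matrix.cons_val]
    simp only [fieldT_eq, fieldX_eq, lieBracket_scaleField]
    simp [scaleField]

theorem isBasis3A1_of_determining (hU : IsOpen U) (hUc : IsConnected U) (hI : IsOpen I)
    (hIc : IsConnected I) (hf : ContDiffOn ℝ ∞ f I) (hg : ContDiffOn ℝ ∞ g I)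
    (hf0 : ∀ u ∈ I, f u ≠ 0) (hf' : ∃ u ∈ I, deriv f u ≠ 0) {A₀ B₀ : ℝ} (hne : A₀ ≠ 0 ∨ B₀ ≠ 0)
    (h : ∀ a A B, Determining f g I a A B ↔ a = 0 ∧ ∃ r, A = r * A₀ ∧ B = r * B₀) :
    IsBasis3A1 f g U I ![fieldT, fieldX, scaleField 0 0 0 A₀ B₀] := by
  refine ⟨isSymmetryBasis_three hU hUc hI hIc hf hg hf0 hf' (Or.inr hne) fun a A B => ?_,
    ?_, ?_, ?_⟩
  · rw [h]
    simp
  all_goals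
    intro p _
    simp only [Matrix.cons_val_zero, Matrix.cons_val_one, Matrix.cons_val]
    simp only [fieldT_eq, fieldX_eq, lieBracket_scaleField]
    simp [scaleField]

theorem isBasis2A1_of_determining (hU : IsOpen U) (hUc : IsConnected U) (hI : IsOpen I)
    (hIc : IsConnected I) (hf : ContDiffOn ℝ ∞ f I) (hg : ContDiffOn ℝ ∞ g I)
    (hf0 : ∀ u ∈ I, f u ≠ 0) (hf' : ∃ u ∈ I, deriv f u ≠ 0)
    (h : ∀ a A B, Determining f g I a A B → a = 0 ∧ A = 0 ∧ B = 0) :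
    IsBasis2A1 f g U I ![fieldT, fieldX] := by
  have comb : ∀ (r : Fin 2 → ℝ) (p : (ℝ × ℝ) × ℝ),
      ∑ i, r i • (![fieldT, fieldX] : Fin 2 → PointField) i p
        = scaleField 0 (r 0) (r 1) 0 0 p := fun r p => by
    simp [Fin.sum_univ_two, fieldT, fieldX, scaleField]
  refine ⟨⟨?_, fun V => ?_⟩, fun p _ => ?_⟩
  · rw [Fintype.linearIndependent_iff]
    intro r hr
    obtain ⟨-, h2, h3, -, -⟩ := scaleField_eqOn_zero hU hUc.nonempty hI hIc.nonempty
      (a := 0) (b := r 0) (c := r 1) (A := 0) (B := 0) fun p hp => by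
        rw [← comb]
        simpa [Finset.sum_apply] using congrFun hr ⟨p, hp⟩
    intro i
    fin_cases i
    · exact h2
    · exact h3
  · rw [isLiePointSymmetry_iff_exists hU hUc hI hIc hf hg hf0 hf']
    constructor
    · rintro ⟨a, b, c, A, B, hV, hD⟩
      obtain ⟨rfl, rfl, rfl⟩ := h a A B hD
      refine ⟨![b, c], fun p hp => ?_⟩
      refine (hV hp).trans ((comb _ p).trans ?_).symm
      simp
    · rintro ⟨r, hr⟩
      exact ⟨0, r 0, r 1, 0, 0, fun p hp => (hr hp).trans (comb r p), 0, fun u _ => by simp⟩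
  · simp only [Matrix.cons_val_zero, Matrix.cons_val_one]
    simp only [fieldT_eq, fieldX_eq, lieBracket_scaleField]
    simp [scaleField]

/-- The algebra `A₃,₃` requires a symmetry that scales `t` and `x`. -/
theorem IsBasisA33.exists_determining (hU : IsOpen U) (hUc : IsConnected U) (hI : IsOpen I)
    (hIc : IsConnected I) (hf : ContDiffOn ℝ ∞ f I) (hg : ContDiffOn ℝ ∞ g I)
    (hf0 : ∀ u ∈ I, f u ≠ 0) (hf' : ∃ u ∈ I, deriv f u ≠ 0) {e : Fin 3 → PointField}
    (he : IsBasisA33 f g U I e) : ∃ a A B, Determining f g I a A B ∧ a ≠ 0 := by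
  -- If a = 0 throughout, every bracket is a multiple of ∂ᵤ. Then [e₀, e₂] = e₀ and [e₁, e₂] = e₁
  -- make e₀ and e₁ both multiples of ∂ᵤ, against linear independence.
  by_contra! hno
  obtain ⟨⟨hlin, hspan⟩, h01, h02, h12⟩ := he
  have form : ∀ i, ∃ b c A B : ℝ, EqOn (e i) (scaleField 0 b c A B) (U ×ˢ I) := fun i => by
    have hs : IsLiePointSymmetry f g U I (e i) :=
      (hspan (e i)).2 ⟨Pi.single i 1, fun p _ => by simp [Pi.single_apply]⟩
    obtain ⟨a, b, c, A, B, h, hD⟩ :=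
      (isLiePointSymmetry_iff_exists hU hUc hI hIc hf hg hf0 hf' (e i)).1 hs
    exact ⟨b, c, A, B, hno a A B hD ▸ h⟩
  choose b c A B hform using form
  have zero := fun {a b c A B : ℝ} (h : EqOn (scaleField a b c A B) 0 (U ×ˢ I)) =>
    scaleField_eqOn_zero hU hUc.nonempty hI hIc.nonempty h
  have br : ∀ i j, EqOn (VectorField.lieBracket ℝ (e i) (e j))
      (scaleField 0 0 0 0 (A j * B i - A i * B j)) (U ×ˢ I) := fun i j p hp => by
    rw [lieBracket_congr hU hI (hform i) (hform j) hp, lieBracket_scaleField]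
    simp
  have vert : ∀ i, EqOn (VectorField.lieBracket ℝ (e i) (e 2)) (e i) (U ×ˢ I) →
      b i = 0 ∧ c i = 0 ∧ A i = 0 := fun i hi => by
    have hz : EqOn (scaleField 0 (b i) (c i) (A i) (B i - (A 2 * B i - A i * B 2))) 0
        (U ×ˢ I) := fun p hp => by
      have e1 := (br i 2 hp).symm.trans ((hi hp).trans (hform i hp))
      simp only [scaleField, Prod.mk.injEq] at e1 ⊢
      obtain ⟨⟨e1, e2⟩, e3⟩ := e1
      refine Prod.ext (Prod.ext ?_ ?_) ?_ <;>
        simp only [Pi.zero_apply, Prod.fst_zero, Prod.snd_zero] <;> linarith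
    obtain ⟨-, h1, h2, h3, -⟩ := zero hz
    exact ⟨h1, h2, h3⟩
  obtain ⟨hb0, hc0, hA0⟩ := vert 0 h02
  obtain ⟨hb1, hc1, hA1⟩ := vert 1 h12
  have f0 : EqOn (e 0) (scaleField 0 0 0 0 (B 0)) (U ×ˢ I) := by
    simpa only [hb0, hc0, hA0] using hform 0
  have f1 : EqOn (e 1) (scaleField 0 0 0 0 (B 1)) (U ×ˢ I) := by
    simpa only [hb1, hc1, hA1] using hform 1
  rw [Fintype.linearIndependent_iff] at hlin
  -- With e₀ = B₀ ∂ᵤ and e₁ = B₁ ∂ᵤ, the combination B₁ e₀ - B₀ e₁ vanishes. So B₀ = 0, and then e₀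
  -- = 0.
  have k1 := hlin ![B 1, -B 0, 0] (by
    funext p
    have e0 := f0 p.2
    have e1 := f1 p.2
    simp only [Fin.sum_univ_three, Matrix.cons_val_zero, Matrix.cons_val_one, Matrix.cons_val,
      Pi.add_apply, Pi.smul_apply, Set.domRestrict_apply, e0, e1, scaleField]
    refine Prod.ext (Prod.ext ?_ ?_) ?_ <;> simp [mul_comm])
  have hB0 : B 0 = 0 := by simpa using k1 1
  have k2 := hlin ![1, 0, 0] (by
    funext p
    have e0 := f0 p.2
    simp [Fin.sum_univ_three, e0, scaleField, hB0])
  simpa using k2 0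

/-- The classification of the coefficient functions that admit a further symmetry. -/
theorem Determining.classification (hI : IsOpen I) (hIc : IsConnected I)
    (hf : ContDiffOn ℝ ∞ f I) (hg : ContDiffOn ℝ ∞ g I)
    (hf0 : ∀ u ∈ I, f u ≠ 0) (hf' : ∃ u ∈ I, deriv f u ≠ 0) (hg' : ∃ u ∈ I, deriv g u ≠ 0)
    {a A B : ℝ} (h : Determining f g I a A B) :
    (a = 0 ∧ A = 0 ∧ B = 0) ∨
    (a ≠ 0 ∧ ((∃ c K α : ℝ, FamilyA f g I c K α) ∨ (∃ c K : ℝ, FamilyB f g I c K) ∨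
      (∃ K α : ℝ, FamilyC f g I K α) ∨ (∃ K : ℝ, FamilyD f g I K))) ∨
    (a = 0 ∧ ((∃ c : ℝ, DegeneratePower f g I c) ∨ DegenerateExp f g I)) := by
  by_cases hA : A = 0
  · subst hA
    by_cases hB : B = 0
    · subst hB
      exact Or.inl ⟨h.eq_zero hf0 hg', rfl, rfl⟩
    obtain ⟨K, m, hT, hm⟩ := h.expType hB
    refine Or.inr ?_
    by_cases ha : a = 0
    · refine Or.inr ⟨ha, Or.inr ?_⟩
      have hmK : m = -K := by
        have : m + K = 0 := (mul_eq_zero.1 (by rw [hm, ha, mul_zero])).resolve_right hB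
        linarith
      have hm0 : m ≠ 0 := by
        rw [hmK]
        exact neg_ne_zero.2 (hT.ne_zero hf')
      obtain ⟨f₀, g₀, g₁, hfg⟩ := hT.exists_exp hI hIc hf hg hm0
      exact ⟨K, f₀, g₀, g₁, by simpa only [hmK] using hfg⟩
    · refine Or.inl ⟨ha, Or.inr (Or.inr ?_)⟩
      have hs : m + K ≠ 0 := fun e => ha (by rw [e] at hm; linarith)
      by_cases hm0 : m = 0
      · subst hm0
        exact Or.inr ⟨K, hT.exists_linear hI hIc hf hg⟩
      · obtain ⟨f₀, g₀, g₁, hfg⟩ := hT.exists_exp hI hIc hf hg hm0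
        -- This α solves -(K + 2/α) = m; it equals B / a.
        refine Or.inl ⟨K, -2 / (m + K), div_ne_zero (by simp) hs, f₀, g₀, g₁, ?_⟩
        have e : -(K + 2 / (-2 / (m + K))) = m := by field_simp; ring
        rwa [e]
  · obtain ⟨c, K, m, hT, hm⟩ := h.powerType hI hf hf0 hf' hA
    refine Or.inr ?_
    by_cases ha : a = 0
    · refine Or.inr ⟨ha, Or.inl ⟨c, hT.1, ?_⟩⟩
      have hmK : m = -K := by
        have : m + K = 0 := (mul_eq_zero.1 (by rw [hm, ha, mul_zero])).resolve_right hA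
        linarith
      by_cases hm1 : m = -1
      · subst hm1
        obtain ⟨f₀, g₀, g₁, hfg⟩ := hT.exists_log hI hIc hf hg
        have hK : K = 1 := by linarith
        exact ⟨f₀, g₀, g₁, Or.inr (by simpa only [hK, Real.rpow_one] using hfg)⟩
      · obtain ⟨f₀, g₀, g₁, hfg⟩ := hT.exists_rpow hI hIc hf hg hm1
        have e : m + 1 = 1 - K := by linarith
        exact ⟨f₀, g₀, g₁, Or.inl ⟨K, by rwa [e] at hfg⟩⟩
    · refine Or.inl ⟨ha, ?_⟩
      have hs : m + K ≠ 0 := fun e => ha (by rw [e] at hm; linarith)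
      by_cases hm1 : m = -1
      · subst hm1
        exact Or.inr (Or.inl ⟨c, K, hT.1, fun e => hs (by rw [e]; ring),
          hT.exists_log hI hIc hf hg⟩)
      · obtain ⟨f₀, g₀, g₁, hfg⟩ := hT.exists_rpow hI hIc hf hg hm1
        -- This α solves -2/α - (K - 1) = m + 1; it equals A / a.
        refine Or.inl ⟨c, K, -2 / (m + K), hT.1, div_ne_zero (by simp) hs, f₀, g₀, g₁, ?_⟩
        have e : -2 / (-2 / (m + K)) - (K - 1) = m + 1 := by field_simp; ring
        rwa [e]

end algebra

end Zoomeron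

/-! ### The classification -/

theorem proposition1 (f g : ℝ → ℝ) (U : Set (ℝ × ℝ)) (I : Set ℝ)
    (hUo : IsOpen U) (hUc : IsConnected U) (hIo : IsOpen I) (hIc : IsConnected I)
    (hf : ContDiffOn ℝ ∞ f I) (hg : ContDiffOn ℝ ∞ g I) (hf0 : ∀ u ∈ I, f u ≠ 0)
    (hfc : ¬ ∃ c : ℝ, ∀ u ∈ I, f u = c) (hgc : ¬ ∃ c : ℝ, ∀ u ∈ I, g u = c) :
    -- `∂ₜ` and `∂ₓ` are always symmetries, and they commute
    (IsLiePointSymmetry f g U I fieldT ∧ IsLiePointSymmetry f g U I fieldX ∧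
      EqOn (VectorField.lieBracket ℝ fieldT fieldX) 0 (U ×ˢ I)) ∧
    -- the four families with a scaling symmetry: the symmetry algebra is `A₃,₃`
    (∀ c K α : ℝ, FamilyA f g I c K α →
      IsBasisA33 f g U I ![fieldT, fieldX, fieldScale α c]) ∧
    (∀ c K : ℝ, FamilyB f g I c K →
      IsBasisA33 f g U I ![fieldT, fieldX, fieldScale (2 / (1 - K)) c]) ∧
    (∀ K α : ℝ, FamilyC f g I K α →
      IsBasisA33 f g U I ![fieldT, fieldX, fieldShift α]) ∧
    (∀ K : ℝ, FamilyD f g I K →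
      IsBasisA33 f g U I ![fieldT, fieldX, fieldShift (-2 / K)]) ∧
    -- `A₃,₃` occurs for no other coefficient functions
    ((∃ e : Fin 3 → PointField, IsBasisA33 f g U I e) ↔
      (∃ c K α : ℝ, FamilyA f g I c K α) ∨ (∃ c K : ℝ, FamilyB f g I c K) ∨
      (∃ K α : ℝ, FamilyC f g I K α) ∨ (∃ K : ℝ, FamilyD f g I K)) ∧
    -- the degenerate limits of the families
    (∀ c : ℝ, DegeneratePower f g I c →
      IsBasis3A1 f g U I ![fieldT, fieldX, fieldDilU c]) ∧
    (DegenerateExp f g I → IsBasis3A1 f g U I ![fieldT, fieldX, fieldU]) ∧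
    -- in all other cases the symmetry algebra is `2A₁`, spanned by `∂ₜ` and `∂ₓ`
    ((¬ ∃ c K α : ℝ, FamilyA f g I c K α) → (¬ ∃ c K : ℝ, FamilyB f g I c K) →
      (¬ ∃ K α : ℝ, FamilyC f g I K α) → (¬ ∃ K : ℝ, FamilyD f g I K) →
      (¬ ∃ c : ℝ, DegeneratePower f g I c) → ¬ DegenerateExp f g I →
      IsBasis2A1 f g U I ![fieldT, fieldX]) := by
  have hf' := exists_deriv_ne_zero hIo hIc hf hfc
  have hg' := exists_deriv_ne_zero hIo hIc hg hgc
  have sym := isLiePointSymmetry_iff_exists hUo hUc hIo hIc hf hg hf0 hf'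
  have trivialSol : Determining f g I 0 0 0 := ⟨0, fun u _ => by simp⟩
  have basisA33 := fun {A₀ B₀ : ℝ} => isBasisA33_of_determining (A₀ := A₀) (B₀ := B₀)
    hUo hUc hIo hIc hf hg hf0 hf'
  have basis3A1 := fun {A₀ B₀ : ℝ} => isBasis3A1_of_determining (A₀ := A₀) (B₀ := B₀)
    hUo hUc hIo hIc hf hg hf0 hf'
  have power := fun {c K m a A B : ℝ} (h : PowerType f g I c K m) =>
    h.determining_iff (a := a) (A := A) (B := B) hIo hIc.nonempty hf0 hf' hg'
  have expo := fun {K m a A B : ℝ} (h : ExpType f g I K m) =>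
    h.determining_iff (a := a) (A := A) (B := B) hIo hIc.nonempty hf0 hf' hg'
  have famA : ∀ c K α : ℝ, FamilyA f g I c K α →
      IsBasisA33 f g U I ![fieldT, fieldX, fieldScale α c] := by
    rintro c K α ⟨hc, hα, f₀, g₀, g₁, h⟩
    rw [fieldScale_eq]
    refine basisA33 fun a A B => ?_
    rw [power (PowerType.of_rpow hIo hg hc h)]
    -- The exponent of g is m + 1, so m + K = -2/α here.
    have e : (-2 / α - (K - 1) - 1 + K) * A = -2 * a ↔ A = a * α := by
      constructor <;> intro h
      · field_simp at h
        linarith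
      · rw [h]
        field_simp
        ring
    rw [e]
    constructor
    · rintro ⟨rfl, rfl⟩
      exact ⟨rfl, by ring⟩
    · rintro ⟨rfl, rfl⟩
      exact ⟨by ring, rfl⟩
  have famB : ∀ c K : ℝ, FamilyB f g I c K →
      IsBasisA33 f g U I ![fieldT, fieldX, fieldScale (2 / (1 - K)) c] := by
    rintro c K ⟨hc, hK, f₀, g₀, g₁, h⟩
    have hK' : 1 - K ≠ 0 := sub_ne_zero.2 hK.symm
    rw [fieldScale_eq]
    refine basisA33 fun a A B => ?_
    rw [power (PowerType.of_log hIo hg hc h)]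
    have e : (-1 + K) * A = -2 * a ↔ A = a * (2 / (1 - K)) := by
      rw [mul_div_assoc', eq_div_iff hK']
      constructor <;> intro h <;> linarith
    rw [e]
    constructor
    · rintro ⟨rfl, rfl⟩
      exact ⟨rfl, by ring⟩
    · rintro ⟨rfl, rfl⟩
      exact ⟨by ring, rfl⟩
  have famC : ∀ K α : ℝ, FamilyC f g I K α →
      IsBasisA33 f g U I ![fieldT, fieldX, fieldShift α] := by
    rintro K α ⟨hα, f₀, g₀, g₁, h⟩
    rw [fieldShift_eq]
    refine basisA33 fun a A B => ?_
    rw [expo (ExpType.of_exp hIo hg h), mul_zero]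
    refine and_congr_right fun _ => ?_
    constructor <;> intro h
    · field_simp at h
      linarith
    · rw [h]
      field_simp
      ring
  have famD : ∀ K : ℝ, FamilyD f g I K →
      IsBasisA33 f g U I ![fieldT, fieldX, fieldShift (-2 / K)] := by
    rintro K ⟨f₀, g₀, g₁, h⟩
    have hT := ExpType.of_linear hIo hg h
    -- K ≠ 0 because f is not constant; otherwise -2 / K would be the default value 0.
    have hK := hT.ne_zero hf'
    rw [fieldShift_eq]
    refine basisA33 fun a A B => ?_
    rw [expo hT, mul_zero, zero_add, mul_div_assoc', eq_div_iff hK]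
    refine and_congr_right fun _ => ?_
    constructor <;> intro h <;> linarith
  refine ⟨⟨?_, ?_, ?_⟩, famA, famB, famC, famD, ⟨?_, ?_⟩, ?_, ?_, ?_⟩
  · exact (sym _).2 ⟨0, 1, 0, 0, 0, fieldT_eq ▸ eqOn_refl _ _, trivialSol⟩
  · exact (sym _).2 ⟨0, 0, 1, 0, 0, fieldX_eq ▸ eqOn_refl _ _, trivialSol⟩
  · intro p _
    rw [fieldT_eq, fieldX_eq, lieBracket_scaleField]
    simp [scaleField]
  · rintro ⟨e, he⟩
    obtain ⟨a, A, B, hD, ha⟩ := he.exists_determining hUo hUc hIo hIc hf hg hf0 hf'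
    rcases hD.classification hIo hIc hf hg hf0 hf' hg' with h | h | h
    · exact absurd h.1 ha
    · exact h.2
    · exact absurd h.1 ha
  · rintro (⟨c, K, α, h⟩ | ⟨c, K, h⟩ | ⟨K, α, h⟩ | ⟨K, h⟩)
    · exact ⟨_, famA c K α h⟩
    · exact ⟨_, famB c K h⟩
    · exact ⟨_, famC K α h⟩
    · exact ⟨_, famD K h⟩
  · rintro c ⟨hc, f₀, g₀, g₁, h⟩
    -- Both degenerate forms satisfy m = -K; the logarithm is the case K = 1, m = -1.
    have hT : ∃ K, PowerType f g I c K (-K) := by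
      rcases h with ⟨K, h⟩ | h
      · refine ⟨K, ?_⟩
        have := PowerType.of_rpow hIo hg hc h
        rwa [show 1 - K - 1 = -K by ring] at this
      · exact ⟨1, PowerType.of_log hIo hg hc (f₀ := f₀) (g₀ := g₀) (g₁ := g₁)
          (by simpa only [Real.rpow_one] using h)⟩
    obtain ⟨K, hT⟩ := hT
    rw [fieldDilU_eq]
    refine basis3A1 (by simp) fun a A B => ?_
    rw [power hT]
    constructor
    · rintro ⟨rfl, h⟩
      exact ⟨by linarith, A, by ring, by ring⟩
    · rintro ⟨rfl, r, rfl, rfl⟩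
      exact ⟨by ring, by ring⟩
  · rintro ⟨K, f₀, g₀, g₁, h⟩
    rw [fieldU_eq]
    refine basis3A1 (by simp) fun a A B => ?_
    rw [expo (ExpType.of_exp hIo hg h)]
    constructor
    · rintro ⟨rfl, h⟩
      exact ⟨by linarith, B, by ring, by ring⟩
    · rintro ⟨rfl, r, rfl, rfl⟩
      exact ⟨by ring, by ring⟩
  · intro hA hB hC hD hP hE
    refine isBasis2A1_of_determining hUo hUc hIo hIc hf hg hf0 hf' fun a A B h => ?_
    rcases h.classification hIo hIc hf hg hf0 hf' hg' with h | ⟨-, h⟩ | ⟨-, h⟩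
    · exact h
    · rcases h with h | h | h | h
      · exact absurd h hA
      · exact absurd h hB
      · exact absurd h hC
      · exact absurd h hD
    · rcases h with h | h
      · exact absurd h hP
      · exact absurd h hE
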